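/- Let $\mathbb K\in\{\mathbb R,\mathbb C\}$, let $M$ be a smooth $n$-dimensional manifold (Hausdorff, second countable, without boundary) and let $r,s\ge 0$. Write $C^\infty(M)$ for the algebra of smooth $\mathbb K$-valued functions, $\mathrm T^r_s(M)$ for the bundle of $\mathbb K$-valued tensors with $r$ contravariant and $s$ covariant indices, $\mathcal T^r_s(M)=\Gamma(\mathrm T^r_s(M))$ for the space of its smooth sections, and $\mathrm{Vol}(M)$ for the bundle of $1$-densities (transition functions: absolute values of Jacobian determinants). For a vector bundle $E$, $\Gamma(E)$ carries the Fréchet topology of uniform convergence of all derivatives of local representations on compact sets, $\Gamma_{c,K}(E)$ (sections supported in the compact set $K$) the subspace topology, and $\Gamma_c(E)$ the finest locally convex topology for which all inclusions $\Gamma_{c,K}(E)\to\Gamma_c(E)$ are continuous. Put $\mathcal D'(M)=\Gamma_c(\mathrm{Vol}(M))'$ and $\mathcal D'^r_s(M)=\Gamma_c(\mathrm T^s_r(M)\otimes\mathrm{Vol}(M))'$, where $'$ denotes the strong dual. On these duals $C^\infty(M)$ acts by $\langle fT,\omega\rangle=\langle T,f\omega\rangle$. For locally convex spaces $E,F$ with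 a $C^\infty(M)$-module structure, let $E\otimes_\beta F$ be the tensor product over $\mathbb K$ with the finest locally convex topology for which $\otimes\colon E\times F\to E\otimes F$ is bounded, and let $E\otimes^\beta_{C^\infty(M)}F$ be its quotient by the closure of the subgroup generated by all $fx\otimes y-x\otimes fy$ with $f\in C^\infty(M)$, $x\in E$, $y\in F$, with the quotient topology and the module structure $f\cdot(x\otimes y)=fx\otimes y$. Let $\mathrm L^b_{C^\infty(M)}(E,F)$ be the module of bounded $C^\infty(M)$-linear maps $E\to F$ with the topology of uniform convergence on bounded sets. "Bounded" refers to the von Neumann bornology. **Theorem 7.3.** There are isomorphisms of $C^\infty(M)$-modules $$\mathcal D'^r_s(M)\;\cong\;\bigl(\mathcal T^s_r(M)\otimes^\beta_{C^\infty(M)}\Gamma_c(\mathrm{Vol}(M))\bigr)'\;\cong\;\mathrm L^b_{C^\infty(M)}\bigl(\mathcal T^s_r(M),\mathcal D'(M)\bigr)\;\cong\;\mathcal T^r_s(M)\otimes^\beta_{C^\infty(M)}\mathcal D'(M),$$ each of which is bornological, i.e. maps bounded sets to bounded sets in both directions. They can be taken to be the canonical ones: the first sends $T$ to the functional $t\otimes\omega\mapsto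 T(t\otimes\omega)$, where on the right $t\otimes\omega$ is the pointwise tensor product, the second sends $S$ to $t\mapsto[\omega\mapsto S(t\otimes\omega)]$, and the inverse of the third sends $u\otimes v$ to $t\mapsto (u\cdot t)\,v$, where $u\cdot t\in C^\infty(M)$ is the contraction of $u$ with $t$. -/

import Mathlib

open scoped ContDiff Manifold TensorProduct Kronecker
open Bornology

noncomputable section

namespace TensorDist

/-! ### Bounded maps and bornological isomorphisms

Boundedness is always taken with respect to the von Neumann bornology. Locally convex topologies over
`𝕜` are the topologies generated by a family of `𝕜`-seminorms, `PolynormableSpace 𝕜 E`. -/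

/-- A map between topological vector spaces is bounded if it maps bounded sets to bounded sets. -/
def IsBoundedMap (𝕜 : Type*) [RCLike 𝕜] {E F : Type*}
    [AddCommGroup E] [Module 𝕜 E] [TopologicalSpace E]
    [AddCommGroup F] [Module 𝕜 F] [TopologicalSpace F] (f : E → F) : Prop :=
  ∀ B : Set E, IsVonNBounded 𝕜 B → IsVonNBounded 𝕜 (f '' B)

/-- A module isomorphism is bornological if it is bounded together with its inverse. -/
def IsBornologicalIso (𝕜 : Type*) [RCLike 𝕜] {A : Type*} [Semiring A] {E F : Type*}
    [AddCommGroup E] [Module 𝕜 E] [TopologicalSpace E] [Module A E]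
    [AddCommGroup F] [Module 𝕜 F] [TopologicalSpace F] [Module A F] (e : E ≃ₗ[A] F) : Prop :=
  IsBoundedMap 𝕜 e ∧ IsBoundedMap 𝕜 e.symm

theorem isVonNBounded_induced {𝕜 : Type*} [RCLike 𝕜] {E F : Type*} [AddCommGroup E] [Module 𝕜 E]
    [AddCommGroup F] [Module 𝕜 F] [t : TopologicalSpace F] (f : E →ₗ[𝕜] F) {B : Set E}
    (hB : IsVonNBounded 𝕜 (f '' B)) :
    @IsVonNBounded 𝕜 E _ _ _ (TopologicalSpace.induced f t) B := by
  let := TopologicalSpace.induced f t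
  intro V hV
  rw [nhds_induced, map_zero, Filter.mem_comap] at hV
  obtain ⟨U, hU, hUV⟩ := hV
  refine Absorbs.mono_left ?_ hUV
  filter_upwards [hB hU, eventually_ne_cobounded (0 : 𝕜)] with a ha ha0 x hx
  rw [Set.mem_smul_set_iff_inv_smul_mem₀ ha0]
  have := ha ⟨x, hx, rfl⟩
  rw [Set.mem_smul_set_iff_inv_smul_mem₀ ha0] at this
  simpa using this

theorem isBoundedMap_of_continuous {𝕜 : Type*} [RCLike 𝕜] {E F : Type*}
    [AddCommGroup E] [Module 𝕜 E] [TopologicalSpace E] [AddCommGroup F] [Module 𝕜 F]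
    [TopologicalSpace F] (f : E →L[𝕜] F) : IsBoundedMap 𝕜 f :=
  fun _ hB => hB.image f

/-! ### The space of bounded module homomorphisms -/

section BoundedHom

variable (𝕜 A E F : Type*) [RCLike 𝕜] [CommRing A] [Algebra 𝕜 A]
  [AddCommGroup E] [Module 𝕜 E] [Module A E] [IsScalarTower 𝕜 A E] [TopologicalSpace E]
  [AddCommGroup F] [Module 𝕜 F] [Module A F] [IsScalarTower 𝕜 A F] [TopologicalSpace F]
  [IsTopologicalAddGroup F] [ContinuousSMul 𝕜 F] [ContinuousConstSMul A F]


/-- The bounded `A`-linear maps `E → F`, as a submodule of all `A`-linear maps. -/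
def boundedHomSubmodule : Submodule A (E →ₗ[A] F) where
  carrier := {l | IsBoundedMap 𝕜 l}
  zero_mem' := fun B _ => (isVonNBounded_singleton (𝕜 := 𝕜) (0 : F)).subset (by
    rintro _ ⟨x, _, rfl⟩; simp)
  add_mem' := fun {l l'} hl hl' B hB => ((hl B hB).add (hl' B hB)).subset (by
    rintro _ ⟨x, hx, rfl⟩; exact Set.add_mem_add ⟨x, hx, rfl⟩ ⟨x, hx, rfl⟩)
  smul_mem' := fun a l hl B hB => by
    have h := (hl B hB).image (σ := RingHom.id 𝕜)
      ({ toFun := fun y => a • y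
         map_add' := smul_add a
         map_smul' := fun c y => smul_comm a c y
         cont := continuous_const_smul a } : F →L[𝕜] F)
    refine h.subset ?_
    rintro _ ⟨x, hx, rfl⟩
    exact ⟨l x, ⟨x, hx, rfl⟩, rfl⟩

/-- The space of bounded `A`-linear maps `E → F`. -/
def BoundedHom : Type _ := boundedHomSubmodule 𝕜 A E F

instance : AddCommGroup (BoundedHom 𝕜 A E F) :=
  inferInstanceAs (AddCommGroup (boundedHomSubmodule 𝕜 A E F))
instance : Module A (BoundedHom 𝕜 A E F) :=
  inferInstanceAs (Module A (boundedHomSubmodule 𝕜 A E F))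
instance : Module 𝕜 (BoundedHom 𝕜 A E F) :=
  inferInstanceAs (Module 𝕜 (boundedHomSubmodule 𝕜 A E F))

variable {𝕜 A E F} in
/-- The underlying linear map of a bounded homomorphism. -/
def BoundedHom.toLin (l : BoundedHom 𝕜 A E F) : E →ₗ[A] F := l.1

/-- The topology of uniform convergence on bounded sets. -/
instance : TopologicalSpace (BoundedHom 𝕜 A E F) :=
  letI : UniformSpace F := IsTopologicalAddGroup.rightUniformSpace F
  TopologicalSpace.induced
    (fun l => UniformOnFun.ofFun {B : Set E | IsVonNBounded 𝕜 B} l.toLin) inferInstance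

end BoundedHom

/-! ### The bornological tensor product -/

section BornTensor

/-- The algebraic tensor product of two locally convex spaces, as the carrier of the bornological
tensor product. -/
def BornTensorBase (𝕜 E F : Type*) [RCLike 𝕜] [AddCommGroup E] [Module 𝕜 E]
    [AddCommGroup F] [Module 𝕜 F] : Type _ := E ⊗[𝕜] F

variable (𝕜 A E F : Type*) [RCLike 𝕜] [CommRing A] [Algebra 𝕜 A]
  [AddCommGroup E] [Module 𝕜 E] [Module A E] [IsScalarTower 𝕜 A E] [TopologicalSpace E]
  [AddCommGroup F] [Module 𝕜 F] [Module A F] [IsScalarTower 𝕜 A F] [TopologicalSpace F]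

instance : AddCommGroup (BornTensorBase 𝕜 E F) := inferInstanceAs (AddCommGroup (E ⊗[𝕜] F))
instance : Module 𝕜 (BornTensorBase 𝕜 E F) := inferInstanceAs (Module 𝕜 (E ⊗[𝕜] F))
/-- `A` acts through the first factor. -/
instance : Module A (BornTensorBase 𝕜 E F) := inferInstanceAs (Module A (E ⊗[𝕜] F))
instance : IsScalarTower 𝕜 A (BornTensorBase 𝕜 E F) :=
  inferInstanceAs (IsScalarTower 𝕜 A (E ⊗[𝕜] F))

variable {E F} in
/-- The elementary tensor `x ⊗ y`. -/
def baseTmul (x : E) (y : F) : BornTensorBase 𝕜 E F := x ⊗ₜ[𝕜] y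

/-- The finest locally convex topology for which `(x, y) ↦ x ⊗ y` is bounded. -/
instance : TopologicalSpace (BornTensorBase 𝕜 E F) :=
  sInf {t | @PolynormableSpace 𝕜 (BornTensorBase 𝕜 E F) _ _ _ t ∧
    @IsBoundedMap 𝕜 _ (E × F) (BornTensorBase 𝕜 E F) _ _ _ _ _ t
      (fun p => baseTmul 𝕜 p.1 p.2)}

instance : IsTopologicalAddGroup (BornTensorBase 𝕜 E F) :=
  topologicalAddGroup_sInf fun t ht =>
    letI := t; haveI := ht.1
    (PolynormableSpace.withSeminorms 𝕜 (BornTensorBase 𝕜 E F)).topologicalAddGroup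

instance [ContinuousConstSMul A E] : ContinuousConstSMul A (BornTensorBase 𝕜 E F) where
  continuous_const_smul a := by
    rw [continuous_sInf_rng]
    intro t ht
    let φ : BornTensorBase 𝕜 E F →ₗ[𝕜] BornTensorBase 𝕜 E F :=
      { toFun := fun z => a • z
        map_add' := smul_add a
        map_smul' := fun c y => smul_comm a c y }
    have key : TopologicalSpace.induced φ t ∈
        {t | @PolynormableSpace 𝕜 (BornTensorBase 𝕜 E F) _ _ _ t ∧
          @IsBoundedMap 𝕜 _ (E × F) (BornTensorBase 𝕜 E F) _ _ _ _ _ t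
            (fun p => baseTmul 𝕜 p.1 p.2)} := by
      let := t; have := ht.1
      refine ⟨PolynormableSpace.induced φ, ?_⟩
      intro B hB
      refine isVonNBounded_induced φ ?_
      let ψ : E × F →L[𝕜] E × F :=
        { toFun := fun p => (a • p.1, p.2)
          map_add' := fun p q => by simp
          map_smul' := fun c p => by simp [smul_comm c a p.1]
          cont := by fun_prop }
      refine (ht.2 _ (hB.image ψ)).subset ?_
      rintro _ ⟨_, ⟨p, hp, rfl⟩, rfl⟩
      exact ⟨ψ p, ⟨p, hp, rfl⟩, rfl⟩
    exact (continuous_iff_le_induced.2 (sInf_le key) : _)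

/-- The `A`-submodule generated by all `x a ⊗ y - x ⊗ a y`. As the generating set is stable under `A`,
it is also the subgroup generated by these elements. -/
def balancingSubmodule : Submodule A (BornTensorBase 𝕜 E F) :=
  Submodule.span A {z | ∃ (a : A) (x : E) (y : F),
    z = baseTmul 𝕜 (a • x) y - baseTmul 𝕜 x (a • y)}

variable [ContinuousConstSMul A E]

/-- The bornological tensor product of `E` and `F` over `A`, with the quotient topology. -/
abbrev BornTensor : Type _ :=
  BornTensorBase 𝕜 E F ⧸ (balancingSubmodule 𝕜 A E F).topologicalClosure

variable {E F} in
/-- The canonical bilinear map into the bornological tensor product over `A`. -/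
def bornTmul (x : E) (y : F) : BornTensor 𝕜 A E F := Submodule.Quotient.mk (baseTmul 𝕜 x y)

instance : ContinuousConstSMul A (BornTensor 𝕜 A E F) where
  continuous_const_smul a :=
    continuous_quot_lift _ (continuous_quot_mk.comp (continuous_const_smul a))

end BornTensor

/-! ### Smooth functions and smooth sections of vector bundles -/

/-- The model space `ℝⁿ`. -/
abbrev Euc (n : ℕ) : Type := EuclideanSpace ℝ (Fin n)

section Sections

variable (𝕜 : Type*) [RCLike 𝕜] (n : ℕ) (M : Type*) [TopologicalSpace M] [ChartedSpace (Euc n) M]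

/-- The algebra of smooth `𝕜`-valued functions on `M`. -/
def smoothFunSubalgebra : Subalgebra 𝕜 (M → 𝕜) where
  carrier := {f | ContMDiff (𝓡 n) 𝓘(ℝ, 𝕜) ∞ f}
  mul_mem' := fun {f g} (hf : ContMDiff _ _ _ f) (hg : ContMDiff _ _ _ g) => by
    have h : ContDiff ℝ ∞ (fun p : 𝕜 × 𝕜 => p.1 * p.2) := contDiff_fst.mul contDiff_snd
    exact h.contMDiff.comp (hf.prodMk_space hg)
  add_mem' := fun {f g} (hf : ContMDiff _ _ _ f) (hg : ContMDiff _ _ _ g) => by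
    have h : ContDiff ℝ ∞ (fun p : 𝕜 × 𝕜 => p.1 + p.2) := contDiff_fst.add contDiff_snd
    exact h.contMDiff.comp (hf.prodMk_space hg)
  algebraMap_mem' := fun _ => contMDiff_const

/-- `C^∞(M)`. -/
def SmoothFun : Type _ := smoothFunSubalgebra 𝕜 n M

instance : CommRing (SmoothFun 𝕜 n M) := inferInstanceAs (CommRing (smoothFunSubalgebra 𝕜 n M))
instance : Algebra 𝕜 (SmoothFun 𝕜 n M) := inferInstanceAs (Algebra 𝕜 (smoothFunSubalgebra 𝕜 n M))
instance : CoeFun (SmoothFun 𝕜 n M) (fun _ => M → 𝕜) := ⟨fun f => f.1⟩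

@[simp] theorem SmoothFun.one_apply (x : M) : (1 : SmoothFun 𝕜 n M) x = 1 := rfl
@[simp] theorem SmoothFun.zero_apply (x : M) : (0 : SmoothFun 𝕜 n M) x = 0 := rfl
@[simp] theorem SmoothFun.add_apply (f g : SmoothFun 𝕜 n M) (x : M) : (f + g) x = f x + g x := rfl
@[simp] theorem SmoothFun.mul_apply (f g : SmoothFun 𝕜 n M) (x : M) : (f * g) x = f x * g x := rfl
@[simp] theorem SmoothFun.smul_apply (c : 𝕜) (f : SmoothFun 𝕜 n M) (x : M) :
    (c • f) x = c * f x := rfl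

variable {𝕜 M}
variable {F : Type*} [NormedAddCommGroup F] [NormedSpace 𝕜 F] [NormedSpace ℝ F]
  [IsScalarTower ℝ 𝕜 F] {ι : Type*} (Z : VectorBundleCore 𝕜 M F ι)

variable {n} in
/-- The image `φ(U ∩ V_i)` of the common domain of a chart `(U, φ)` and the trivialization `i`. -/
def overlap (φ : OpenPartialHomeomorph M (Euc n)) (i : ι) : Set (Euc n) :=
  φ.target ∩ φ.symm ⁻¹' Z.baseSet i

variable {n} in
/-- The local representation of a section in a chart `φ` and the trivialization `i`. The fibre of `Z`
over `x` is the vector space `F`, the preferred trivialization at `x` being the identity. -/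
def localRep (φ : OpenPartialHomeomorph M (Euc n)) (i : ι) (s : M → F) : Euc n → F := fun y =>
  Z.coordChange (Z.indexAt (φ.symm y)) i (φ.symm y) (s (φ.symm y))

/-- The smooth sections: all local representations are smooth. -/
def smoothSectionSubmodule : Submodule 𝕜 (M → F) where
  carrier := {s | ∀ φ ∈ atlas (Euc n) M, ∀ i, ContDiffOn ℝ ∞ (localRep Z φ i s) (overlap Z φ i)}
  zero_mem' := fun φ _ i => by
    have : localRep Z φ i 0 = fun _ => 0 := by ext y; simp [localRep]
    rw [this]; exact contDiffOn_const
  add_mem' := fun {s t} hs ht φ hφ i => by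
    have : localRep Z φ i (s + t) = localRep Z φ i s + localRep Z φ i t := by
      ext y; simp [localRep]
    rw [this]; exact (hs φ hφ i).add (ht φ hφ i)
  smul_mem' := fun c s hs φ hφ i => by
    have : localRep Z φ i (c • s) = c • localRep Z φ i s := by ext y; simp [localRep]
    rw [this]; exact (hs φ hφ i).const_smul c

/-- The space `Γ(Z)` of smooth sections of the vector bundle `Z`. -/
def SmoothSection : Type _ := smoothSectionSubmodule n Z

instance : AddCommGroup (SmoothSection n Z) :=
  inferInstanceAs (AddCommGroup (smoothSectionSubmodule n Z))
instance : Module 𝕜 (SmoothSection n Z) :=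
  inferInstanceAs (Module 𝕜 (smoothSectionSubmodule n Z))
instance : CoeFun (SmoothSection n Z) (fun _ => M → F) := ⟨fun s => s.1⟩

variable {n Z}

@[ext] theorem SmoothSection.ext {s t : SmoothSection n Z} (h : ∀ x, s x = t x) : s = t :=
  Subtype.ext (funext h)
@[simp] theorem SmoothSection.add_apply (s t : SmoothSection n Z) (x : M) :
    (s + t) x = s x + t x := rfl
@[simp] theorem SmoothSection.zero_apply (x : M) : (0 : SmoothSection n Z) x = 0 := rfl
@[simp] theorem SmoothSection.const_smul_apply (c : 𝕜) (s : SmoothSection n Z) (x : M) :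
    (c • s) x = c • s x := rfl

theorem isOpen_overlap (φ : OpenPartialHomeomorph M (Euc n)) (i : ι) : IsOpen (overlap Z φ i) :=
  φ.isOpen_inter_preimage_symm (Z.isOpen_baseSet i)

theorem smoothFun_chart [IsManifold (𝓡 n) ∞ M] (f : SmoothFun 𝕜 n M)
    {φ : OpenPartialHomeomorph M (Euc n)} (hφ : φ ∈ atlas (Euc n) M) :
    ContDiffOn ℝ ∞ (fun y => f (φ.symm y)) φ.target := by
  have h : ContMDiff (𝓡 n) 𝓘(ℝ, 𝕜) ∞ f.1 := f.2
  have h2 := contMDiffOn_symm_of_mem_maximalAtlas (I := 𝓡 n) (n := ∞)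
    (IsManifold.subset_maximalAtlas hφ)
  exact (h.comp_contMDiffOn h2).contDiffOn

variable [IsManifold (𝓡 n) ∞ M]

instance : SMul (SmoothFun 𝕜 n M) (SmoothSection n Z) where
  smul f s := ⟨fun x => f x • s x, fun φ hφ i => by
    have : localRep Z φ i (fun x => f x • s x) =
        fun y => f (φ.symm y) • localRep Z φ i s y := by
      ext y; simp [localRep]
    rw [this]
    exact ((smoothFun_chart f hφ).mono Set.inter_subset_left).smul (s.2 φ hφ i)⟩

@[simp] theorem SmoothSection.smul_apply (f : SmoothFun 𝕜 n M) (s : SmoothSection n Z) (x : M) :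
    (f • s) x = f x • s x := rfl

instance : Module (SmoothFun 𝕜 n M) (SmoothSection n Z) where
  one_smul s := by ext x; simp
  mul_smul f g s := by ext x; simp [mul_smul]
  smul_zero f := by ext x; simp
  smul_add f s t := by ext x; simp
  add_smul f g s := by ext x; simp [add_smul]
  zero_smul s := by ext x; simp

instance : IsScalarTower 𝕜 (SmoothFun 𝕜 n M) (SmoothSection n Z) where
  smul_assoc c f s := by ext x; simp [mul_smul]

/-! ### The Fréchet topology on smooth sections -/

variable (n Z) in
/-- Index of a defining seminorm: a chart, a trivialization, a compact subset of the
overlap of their domains (transported to `ℝⁿ`), and an order of differentiation. -/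
structure SemIndex where
  chart : OpenPartialHomeomorph M (Euc n)
  chart_mem : chart ∈ atlas (Euc n) M
  triv : ι
  K : Set (Euc n)
  isCompact_K : IsCompact K
  K_subset : K ⊆ overlap Z chart triv
  order : ℕ

/-- The `k`-th derivative of the local representation of a section. -/
def localDeriv (a : SemIndex n Z) (s : M → F) (y : Euc n) :
    ContinuousMultilinearMap ℝ (fun _ : Fin a.order => Euc n) F :=
  iteratedFDerivWithin ℝ a.order (localRep Z a.chart a.triv s) (overlap Z a.chart a.triv) y

theorem bddAbove_localDeriv (a : SemIndex n Z) (s : SmoothSection n Z) :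
    BddAbove (Set.range fun y : a.K => ‖localDeriv a s y‖) := by
  have h : ContinuousOn (fun y => ‖localDeriv a s y‖) a.K :=
    (((s.2 a.chart a.chart_mem a.triv).continuousOn_iteratedFDerivWithin
      (by exact_mod_cast le_top) (isOpen_overlap _ _).uniqueDiffOn).mono a.K_subset).norm
  have := a.isCompact_K.bddAbove_image h
  rwa [Set.image_eq_range] at this

/-- The seminorm `s ↦ sup_K ‖D^k s_loc‖`. -/
def sectionSeminorm (a : SemIndex n Z) : Seminorm 𝕜 (SmoothSection n Z) :=
  Seminorm.of (fun s => ⨆ y : a.K, ‖localDeriv a s y‖)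
    (fun s t => by
      have hnn : ∀ u : SmoothSection n Z, 0 ≤ ⨆ y : a.K, ‖localDeriv a u y‖ :=
        fun u => Real.iSup_nonneg fun _ => norm_nonneg _
      refine Real.iSup_le (fun y => ?_) (add_nonneg (hnn s) (hnn t))
      have : localDeriv a (s + t : SmoothSection n Z) y = localDeriv a s y + localDeriv a t y := by
        have e : localRep Z a.chart a.triv (s + t : SmoothSection n Z) =
            localRep Z a.chart a.triv s + localRep Z a.chart a.triv t := by
          ext y; simp [localRep]
        have hs := (s.2 a.chart a.chart_mem a.triv y (a.K_subset y.2)).of_le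
          (m := (a.order : ℕ∞)) (by exact_mod_cast le_top)
        have ht := (t.2 a.chart a.chart_mem a.triv y (a.K_subset y.2)).of_le
          (m := (a.order : ℕ∞)) (by exact_mod_cast le_top)
        unfold localDeriv
        rw [e]
        exact iteratedFDerivWithin_add_apply hs ht (isOpen_overlap _ _).uniqueDiffOn
          (a.K_subset y.2)
      rw [this]
      exact (norm_add_le _ _).trans (add_le_add (le_ciSup (bddAbove_localDeriv a s) y)
        (le_ciSup (bddAbove_localDeriv a t) y)))
    (fun c s => by
      rw [Real.mul_iSup_of_nonneg (norm_nonneg c)]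
      congr 1
      ext y
      have : localDeriv a (c • s : SmoothSection n Z) y = c • localDeriv a s y := by
        have e : localRep Z a.chart a.triv (c • s : SmoothSection n Z) =
            c • localRep Z a.chart a.triv s := by
          ext y; simp [localRep]
        have hs := (s.2 a.chart a.chart_mem a.triv y (a.K_subset y.2)).of_le
          (m := (a.order : ℕ∞)) (by exact_mod_cast le_top)
        unfold localDeriv
        rw [e]
        exact iteratedFDerivWithin_const_smul_apply hs (isOpen_overlap _ _).uniqueDiffOn
          (a.K_subset y.2)
      rw [this, norm_smul])

variable (n Z) in
/-- The family of defining seminorms of `Γ(Z)`. -/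
def sectionSeminorms : SeminormFamily 𝕜 (SmoothSection n Z) (SemIndex n Z) := sectionSeminorm

instance : TopologicalSpace (SmoothSection n Z) :=
  (sectionSeminorms n Z).moduleFilterBasis.topology

theorem withSeminorms_section : WithSeminorms (sectionSeminorms n Z) := ⟨rfl⟩

instance : ContinuousConstSMul (SmoothFun 𝕜 n M) (SmoothSection n Z) where
  continuous_const_smul f := by
    let φ : SmoothSection n Z →ₗ[𝕜] SmoothSection n Z :=
      { toFun := fun s => f • s
        map_add' := smul_add f
        map_smul' := fun c s => smul_comm f c s }
    refine withSeminorms_section.continuous_of_isBounded withSeminorms_section φ ?_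
    intro a
    let g : Euc n → 𝕜 := fun y => f (a.chart.symm y)
    have hg : ContDiffOn ℝ ∞ g (overlap Z a.chart a.triv) :=
      (smoothFun_chart f a.chart_mem).mono Set.inter_subset_left
    have hU := (isOpen_overlap (Z := Z) a.chart a.triv).uniqueDiffOn (𝕜 := ℝ)
    have hb : ∀ m : ℕ, ∃ C : ℝ, 0 ≤ C ∧
        ∀ y ∈ a.K, ‖iteratedFDerivWithin ℝ m g (overlap Z a.chart a.triv) y‖ ≤ C := by
      intro m
      have h := (hg.continuousOn_iteratedFDerivWithin (m := m)
        (by exact_mod_cast le_top) hU).mono a.K_subset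
      obtain ⟨C, hC⟩ := a.isCompact_K.exists_bound_of_continuousOn h
      exact ⟨max C 0, le_max_right _ _, fun y hy => (hC y hy).trans (le_max_left _ _)⟩
    choose C hC0 hC using hb
    classical
    let b : ℕ → SemIndex n Z := fun m => { a with order := m }
    let S : Finset (SemIndex n Z) := (Finset.range (a.order + 1)).image b
    refine ⟨S, ⟨∑ m ∈ Finset.range (a.order + 1), (a.order.choose m : ℝ) * C m,
      Finset.sum_nonneg fun m _ => mul_nonneg (Nat.cast_nonneg _) (hC0 m)⟩, fun s => ?_⟩
    change (⨆ y : a.K, ‖localDeriv a (f • s : SmoothSection n Z) y‖) ≤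
      (∑ m ∈ Finset.range (a.order + 1), (a.order.choose m : ℝ) * C m) *
        (S.sup (sectionSeminorms n Z)) s
    refine Real.iSup_le (fun y => ?_) (mul_nonneg
      (Finset.sum_nonneg fun m _ => mul_nonneg (Nat.cast_nonneg _) (hC0 m)) (apply_nonneg _ _))
    have e : localRep Z a.chart a.triv (f • s : SmoothSection n Z) =
        fun y => g y • localRep Z a.chart a.triv s y := by
      ext y; simp [localRep, g]
    unfold localDeriv
    rw [e]
    refine (norm_iteratedFDerivWithin_smul_le hg (s.2 a.chart a.chart_mem a.triv) hU
      (a.K_subset y.2) (n := a.order) (by exact_mod_cast le_top)).trans ?_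
    rw [Finset.sum_mul]
    refine Finset.sum_le_sum fun m hm => ?_
    refine mul_le_mul (mul_le_mul_of_nonneg_left (hC m y y.2) (Nat.cast_nonneg _)) ?_
      (norm_nonneg _) (mul_nonneg (Nat.cast_nonneg _) (hC0 m))
    have h1 : ‖localDeriv (b (a.order - m)) s y‖ ≤ sectionSeminorms n Z (b (a.order - m)) s :=
      le_ciSup (bddAbove_localDeriv (b (a.order - m)) s) y
    exact h1.trans (Seminorm.le_finset_sup_apply (Finset.mem_image_of_mem b (by simp)))

instance : IsTopologicalAddGroup (SmoothSection n Z) := withSeminorms_section.topologicalAddGroup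
instance : ContinuousSMul 𝕜 (SmoothSection n Z) := withSeminorms_section.continuousSMul

/-! ### Compactly supported sections and the (LF)-topology -/

variable (n Z) in
/-- The compactly supported smooth sections. -/
def compSectionSubmodule : Submodule (SmoothFun 𝕜 n M) (SmoothSection n Z) where
  carrier := {s | HasCompactSupport s.1}
  zero_mem' := HasCompactSupport.zero
  add_mem' := fun hs ht => HasCompactSupport.add hs ht
  smul_mem' := fun f _ hs => HasCompactSupport.smul_left (f := f.1) hs

variable (n Z) in
/-- The space `Γ_c(Z)` of compactly supported smooth sections. -/
def CompSection : Type _ := compSectionSubmodule n Z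

instance : AddCommGroup (CompSection n Z) :=
  inferInstanceAs (AddCommGroup (compSectionSubmodule n Z))
instance : Module (SmoothFun 𝕜 n M) (CompSection n Z) :=
  inferInstanceAs (Module (SmoothFun 𝕜 n M) (compSectionSubmodule n Z))
instance : Module 𝕜 (CompSection n Z) :=
  inferInstanceAs (Module 𝕜 (compSectionSubmodule n Z))
instance : IsScalarTower 𝕜 (SmoothFun 𝕜 n M) (CompSection n Z) where
  smul_assoc c f s := Subtype.ext (smul_assoc c f (s.1 : SmoothSection n Z))

/-- A compactly supported section as a section. -/
def CompSection.toSection (s : CompSection n Z) : SmoothSection n Z := s.1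

instance : CoeFun (CompSection n Z) (fun _ => M → F) := ⟨fun s => s.toSection⟩

variable (n Z) in
/-- The space `Γ_{c,K}(Z)` of smooth sections with support in the compact set `K`, a subspace
of `Γ_c(Z)`. -/
def SuppSection (K : Set M) : Type _ := {s : CompSection n Z // ∀ x, x ∉ K → s x = 0}

/-- `Γ_{c,K}(Z)` carries the subspace topology of `Γ(Z)`. -/
instance (K : Set M) : TopologicalSpace (SuppSection n Z K) :=
  TopologicalSpace.induced (fun s => s.1.toSection) inferInstance

variable (n Z) in
/-- The locally convex topologies on `Γ_c(Z)` for which all inclusions of the spaces `Γ_{c,K}(Z)`,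
`K` compact, are continuous. -/
def compTopologies : Set (TopologicalSpace (CompSection n Z)) :=
  {t | @PolynormableSpace 𝕜 (CompSection n Z) _ _ _ t ∧
    ∀ K : Set M, IsCompact K →
      @Continuous (SuppSection n Z K) (CompSection n Z) _ t Subtype.val}

/-- The inductive limit topology: the finest locally convex topology for which all inclusions
`Γ_{c,K}(Z) → Γ_c(Z)` are continuous. -/
instance : TopologicalSpace (CompSection n Z) := sInf (compTopologies n Z)

instance : IsTopologicalAddGroup (CompSection n Z) :=
  topologicalAddGroup_sInf fun t ht =>
    letI := t; haveI := ht.1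
    (PolynormableSpace.withSeminorms 𝕜 (CompSection n Z)).topologicalAddGroup

instance : ContinuousSMul 𝕜 (CompSection n Z) :=
  continuousSMul_sInf fun t ht =>
    letI := t; haveI := ht.1
    (PolynormableSpace.withSeminorms 𝕜 (CompSection n Z)).continuousSMul

instance : ContinuousConstSMul (SmoothFun 𝕜 n M) (CompSection n Z) where
  continuous_const_smul f := by
    rw [continuous_sInf_rng]
    intro t ht
    let φ : CompSection n Z →ₗ[𝕜] CompSection n Z :=
      { toFun := fun s => f • s
        map_add' := smul_add f
        map_smul' := fun c s => smul_comm f c s }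
    have key : TopologicalSpace.induced φ t ∈ compTopologies n Z := by
      let := t; have := ht.1
      refine ⟨PolynormableSpace.induced φ, fun K hK => ?_⟩
      refine continuous_induced_rng.2 ?_
      let μ : SuppSection n Z K → SuppSection n Z K := fun s =>
        ⟨f • s.1, fun x hx => by
          change f x • s.1.toSection x = 0
          rw [s.2 x hx, smul_zero]⟩
      have hμ : Continuous μ := by
        refine continuous_induced_rng.2 ?_
        exact (continuous_const_smul f).comp continuous_induced_dom
      exact (ht.2 K hK).comp hμ
    exact (continuous_iff_le_induced.2 (sInf_le key) : _)

end Sections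

/-! ### Strong duals as `C^∞(M)`-modules

`StrongDual 𝕜 E` carries the topology of uniform convergence on bounded sets. -/

section Dual

variable {𝕜 : Type*} [RCLike 𝕜] {n : ℕ} {M : Type*} [TopologicalSpace M] [ChartedSpace (Euc n) M]
  {E : Type*} [AddCommGroup E] [Module 𝕜 E] [TopologicalSpace E]
  [Module (SmoothFun 𝕜 n M) E] [IsScalarTower 𝕜 (SmoothFun 𝕜 n M) E]
  [ContinuousConstSMul (SmoothFun 𝕜 n M) E]

/-- Multiplication by a smooth function on `E`, as a continuous linear map. -/
def mulCLM (f : SmoothFun 𝕜 n M) : E →L[𝕜] E where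
  toFun x := f • x
  map_add' := smul_add f
  map_smul' c x := smul_comm f c x
  cont := continuous_const_smul f

/-- The product of a functional and a smooth function: `⟨f T, ω⟩ = ⟨T, f ω⟩`. -/
instance : SMul (SmoothFun 𝕜 n M) (StrongDual 𝕜 E) where
  smul f T := T.comp (mulCLM f)

instance : Module (SmoothFun 𝕜 n M) (StrongDual 𝕜 E) where
  one_smul T := ContinuousLinearMap.ext fun x => congrArg T (one_smul _ x)
  mul_smul f g T := ContinuousLinearMap.ext fun x =>
    congrArg T ((congrArg (fun h : SmoothFun 𝕜 n M => h • x) (mul_comm f g)).trans (mul_smul g f x))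
  smul_zero f := ContinuousLinearMap.ext fun _ => rfl
  smul_add f S T := ContinuousLinearMap.ext fun _ => rfl
  add_smul f g T := ContinuousLinearMap.ext fun x =>
    (congrArg T (add_smul f g x)).trans (map_add T _ _)
  zero_smul T := ContinuousLinearMap.ext fun x =>
    (congrArg T (zero_smul (SmoothFun 𝕜 n M) x)).trans (map_zero T)

instance : IsScalarTower 𝕜 (SmoothFun 𝕜 n M) (StrongDual 𝕜 E) where
  smul_assoc c f T := ContinuousLinearMap.ext fun x =>
    (congrArg T (smul_assoc c f x)).trans (map_smul T _ _)

instance : ContinuousConstSMul (SmoothFun 𝕜 n M) (StrongDual 𝕜 E) where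
  continuous_const_smul f := (ContinuousLinearMap.precomp 𝕜 (mulCLM f)).continuous

end Dual

/-! ### The tensor bundles, the volume bundle, and tensor products of bundles -/

section Bundles

variable (𝕜 : Type*) [RCLike 𝕜] (n : ℕ) (M : Type*) [TopologicalSpace M] [ChartedSpace (Euc n) M]
  [IsManifold (𝓡 n) ∞ M]

variable {n M} in
/-- The Jacobian matrix `D(φ_j ∘ φ_i⁻¹)` at the point `φ_i(x)`. -/
def jacobian (i j : atlas (Euc n) M) (x : M) : Matrix (Fin n) (Fin n) ℝ :=
  LinearMap.toMatrix (EuclideanSpace.basisFun (Fin n) ℝ).toBasis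
    (EuclideanSpace.basisFun (Fin n) ℝ).toBasis
    ((tangentBundleCore (𝓡 n) M).coordChange i j x : Euc n →ₗ[ℝ] Euc n)

variable {n M} in
theorem jacobian_self (i : atlas (Euc n) M) {x : M} (hx : x ∈ i.1.source) :
    jacobian i i x = 1 := by
  have : ((tangentBundleCore (𝓡 n) M).coordChange i i x : Euc n →ₗ[ℝ] Euc n) = LinearMap.id :=
    LinearMap.ext fun v => (tangentBundleCore (𝓡 n) M).coordChange_self i x hx v
  rw [jacobian, this, LinearMap.toMatrix_id]

variable {n M} in
theorem jacobian_comp (i j k : atlas (Euc n) M) {x : M}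
    (hx : x ∈ i.1.source ∩ j.1.source ∩ k.1.source) :
    jacobian j k x * jacobian i j x = jacobian i k x := by
  rw [jacobian, jacobian, ← LinearMap.toMatrix_comp]
  congr 1
  exact LinearMap.ext fun v => (tangentBundleCore (𝓡 n) M).coordChange_comp i j k x hx v

variable {n M} in
theorem continuousOn_jacobian (i j : atlas (Euc n) M) :
    ContinuousOn (jacobian i j) (i.1.source ∩ j.1.source) := by
  have h := (tangentBundleCore (𝓡 n) M).continuousOn_coordChange i j
  let L : (Euc n →L[ℝ] Euc n) →ₗ[ℝ] Matrix (Fin n) (Fin n) ℝ :=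
    (LinearMap.toMatrix (EuclideanSpace.basisFun (Fin n) ℝ).toBasis
      (EuclideanSpace.basisFun (Fin n) ℝ).toBasis).toLinearMap ∘ₗ ContinuousLinearMap.coeLM ℝ
  have hL : Continuous L := L.continuous_of_finiteDimensional
  exact hL.comp_continuousOn h

/-- The action `(∏ a, A (K a) (I a))_{K, I}` of a matrix on the components of `r`-fold
contravariant tensors. -/
def tensorPow (r : ℕ) {n : ℕ} (A : Matrix (Fin n) (Fin n) ℝ) :
    Matrix (Fin r → Fin n) (Fin r → Fin n) ℝ :=
  Matrix.of fun K I => ∏ a, A (K a) (I a)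

theorem tensorPow_mul (r : ℕ) {n : ℕ} (A B : Matrix (Fin n) (Fin n) ℝ) :
    tensorPow r (A * B) = tensorPow r A * tensorPow r B := by
  ext K I
  simp only [tensorPow, Matrix.of_apply, Matrix.mul_apply, Finset.prod_univ_sum,
    Finset.prod_mul_distrib, Fintype.piFinset_univ]

theorem tensorPow_one (r n : ℕ) : tensorPow r (1 : Matrix (Fin n) (Fin n) ℝ) = 1 := by
  ext K I
  simp only [tensorPow, Matrix.of_apply, Matrix.one_apply, Finset.prod_ite_zero,
    Finset.prod_const_one, Finset.mem_univ, forall_const, funext_iff]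

/-- The components of a tensor of type `(r, s)` over an `n`-dimensional space: `r` contravariant
(upper) and `s` covariant (lower) indices. -/
abbrev TensorComp (n r s : ℕ) : Type _ :=
  EuclideanSpace 𝕜 ((Fin r → Fin n) × (Fin s → Fin n))

/-- The matrix of the transformation law of tensor components,
`t'^K_L = ∑ I J, (∏ a, A (K a) (I a)) (∏ b, B (J b) (L b)) t^I_J`, where `A` is the Jacobian of the
change of coordinates and `B` the Jacobian of its inverse. -/
def tensorTransition (r s : ℕ) {n : ℕ} (A B : Matrix (Fin n) (Fin n) ℝ) :
    Matrix ((Fin r → Fin n) × (Fin s → Fin n)) ((Fin r → Fin n) × (Fin s → Fin n)) 𝕜 :=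
  (tensorPow r A ⊗ₖ (tensorPow s B).transpose).map (fun c : ℝ => (c : 𝕜))

theorem tensorTransition_one (r s n : ℕ) :
    tensorTransition 𝕜 r s (1 : Matrix (Fin n) (Fin n) ℝ) 1 = 1 := by
  rw [tensorTransition, tensorPow_one, tensorPow_one, Matrix.transpose_one, Matrix.one_kronecker_one]
  exact Matrix.map_one _ RCLike.ofReal_zero RCLike.ofReal_one

theorem tensorTransition_mul (r s : ℕ) {n : ℕ} (A A' B B' : Matrix (Fin n) (Fin n) ℝ) :
    tensorTransition 𝕜 r s (A * A') (B' * B) =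
      tensorTransition 𝕜 r s A B * tensorTransition 𝕜 r s A' B' := by
  simp only [tensorTransition, tensorPow_mul, Matrix.transpose_mul, Matrix.mul_kronecker_mul]
  exact Matrix.map_mul (f := algebraMap ℝ 𝕜)

theorem continuous_tensorTransition (r s n : ℕ) :
    Continuous fun p : Matrix (Fin n) (Fin n) ℝ × Matrix (Fin n) (Fin n) ℝ =>
      tensorTransition 𝕜 r s p.1 p.2 := by
  refine continuous_matrix fun K L => ?_
  simp only [tensorTransition, tensorPow, Matrix.map_apply, Matrix.kroneckerMap_apply,
    Matrix.transpose_apply, Matrix.of_apply]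
  refine RCLike.continuous_ofReal.comp (Continuous.mul ?_ ?_)
  · exact continuous_finsetProd _ fun a _ => continuous_fst.matrix_elem _ _
  · exact continuous_finsetProd _ fun a _ => continuous_snd.matrix_elem _ _

theorem continuous_toEuclideanCLM (κ : Type*) [Fintype κ] [DecidableEq κ] :
    Continuous fun A : Matrix κ κ 𝕜 => Matrix.toEuclideanCLM (𝕜 := 𝕜) A := by
  let L : Matrix κ κ 𝕜 →ₗ[𝕜] (EuclideanSpace 𝕜 κ →L[𝕜] EuclideanSpace 𝕜 κ) :=
    { toFun := fun A => Matrix.toEuclideanCLM (𝕜 := 𝕜) A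
      map_add' := map_add _
      map_smul' := map_smul _ }
  exact L.continuous_of_finiteDimensional

variable {n M} in
theorem continuousOn_tensorTransition (r s : ℕ) {U : Set M}
    {A B : M → Matrix (Fin n) (Fin n) ℝ} (hA : ContinuousOn A U) (hB : ContinuousOn B U) :
    ContinuousOn (fun x => Matrix.toEuclideanCLM (𝕜 := 𝕜) (tensorTransition 𝕜 r s (A x) (B x)))
      U := by
  have h := (continuous_tensorTransition 𝕜 r s n).comp_continuousOn (hA.prodMk hB)
  exact (continuous_toEuclideanCLM 𝕜 ((Fin r → Fin n) × (Fin s → Fin n))).comp_continuousOn h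

/-- The tensor bundle `T^r_s(M)`. -/
def tensorBundle (r s : ℕ) : VectorBundleCore 𝕜 M (TensorComp 𝕜 n r s) (atlas (Euc n) M) where
  baseSet i := i.1.source
  isOpen_baseSet i := i.1.open_source
  indexAt := achart (Euc n)
  mem_baseSet_at := mem_chart_source (Euc n)
  coordChange i j x :=
    Matrix.toEuclideanCLM (𝕜 := 𝕜) (tensorTransition 𝕜 r s (jacobian i j x) (jacobian j i x))
  coordChange_self i x hx v := by
    rw [jacobian_self i hx, tensorTransition_one, map_one]; rfl
  continuousOn_coordChange i j :=
    continuousOn_tensorTransition 𝕜 r s (continuousOn_jacobian i j)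
      ((continuousOn_jacobian j i).mono (Set.inter_comm _ _).le)
  coordChange_comp i j k x hx v := by
    rw [← jacobian_comp i j k hx, ← jacobian_comp k j i ⟨⟨hx.2, hx.1.2⟩, hx.1.1⟩,
      tensorTransition_mul, map_mul]
    rfl

/-- The volume bundle `Vol(M)`, the line bundle of `1`-densities: its transition functions are the
absolute values of the Jacobian determinants of the inverse changes of coordinates. -/
def volBundle : VectorBundleCore 𝕜 M 𝕜 (atlas (Euc n) M) where
  baseSet i := i.1.source
  isOpen_baseSet i := i.1.open_source
  indexAt := achart (Euc n)
  mem_baseSet_at := mem_chart_source (Euc n)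
  coordChange i j x := ((|(jacobian j i x).det| : ℝ) : 𝕜) • ContinuousLinearMap.id 𝕜 𝕜
  coordChange_self i x hx v := by simp [jacobian_self i hx]
  continuousOn_coordChange i j := by
    have h : ContinuousOn (fun x => |(jacobian j i x).det|) (i.1.source ∩ j.1.source) :=
      ((Continuous.matrix_det (continuous_id (X := Matrix (Fin n) (Fin n) ℝ))).comp_continuousOn
        ((continuousOn_jacobian j i).mono fun x hx => ⟨hx.2, hx.1⟩)).abs
    have h' : ContinuousOn (fun x => ((|(jacobian j i x).det| : ℝ) : 𝕜)) (i.1.source ∩ j.1.source) :=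
      RCLike.continuous_ofReal.comp_continuousOn h
    exact h'.smul
      (continuousOn_const (c := ContinuousLinearMap.id 𝕜 𝕜))
  coordChange_comp i j k x hx v := by
    rw [← jacobian_comp k j i ⟨⟨hx.2, hx.1.2⟩, hx.1.1⟩, Matrix.det_mul, abs_mul]
    simp only [smul_apply, ContinuousLinearMap.id_apply, smul_eq_mul,
      RCLike.ofReal_mul]
    ring

end Bundles

section TensorProductBundle

variable {𝕜 : Type*} [RCLike 𝕜] {M : Type*} [TopologicalSpace M]
  {F₁ : Type*} [NormedAddCommGroup F₁] [InnerProductSpace 𝕜 F₁] [FiniteDimensional 𝕜 F₁]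
  {F₂ : Type*} [NormedAddCommGroup F₂] [InnerProductSpace 𝕜 F₂] [FiniteDimensional 𝕜 F₂]
  {ι₁ ι₂ : Type*}

/-- The tensor product of two vector bundles: the fibres are the tensor products of the fibres, the
transition functions the tensor products of the transition functions. -/
def tensorProductBundle (Z₁ : VectorBundleCore 𝕜 M F₁ ι₁) (Z₂ : VectorBundleCore 𝕜 M F₂ ι₂) :
    VectorBundleCore 𝕜 M (F₁ ⊗[𝕜] F₂) (ι₁ × ι₂) where
  baseSet i := Z₁.baseSet i.1 ∩ Z₂.baseSet i.2
  isOpen_baseSet i := (Z₁.isOpen_baseSet i.1).inter (Z₂.isOpen_baseSet i.2)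
  indexAt x := (Z₁.indexAt x, Z₂.indexAt x)
  mem_baseSet_at x := ⟨Z₁.mem_baseSet_at x, Z₂.mem_baseSet_at x⟩
  coordChange i j x := LinearMap.toContinuousLinearMap
    (TensorProduct.map (Z₁.coordChange i.1 j.1 x : F₁ →ₗ[𝕜] F₁)
      (Z₂.coordChange i.2 j.2 x : F₂ →ₗ[𝕜] F₂))
  coordChange_self i x hx v := by
    have h₁ : (Z₁.coordChange i.1 i.1 x : F₁ →ₗ[𝕜] F₁) = LinearMap.id :=
      LinearMap.ext fun v => Z₁.coordChange_self i.1 x hx.1 v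
    have h₂ : (Z₂.coordChange i.2 i.2 x : F₂ →ₗ[𝕜] F₂) = LinearMap.id :=
      LinearMap.ext fun v => Z₂.coordChange_self i.2 x hx.2 v
    simp [h₁, h₂]
  continuousOn_coordChange i j := by
    rw [continuousOn_clm_apply]
    intro v
    induction v using TensorProduct.induction_on with
    | zero => simpa using continuousOn_const
    | add v w hv hw => simpa [Pi.add_def] using hv.add hw
    | tmul v w =>
      have h₁ := ((Z₁.continuousOn_coordChange i.1 j.1).clm_apply
        (continuousOn_const (c := v))).mono
          (fun x (hx : x ∈ (Z₁.baseSet i.1 ∩ Z₂.baseSet i.2) ∩ (Z₁.baseSet j.1 ∩ Z₂.baseSet j.2)) =>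
            (⟨hx.1.1, hx.2.1⟩ : x ∈ Z₁.baseSet i.1 ∩ Z₁.baseSet j.1))
      have h₂ := ((Z₂.continuousOn_coordChange i.2 j.2).clm_apply
        (continuousOn_const (c := w))).mono
          (fun x (hx : x ∈ (Z₁.baseSet i.1 ∩ Z₂.baseSet i.2) ∩ (Z₁.baseSet j.1 ∩ Z₂.baseSet j.2)) =>
            (⟨hx.1.2, hx.2.2⟩ : x ∈ Z₂.baseSet i.2 ∩ Z₂.baseSet j.2))
      let T : F₁ →L[𝕜] F₂ →L[𝕜] F₁ ⊗[𝕜] F₂ :=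
        LinearMap.mkContinuous₂ (TensorProduct.mk 𝕜 F₁ F₂) 1 (fun a b => by simp)
      exact (T.continuous.comp_continuousOn h₁).clm_apply h₂
  coordChange_comp i j k x hx v := by
    have h₁ := Z₁.coordChange_linear_comp i.1 j.1 k.1 x ⟨⟨hx.1.1.1, hx.1.2.1⟩, hx.2.1⟩
    have h₂ := Z₂.coordChange_linear_comp i.2 j.2 k.2 x ⟨⟨hx.1.1.2, hx.1.2.2⟩, hx.2.2⟩
    rw [← h₁, ← h₂]
    simp [TensorProduct.map_map]

/-- The real normed space structure underlying the complex or real one. -/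
instance [NormedSpace ℝ F₁] [IsScalarTower ℝ 𝕜 F₁] : NormedSpace ℝ (F₁ ⊗[𝕜] F₂) where
  norm_smul_le c z := by
    rw [← algebraMap_smul 𝕜 c z]
    exact (norm_smul_le _ _).trans (by simp)

end TensorProductBundle

/-! ### Tensor fields, densities and distributions -/

section Distributions

variable (𝕜 : Type*) [RCLike 𝕜] (n : ℕ) (M : Type*) [TopologicalSpace M] [ChartedSpace (Euc n) M]
  [IsManifold (𝓡 n) ∞ M]

/-- The space `𝒯^r_s(M)` of smooth tensor fields of type `(r, s)`. -/
abbrev TensorField (r s : ℕ) : Type _ := SmoothSection n (tensorBundle 𝕜 n M r s)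

/-- The space `Γ_c(M, Vol(M))` of compactly supported smooth densities. -/
abbrev CompDensity : Type _ := CompSection n (volBundle 𝕜 n M)

/-- The space `Γ_c(M, T^s_r(M) ⊗ Vol(M))` of test objects for tensor distributions of
type `(r, s)`. -/
abbrev CompTensorDensity (r s : ℕ) : Type _ :=
  CompSection n (tensorProductBundle (tensorBundle 𝕜 n M s r) (volBundle 𝕜 n M))

/-- The space `𝒟'(M)` of scalar distributions, with the strong dual topology. -/
abbrev Distribution : Type _ := StrongDual 𝕜 (CompDensity 𝕜 n M)

/-- The space `𝒟'^r_s(M)` of tensor distributions, with the strong dual topology. -/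
abbrev TensorDistribution (r s : ℕ) : Type _ := StrongDual 𝕜 (CompTensorDensity 𝕜 n M r s)

variable {𝕜 n M} in
/-- The pointwise contraction of a tensor field of type `(r, s)` with one of type `(s, r)`, that is,
the natural pairing of `T^r_s(M)` with its dual bundle `T^s_r(M)`, in components. -/
def contraction {r s : ℕ} (u : TensorField 𝕜 n M r s) (t : TensorField 𝕜 n M s r) (x : M) : 𝕜 :=
  ∑ I : Fin r → Fin n, ∑ J : Fin s → Fin n, u x (I, J) * t x (J, I)

end Distributions

end TensorDist
end

set_option linter.unusedSectionVars false
set_option linter.style.haveILetI false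

open scoped ContDiff Manifold TensorProduct Kronecker
open Bornology

noncomputable section

namespace TensorDist

/-! ### Von Neumann bounded sets in locally convex spaces and strong duals -/

section BoundedSets

variable {𝕜 : Type*} [RCLike 𝕜] {E F G : Type*}
  [AddCommGroup E] [Module 𝕜 E] [TopologicalSpace E]
  [AddCommGroup F] [Module 𝕜 F] [TopologicalSpace F]
  [AddCommGroup G] [Module 𝕜 G] [TopologicalSpace G]

theorem isVonNBounded_iff_continuous_seminorm [PolynormableSpace 𝕜 E] {B : Set E} :
    IsVonNBounded 𝕜 B ↔ ∀ p : Seminorm 𝕜 E, Continuous p → BddAbove (p '' B) := by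
  rw [(PolynormableSpace.withSeminorms 𝕜 E).isVonNBounded_iff_seminorm_bddAbove]
  exact ⟨fun h p hp => h ⟨p, hp⟩, fun h p => h p.1 p.2⟩

-- The filters `nhds` and `smallSets` both commute with infima, so absorption by neighbourhoods can
-- be tested for each topology separately. This shows that a finest topology making a map bounded
-- does make it bounded.
open scoped Pointwise in
theorem isVonNBounded_sInf {ts : Set (TopologicalSpace E)} {B : Set E}
    (h : ∀ t ∈ ts, @IsVonNBounded 𝕜 E _ _ _ t B) :
    @IsVonNBounded 𝕜 E _ _ _ (sInf ts) B := by
  have key : ∀ t : TopologicalSpace E, @IsVonNBounded 𝕜 E _ _ _ t B ↔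
      Filter.Tendsto (· • B : 𝕜 → Set E) (nhds 0) (@nhds E t 0).smallSets := fun t =>
    letI := t; isVonNBounded_iff_tendsto_smallSets_nhds
  rw [key, nhds_sInf, Filter.smallSets_iInf, Filter.tendsto_iInf]
  intro t
  rw [Filter.smallSets_iInf, Filter.tendsto_iInf]
  exact fun ht => (key t).1 (h t ht)

theorem IsBoundedMap.comp {g : F → G} {f : E → F} (hg : IsBoundedMap 𝕜 g)
    (hf : IsBoundedMap 𝕜 f) : IsBoundedMap 𝕜 (g ∘ f) := fun B hB => by
  rw [Set.image_comp]; exact hg _ (hf B hB)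

theorem isVonNBounded_prod {B : Set E} {C : Set F} (hB : IsVonNBounded 𝕜 B)
    (hC : IsVonNBounded 𝕜 C) : IsVonNBounded 𝕜 (B ×ˢ C) := by
  intro V hV
  rw [← Prod.mk_zero_zero, mem_nhds_prod_iff] at hV
  obtain ⟨U, hU, W, hW, hUW⟩ := hV
  refine Absorbs.mono_left ?_ hUW
  filter_upwards [hB hU, hC hW, eventually_ne_cobounded (0 : 𝕜)] with a ha hb ha0
  rintro ⟨x, y⟩ ⟨hx, hy⟩
  have h1 := ha hx
  have h2 := hb hy
  rw [Set.mem_smul_set_iff_inv_smul_mem₀ ha0] at h1 h2 ⊢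
  exact ⟨h1, h2⟩

theorem isBoundedMap_finsetSum [IsTopologicalAddGroup F] [ContinuousSMul 𝕜 F] {κ : Type*}
    (s : Finset κ) {f : κ → E → F}
    (hf : ∀ i, IsBoundedMap 𝕜 (f i)) : IsBoundedMap 𝕜 (fun x => ∑ i ∈ s, f i x) := by
  classical
  induction s using Finset.induction_on with
  | empty =>
    intro B _
    refine (isVonNBounded_singleton (𝕜 := 𝕜) (0 : F)).subset ?_
    rintro _ ⟨x, _, rfl⟩; simp
  | insert i s hi ih =>
    intro B hB
    refine ((hf i B hB).add (ih B hB)).subset ?_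
    rintro _ ⟨x, hx, rfl⟩
    simp only [Finset.sum_insert hi]
    exact Set.add_mem_add ⟨x, hx, rfl⟩ ⟨x, hx, rfl⟩

-- Continuous lifts and the seminorm criteria need a target defined by `𝕜`-seminorms. Local
-- convexity passes from the scalars to the strong dual. For the scalars it holds because the
-- nonnegative elements of `𝕜` are the nonnegative reals, so convexity over `𝕜` of a ball is its
-- convexity over `ℝ`.
open scoped ComplexOrder in
instance polynormableSpace_strongDual [IsTopologicalAddGroup E] [ContinuousSMul 𝕜 E] :
    PolynormableSpace 𝕜 (StrongDual 𝕜 E) := by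
  have : LocallyConvexSpace 𝕜 𝕜 := LocallyConvexSpace.ofBasisZero 𝕜 𝕜 _ _ Metric.nhds_basis_ball
    (fun r _ => convex_of_nonneg_surjective_algebraMap 𝕜
      (fun _ => RCLike.nonneg_iff_exists_ofReal.mp) (convex_ball (0 : 𝕜) r))
  have : LocallyConvexSpace 𝕜 (StrongDual 𝕜 E) := inferInstance
  have : ContinuousSMul ℝ (StrongDual 𝕜 E) := IsScalarTower.continuousSMul 𝕜
  exact LocallyConvexSpace.toPolynormableSpace

/-- A set of functionals is bounded in the strong dual if it is uniformly bounded on bounded sets. -/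
theorem isVonNBounded_strongDual_iff {S : Set (StrongDual 𝕜 E)} :
    IsVonNBounded 𝕜 S ↔
      ∀ B : Set E, IsVonNBounded 𝕜 B → ∃ C : ℝ, ∀ T ∈ S, ∀ x ∈ B, ‖T x‖ ≤ C := by
  rw [ContinuousLinearMap.isVonNBounded_iff]
  refine forall₂_congr fun B hB => ?_
  rw [NormedSpace.isVonNBounded_iff']
  simp only [Set.mem_image2, forall_exists_index, and_imp]
  exact exists_congr fun C => ⟨fun h T hT x hx => h _ T hT x hx rfl,
    fun h _ T hT x hx e => e ▸ h T hT x hx⟩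

end BoundedSets

/-! ### Bounded sets of bounded module homomorphisms -/

section BoundedHomSets

variable {𝕜 A E F : Type*} [RCLike 𝕜] [CommRing A] [Algebra 𝕜 A]
  [AddCommGroup E] [Module 𝕜 E] [Module A E] [IsScalarTower 𝕜 A E] [TopologicalSpace E]
  [AddCommGroup F] [Module 𝕜 F] [Module A F] [IsScalarTower 𝕜 A F] [TopologicalSpace F]
  [IsTopologicalAddGroup F] [ContinuousSMul 𝕜 F] [ContinuousConstSMul A F]

@[simp] theorem BoundedHom.toLin_smul' (c : A) (l : BoundedHom 𝕜 A E F) (x : E) :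
    (c • l).toLin x = c • l.toLin x := rfl
@[simp] theorem BoundedHom.toLin_add (l l' : BoundedHom 𝕜 A E F) (x : E) :
    (l + l').toLin x = l.toLin x + l'.toLin x := rfl
@[simp] theorem BoundedHom.toLin_zero (x : E) :
    (0 : BoundedHom 𝕜 A E F).toLin x = 0 := rfl
theorem BoundedHom.ext {l l' : BoundedHom 𝕜 A E F} (h : ∀ x, l.toLin x = l'.toLin x) : l = l' :=
  Subtype.ext (LinearMap.ext h)

/-- Bounded sets are directed under union, so a single bounded set together with a single
neighbourhood of `0` describes a basic neighbourhood. -/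
theorem BoundedHom.hasBasis_nhds_zero :
    (nhds (0 : BoundedHom 𝕜 A E F)).HasBasis
      (fun p : Set E × Set F => IsVonNBounded 𝕜 p.1 ∧ p.2 ∈ nhds (0 : F))
      (fun p => {l | ∀ x ∈ p.1, l.toLin x ∈ p.2}) := by
  letI : UniformSpace F := IsTopologicalAddGroup.rightUniformSpace F
  rw [nhds_induced]
  have hb : (uniformity F).HasBasis (fun V => V ∈ nhds (0 : F))
      (fun V => {p : F × F | p.1 - p.2 ∈ V}) := by
    have := isUniformAddGroup_of_addCommGroup (G := F)
    rw [uniformity_eq_comap_nhds_zero_swapped]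
    exact (nhds (0 : F)).basis_sets.comap _
  have h := UniformOnFun.hasBasis_nhds_of_basis E F {B : Set E | IsVonNBounded 𝕜 B}
    (UniformOnFun.ofFun {B : Set E | IsVonNBounded 𝕜 B} (0 : BoundedHom 𝕜 A E F).toLin)
    ⟨∅, isVonNBounded_empty 𝕜 E⟩
    (by
      intro B hB C hC
      exact ⟨B ∪ C, hB.union hC, Set.subset_union_left, Set.subset_union_right⟩) hb
  refine (h.comap _).congr (fun _ => Iff.rfl) ?_
  rintro ⟨B, V⟩ _
  ext l
  simp [UniformOnFun.gen]

/-- Absorbing `S` into the basic neighbourhood of a pair `(B, V)` means absorbing into `V` all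
values of elements of `S` on `B`. -/
theorem BoundedHom.isVonNBounded_iff {S : Set (BoundedHom 𝕜 A E F)} :
    IsVonNBounded 𝕜 S ↔
      ∀ B : Set E, IsVonNBounded 𝕜 B → IsVonNBounded 𝕜 {y | ∃ l ∈ S, ∃ x ∈ B, l.toLin x = y} := by
  rw [BoundedHom.hasBasis_nhds_zero.isVonNBounded_iff]
  refine ⟨fun h B hB V hV => ?_, fun h ⟨B, V⟩ ⟨hB, hV⟩ => ?_⟩
  · filter_upwards [h ⟨B, V⟩ ⟨hB, hV⟩, eventually_ne_cobounded (0 : 𝕜)] with a ha ha0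
    rintro _ ⟨l, hl, x, hx, rfl⟩
    have h1 := ha hl
    rw [Set.mem_smul_set_iff_inv_smul_mem₀ ha0] at h1 ⊢
    exact h1 x hx
  · filter_upwards [h B hB hV, eventually_ne_cobounded (0 : 𝕜)] with a ha ha0
    intro l hl
    rw [Set.mem_smul_set_iff_inv_smul_mem₀ ha0]
    intro x hx
    have h1 := ha ⟨l, hl, x, hx, rfl⟩
    rw [Set.mem_smul_set_iff_inv_smul_mem₀ ha0] at h1
    exact h1

end BoundedHomSets

/-! ### The universal property of the bornological tensor product -/

section BornTensorLift

variable {𝕜 A E F G : Type*} [RCLike 𝕜] [CommRing A] [Algebra 𝕜 A]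
  [AddCommGroup E] [Module 𝕜 E] [Module A E] [IsScalarTower 𝕜 A E] [TopologicalSpace E]
  [AddCommGroup F] [Module 𝕜 F] [Module A F] [IsScalarTower 𝕜 A F] [TopologicalSpace F]
  [AddCommGroup G] [Module 𝕜 G] [TopologicalSpace G]

theorem isBoundedMap_baseTmul :
    IsBoundedMap 𝕜 (fun p : E × F => baseTmul 𝕜 p.1 p.2) :=
  fun B hB => isVonNBounded_sInf fun _ ht => ht.2 B hB

/-- A bilinear map is bounded if the images of products of bounded sets are bounded. -/
def IsBoundedBilin (b : E →ₗ[𝕜] F →ₗ[𝕜] G) : Prop :=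
  IsBoundedMap 𝕜 (fun p : E × F => b p.1 p.2)

/-- The linear map on the bornological tensor product over `𝕜` induced by a bounded bilinear map. -/
def baseLift [PolynormableSpace 𝕜 G] (b : E →ₗ[𝕜] F →ₗ[𝕜] G) (hb : IsBoundedBilin b) :
    BornTensorBase 𝕜 E F →L[𝕜] G where
  toLinearMap := TensorProduct.lift b
  cont := by
    let f : BornTensorBase 𝕜 E F →ₗ[𝕜] G := TensorProduct.lift b
    change Continuous f
    rw [continuous_iff_le_induced]
    refine sInf_le ⟨PolynormableSpace.induced f, fun B hB => isVonNBounded_induced f ?_⟩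
    refine (hb B hB).subset ?_
    rintro _ ⟨_, ⟨p, hp, rfl⟩, rfl⟩
    exact ⟨p, hp, (TensorProduct.lift.tmul p.1 p.2).symm⟩

@[simp] theorem baseLift_baseTmul [PolynormableSpace 𝕜 G] (b : E →ₗ[𝕜] F →ₗ[𝕜] G)
    (hb : IsBoundedBilin b) (x : E) (y : F) : baseLift b hb (baseTmul 𝕜 x y) = b x y :=
  TensorProduct.lift.tmul x y

@[elab_as_elim]
theorem base_induction {P : BornTensorBase 𝕜 E F → Prop} (z : BornTensorBase 𝕜 E F) (h0 : P 0)
    (ht : ∀ x y, P (baseTmul 𝕜 x y)) (ha : ∀ z w, P z → P w → P (z + w)) : P z :=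
  TensorProduct.induction_on (motive := P) z h0 ht ha

theorem smul_baseTmul (a : A) (x : E) (y : F) :
    a • baseTmul 𝕜 x y = baseTmul 𝕜 (a • x) y := rfl

variable [ContinuousConstSMul A E]

variable (𝕜 A E F) in
/-- The quotient map onto the bornological tensor product over `A`. -/
def bornMk : BornTensorBase 𝕜 E F →L[𝕜] BornTensor 𝕜 A E F where
  toFun z := Submodule.Quotient.mk z
  map_add' _ _ := rfl
  map_smul' _ _ := rfl
  cont := continuous_quot_mk

theorem bornTmul_add_left (x x' : E) (y : F) :
    bornTmul 𝕜 A (x + x') y = bornTmul 𝕜 A x y + bornTmul 𝕜 A x' y :=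
  congrArg (bornMk 𝕜 A E F) (TensorProduct.add_tmul x x' y)

theorem bornTmul_add_right (x : E) (y y' : F) :
    bornTmul 𝕜 A x (y + y') = bornTmul 𝕜 A x y + bornTmul 𝕜 A x y' :=
  congrArg (bornMk 𝕜 A E F) (TensorProduct.tmul_add x y y')

theorem bornTmul_smul_right (c : 𝕜) (x : E) (y : F) :
    bornTmul 𝕜 A x (c • y) = c • bornTmul 𝕜 A x y :=
  congrArg (bornMk 𝕜 A E F) (TensorProduct.tmul_smul c x y)

theorem bornTmul_zero_left (y : F) : bornTmul 𝕜 A (0 : E) y = 0 :=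
  congrArg (bornMk 𝕜 A E F) (TensorProduct.zero_tmul E y)

theorem bornTmul_sum_left {κ : Type*} (s : Finset κ) (x : κ → E) (y : F) :
    bornTmul 𝕜 A (∑ i ∈ s, x i) y = ∑ i ∈ s, bornTmul 𝕜 A (x i) y := by
  classical
  induction s using Finset.induction_on with
  | empty => simpa using bornTmul_zero_left y
  | insert i s hi ih => rw [Finset.sum_insert hi, Finset.sum_insert hi, bornTmul_add_left, ih]

theorem smul_bornTmul (a : A) (x : E) (y : F) :
    a • bornTmul 𝕜 A x y = bornTmul 𝕜 A (a • x) y := rfl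

theorem bornTmul_smul_left_eq (a : A) (x : E) (y : F) :
    bornTmul 𝕜 A (a • x) y = bornTmul 𝕜 A x (a • y) := by
  refine (Submodule.Quotient.eq _).2 (Submodule.le_topologicalClosure _ ?_)
  exact Submodule.subset_span ⟨a, x, y, rfl⟩

@[elab_as_elim]
theorem bornTensor_induction {P : BornTensor 𝕜 A E F → Prop} (z : BornTensor 𝕜 A E F) (h0 : P 0)
    (ht : ∀ x y, P (bornTmul 𝕜 A x y)) (ha : ∀ z w, P z → P w → P (z + w)) : P z := by
  induction z using Submodule.Quotient.induction_on with
  | H z =>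
    induction z using base_induction with
    | h0 => exact h0
    | ht x y => exact ht x y
    | ha z w hz hw => exact ha _ _ hz hw

theorem isBoundedMap_bornTmul :
    IsBoundedMap 𝕜 (fun p : E × F => bornTmul 𝕜 A p.1 p.2) :=
  (isBoundedMap_of_continuous (bornMk 𝕜 A E F)).comp isBoundedMap_baseTmul

theorem isBoundedMap_bornTmul_right [ContinuousSMul 𝕜 E] (x : E) :
    IsBoundedMap 𝕜 (fun y : F => bornTmul 𝕜 A x y) := fun B hB => by
  refine (isBoundedMap_bornTmul (𝕜 := 𝕜) (A := A) _
    (isVonNBounded_prod (isVonNBounded_singleton (𝕜 := 𝕜) x) hB)).subset ?_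
  rintro _ ⟨y, hy, rfl⟩
  exact ⟨(x, y), ⟨rfl, hy⟩, rfl⟩

/-- The continuous linear map on the bornological tensor product over `A` induced by a bounded
balanced bilinear map. -/
def bornLift [PolynormableSpace 𝕜 G] [T1Space G] (b : E →ₗ[𝕜] F →ₗ[𝕜] G)
    (hb : IsBoundedBilin b) (hA : ∀ (a : A) (x : E) (y : F), b (a • x) y = b x (a • y)) :
    BornTensor 𝕜 A E F →L[𝕜] G :=
  have hker : ∀ z ∈ (balancingSubmodule 𝕜 A E F).topologicalClosure, baseLift b hb z = 0 := by
    -- The span is taken over `A`, but the lift is only `𝕜`-linear. Quantifying over all multiples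
    -- `a • z` makes the induction close under the action of `A`.
    have hspan : ∀ z ∈ balancingSubmodule 𝕜 A E F, ∀ a : A, baseLift b hb (a • z) = 0 := by
      intro z hz
      induction hz using Submodule.span_induction with
      | mem z hz =>
        obtain ⟨a, x, y, rfl⟩ := hz
        intro c
        rw [smul_sub, smul_baseTmul, smul_baseTmul, map_sub, baseLift_baseTmul, baseLift_baseTmul,
          smul_comm, hA, sub_self]
      | zero => intro a; rw [smul_zero, map_zero]
      | add z w _ _ hz hw => intro a; rw [smul_add, map_add, hz, hw, add_zero]
      | smul c z _ hz => intro a; rw [smul_smul]; exact hz _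
    -- The quotient is by the closure of the balancing relations. As points of `G` are closed, the
    -- kernel is closed and contains this closure.
    have hcl : IsClosed {z | baseLift b hb z = 0} :=
      isClosed_singleton.preimage (baseLift b hb).continuous
    intro z hz
    exact closure_minimal (fun z hz => by simpa using hspan z hz 1) hcl hz
  have hrel : ∀ z w : BornTensorBase 𝕜 E F,
      (balancingSubmodule 𝕜 A E F).topologicalClosure.quotientRel z w →
        baseLift b hb z = baseLift b hb w := fun z w hzw => by
    rw [Submodule.quotientRel_def] at hzw
    rw [← sub_eq_zero, ← map_sub]
    exact hker _ hzw
  { toFun := Quotient.lift (baseLift b hb) hrel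
    map_add' := fun z w => by
      induction z using Submodule.Quotient.induction_on
      induction w using Submodule.Quotient.induction_on
      exact map_add (baseLift b hb) _ _
    map_smul' := fun c z => by
      induction z using Submodule.Quotient.induction_on
      exact map_smul (baseLift b hb) _ _
    cont := continuous_quot_lift _ (baseLift b hb).continuous }

@[simp] theorem bornLift_bornTmul [PolynormableSpace 𝕜 G] [T1Space G] (b : E →ₗ[𝕜] F →ₗ[𝕜] G)
    (hb : IsBoundedBilin b) (hA : ∀ (a : A) (x : E) (y : F), b (a • x) y = b x (a • y))
    (x : E) (y : F) : bornLift b hb hA (bornTmul 𝕜 A x y) = b x y :=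
  baseLift_baseTmul b hb x y

end BornTensorLift

/-! ### Topologies on spaces of sections -/

section SectionSpaces

variable {𝕜 : Type*} [RCLike 𝕜] {n : ℕ} {M : Type*} [TopologicalSpace M] [ChartedSpace (Euc n) M]
  [IsManifold (𝓡 n) ∞ M]
  {F : Type*} [NormedAddCommGroup F] [NormedSpace 𝕜 F] [NormedSpace ℝ F]
  [IsScalarTower ℝ 𝕜 F] {ι : Type*} {Z : VectorBundleCore 𝕜 M F ι}

instance : PolynormableSpace 𝕜 (SmoothSection n Z) := withSeminorms_section.toPolynormableSpace

instance : PolynormableSpace 𝕜 (CompSection n Z) := PolynormableSpace.sInf fun _ ht => ht.1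

variable (n Z) in
/-- The inclusion `Γ_c(Z) → Γ(Z)`. -/
def compToSection : CompSection n Z →ₗ[𝕜] SmoothSection n Z where
  toFun s := s.toSection
  map_add' _ _ := rfl
  map_smul' _ _ := rfl

theorem CompSection.toSection_injective :
    Function.Injective (CompSection.toSection : CompSection n Z → SmoothSection n Z) :=
  Subtype.val_injective

theorem CompSection.ext {s t : CompSection n Z} (h : ∀ x, s x = t x) : s = t :=
  CompSection.toSection_injective (SmoothSection.ext h)

@[simp] theorem CompSection.add_apply (s t : CompSection n Z) (x : M) :
    (s + t) x = s x + t x := rfl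
@[simp] theorem CompSection.zero_apply (x : M) : (0 : CompSection n Z) x = 0 := rfl
@[simp] theorem CompSection.const_smul_apply (c : 𝕜) (s : CompSection n Z) (x : M) :
    (c • s) x = c • s x := rfl
@[simp] theorem CompSection.smul_apply (f : SmoothFun 𝕜 n M) (s : CompSection n Z) (x : M) :
    (f • s) x = f x • s x := rfl

theorem SmoothSection.sum_apply {κ : Type*} (s : Finset κ) (t : κ → SmoothSection n Z) (x : M) :
    (∑ i ∈ s, t i : SmoothSection n Z) x = ∑ i ∈ s, t i x := by
  classical
  induction s using Finset.induction_on with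
  | empty => simp
  | insert i s hi ih => simp [Finset.sum_insert hi, ih]

theorem CompSection.sum_apply {κ : Type*} (s : Finset κ) (t : κ → CompSection n Z) (x : M) :
    (∑ i ∈ s, t i : CompSection n Z) x = ∑ i ∈ s, t i x := by
  classical
  induction s using Finset.induction_on with
  | empty => simp
  | insert i s hi ih => simp [Finset.sum_insert hi, ih]

/-- The seminorm of order zero attached to a one-point compact set and the preferred trivialization
at `x` is `s ↦ ‖s x‖`, and these separate sections. -/
instance : T1Space (SmoothSection n Z) := by
  refine withSeminorms_section.T1_of_separating fun s hs => ?_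
  obtain ⟨x, hx⟩ : ∃ x, s x ≠ 0 := by
    by_contra! h
    exact hs (SmoothSection.ext h)
  let φ := chartAt (Euc n) x
  have hxs : x ∈ φ.source := mem_chart_source _ x
  let a : SemIndex n Z :=
    { chart := φ
      chart_mem := chart_mem_atlas _ x
      triv := Z.indexAt x
      K := {φ x}
      isCompact_K := isCompact_singleton
      K_subset := by
        rw [Set.singleton_subset_iff]
        refine ⟨φ.map_source hxs, ?_⟩
        rw [Set.mem_preimage, φ.left_inv hxs]
        exact Z.mem_baseSet_at x
      order := 0 }
  refine ⟨a, fun h => hx ?_⟩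
  have h1 : ‖localDeriv a s (φ x)‖ ≤ sectionSeminorms n Z a s :=
    le_ciSup (bddAbove_localDeriv a s) ⟨φ x, rfl⟩
  have h2 : ‖localDeriv a s (φ x)‖ = ‖s x‖ := by
    rw [localDeriv, norm_iteratedFDerivWithin_zero, localRep, φ.left_inv hxs,
      Z.coordChange_self _ _ (Z.mem_baseSet_at x)]
  rw [h, h2] at h1
  exact norm_le_zero_iff.1 h1

variable (Z) in
/-- The sections supported in `K` form a submodule of the compactly supported ones. -/
def suppSubmodule (K : Set M) : Submodule 𝕜 (CompSection n Z) where
  carrier := {s | ∀ x, x ∉ K → s x = 0}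
  zero_mem' := fun _ _ => rfl
  add_mem' := fun {s t} hs ht x hx => by simp [hs x hx, ht x hx]
  smul_mem' := fun c s hs x hx => by simp [hs x hx]

instance (K : Set M) : AddCommGroup (SuppSection n Z K) :=
  inferInstanceAs (AddCommGroup (suppSubmodule Z K))
instance (K : Set M) : Module 𝕜 (SuppSection n Z K) :=
  inferInstanceAs (Module 𝕜 (suppSubmodule Z K))

variable (n Z) in
/-- The inclusion `Γ_{c,K}(Z) → Γ_c(Z)`. -/
def suppIncl (K : Set M) : SuppSection n Z K →ₗ[𝕜] CompSection n Z where
  toFun s := s.1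
  map_add' _ _ := rfl
  map_smul' _ _ := rfl

variable (n Z) in
/-- The inclusion `Γ_{c,K}(Z) → Γ(Z)`. -/
def suppToSection (K : Set M) : SuppSection n Z K →ₗ[𝕜] SmoothSection n Z :=
  compToSection n Z ∘ₗ suppIncl n Z K

theorem isInducing_suppToSection (K : Set M) : Topology.IsInducing (suppToSection n Z K) := ⟨rfl⟩

instance (K : Set M) : PolynormableSpace 𝕜 (SuppSection n Z K) :=
  (isInducing_suppToSection K).polynormableSpace

instance (K : Set M) : IsTopologicalAddGroup (SuppSection n Z K) :=
  (PolynormableSpace.withSeminorms 𝕜 (SuppSection n Z K)).topologicalAddGroup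

instance (K : Set M) : ContinuousSMul 𝕜 (SuppSection n Z K) :=
  (PolynormableSpace.withSeminorms 𝕜 (SuppSection n Z K)).continuousSMul

theorem continuous_suppIncl {K : Set M} (hK : IsCompact K) : Continuous (suppIncl n Z K) :=
  continuous_sInf_rng.2 fun _ ht => ht.2 K hK

/-- A linear map from `Γ_c(Z)` to a locally convex space is continuous if it is so on all spaces
`Γ_{c,K}(Z)`. -/
theorem continuous_of_comp_suppIncl {G : Type*} [AddCommGroup G] [Module 𝕜 G] [TopologicalSpace G]
    [PolynormableSpace 𝕜 G] (l : CompSection n Z →ₗ[𝕜] G)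
    (h : ∀ K : Set M, IsCompact K → Continuous (l ∘ₗ suppIncl n Z K)) : Continuous l := by
  rw [continuous_iff_le_induced]
  exact sInf_le ⟨PolynormableSpace.induced l, fun K hK => continuous_induced_rng.2 (h K hK)⟩

theorem continuous_compToSection : Continuous (compToSection n Z) :=
  continuous_of_comp_suppIncl _ fun K _ => (isInducing_suppToSection K).continuous

instance : T1Space (CompSection n Z) :=
  t1Space_of_injective_of_continuous CompSection.toSection_injective continuous_compToSection

/-- A seminorm on `Γ_c(Z)` is continuous if it is so on all spaces `Γ_{c,K}(Z)`. -/
theorem continuous_seminorm_of_comp_suppIncl (q : Seminorm 𝕜 (CompSection n Z))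
    (h : ∀ K : Set M, IsCompact K → Continuous (q.comp (suppIncl n Z K))) : Continuous q := by
  -- The topology generated by `q` alone competes in the definition of the inductive limit topology,
  -- which is therefore finer.
  let p : SeminormFamily 𝕜 (CompSection n Z) Unit := fun _ => q
  let t : TopologicalSpace (CompSection n Z) := p.moduleFilterBasis.topology
  have hp : @WithSeminorms 𝕜 _ Unit _ _ _ p t := @WithSeminorms.mk _ _ _ _ _ _ _ t rfl
  have ht : t ∈ compTopologies n Z := by
    refine ⟨@WithSeminorms.toPolynormableSpace _ _ _ _ _ _ t _ hp, fun K hK => ?_⟩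
    exact WithSeminorms.continuous_of_continuous_comp hp (suppIncl n Z K) fun _ => h K hK
  exact continuous_le_dom (sInf_le ht) (hp.continuous_seminorm ())

/-- The topology of `Γ_{c,K}(Z)` is induced from `Γ(Z)`, so the restriction of `p` is dominated by
finitely many defining seminorms. The bound depends on `K`. -/
theorem exists_bound_of_continuous_seminorm {p : Seminorm 𝕜 (CompSection n Z)} (hp : Continuous p)
    {K : Set M} (hK : IsCompact K) : ∃ (S : Finset (SemIndex n Z)) (C : ℝ), 0 ≤ C ∧
      ∀ s : CompSection n Z, (∀ x, x ∉ K → s x = 0) →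
        p s ≤ C * S.sup (sectionSeminorms n Z) s.toSection := by
  obtain ⟨S, C, -, h⟩ := Seminorm.bound_comp_of_isInducing
    (p := p.comp (suppIncl n Z K)) (hp.comp (continuous_suppIncl hK))
    withSeminorms_section (isInducing_suppToSection K)
  exact ⟨S, C, C.2, fun s hs => h ⟨s, hs⟩⟩

end SectionSpaces

/-! ### Pointwise bilinear pairings of sections -/

section Pairings

variable {𝕜 : Type*} [RCLike 𝕜] {n : ℕ} {M : Type*} [TopologicalSpace M] [ChartedSpace (Euc n) M]
  {F₁ F₂ F₃ : Type*} [NormedAddCommGroup F₁] [NormedSpace 𝕜 F₁] [NormedSpace ℝ F₁]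
  [IsScalarTower ℝ 𝕜 F₁] [NormedAddCommGroup F₂] [NormedSpace 𝕜 F₂] [NormedSpace ℝ F₂]
  [IsScalarTower ℝ 𝕜 F₂] [NormedAddCommGroup F₃] [NormedSpace 𝕜 F₃] [NormedSpace ℝ F₃]
  [IsScalarTower ℝ 𝕜 F₃] {ι₁ ι₂ ι₃ : Type*}

/-- A bilinear map of the model fibres which is compatible with the transition functions of the
bundles, for trivializations of `Z₁` and `Z₂` chosen for each trivialization of `Z₃`. -/
structure BundlePairing (Z₁ : VectorBundleCore 𝕜 M F₁ ι₁) (Z₂ : VectorBundleCore 𝕜 M F₂ ι₂)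
    (Z₃ : VectorBundleCore 𝕜 M F₃ ι₃) where
  bilin : F₁ →L[𝕜] F₂ →L[𝕜] F₃
  left : ι₃ → ι₁
  right : ι₃ → ι₂
  subset_left : ∀ l, Z₃.baseSet l ⊆ Z₁.baseSet (left l)
  subset_right : ∀ l, Z₃.baseSet l ⊆ Z₂.baseSet (right l)
  equivariant : ∀ l, ∀ x ∈ Z₃.baseSet l, ∀ v w,
    Z₃.coordChange (Z₃.indexAt x) l x (bilin v w) =
      bilin (Z₁.coordChange (Z₁.indexAt x) (left l) x v)
        (Z₂.coordChange (Z₂.indexAt x) (right l) x w)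

namespace BundlePairing

variable {Z₁ : VectorBundleCore 𝕜 M F₁ ι₁} {Z₂ : VectorBundleCore 𝕜 M F₂ ι₂}
    {Z₃ : VectorBundleCore 𝕜 M F₃ ι₃} (β : BundlePairing Z₁ Z₂ Z₃)

theorem overlap_left (φ : OpenPartialHomeomorph M (Euc n)) (l : ι₃) :
    overlap Z₃ φ l ⊆ overlap Z₁ φ (β.left l) :=
  fun _ hy => ⟨hy.1, β.subset_left l hy.2⟩

theorem overlap_right (φ : OpenPartialHomeomorph M (Euc n)) (l : ι₃) :
    overlap Z₃ φ l ⊆ overlap Z₂ φ (β.right l) :=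
  fun _ hy => ⟨hy.1, β.subset_right l hy.2⟩

/-- The bilinear map of the fibres over the reals. -/
def bilinReal : F₁ →L[ℝ] F₂ →L[ℝ] F₃ := β.bilin.bilinearRestrictScalars ℝ

theorem localRep_eqOn (φ : OpenPartialHomeomorph M (Euc n)) (l : ι₃) (s : M → F₁) (t : M → F₂) :
    Set.EqOn (localRep Z₃ φ l fun x => β.bilin (s x) (t x))
      (fun y => β.bilinReal (localRep Z₁ φ (β.left l) s y) (localRep Z₂ φ (β.right l) t y))
      (overlap Z₃ φ l) :=
  fun _ hy => β.equivariant l _ hy.2 _ _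

/-- The pointwise pairing of smooth sections. -/
def pair (s : SmoothSection n Z₁) (t : SmoothSection n Z₂) : SmoothSection n Z₃ :=
  ⟨fun x => β.bilin (s x) (t x), fun φ hφ l => by
    refine ContDiffOn.congr ?_ (β.localRep_eqOn φ l s t)
    exact β.bilinReal.isBoundedBilinearMap.contDiff.comp_contDiffOn
      (((s.2 φ hφ (β.left l)).mono (β.overlap_left φ l)).prodMk
        ((t.2 φ hφ (β.right l)).mono (β.overlap_right φ l)))⟩

@[simp] theorem pair_apply (s : SmoothSection n Z₁) (t : SmoothSection n Z₂) (x : M) :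
    β.pair s t x = β.bilin (s x) (t x) := rfl

variable [IsManifold (𝓡 n) ∞ M]

/-- The seminorm index of the first factor belonging to a seminorm index of the pairing. -/
def leftIndex (a : SemIndex n Z₃) (m : ℕ) : SemIndex n Z₁ :=
  { chart := a.chart, chart_mem := a.chart_mem, triv := β.left a.triv, K := a.K,
    isCompact_K := a.isCompact_K, K_subset := a.K_subset.trans (β.overlap_left _ _), order := m }

/-- The seminorm index of the second factor belonging to a seminorm index of the pairing. -/
def rightIndex (a : SemIndex n Z₃) (m : ℕ) : SemIndex n Z₂ :=
  { chart := a.chart, chart_mem := a.chart_mem, triv := β.right a.triv, K := a.K,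
    isCompact_K := a.isCompact_K, K_subset := a.K_subset.trans (β.overlap_right _ _), order := m }

theorem seminorm_sum_apply {E κ : Type*} [AddCommGroup E] [Module 𝕜 E] (p : κ → Seminorm 𝕜 E)
    (I : Finset κ) (x : E) : (∑ i ∈ I, p i) x = ∑ i ∈ I, p i x := by
  change FunLike.coeAddMonoidHom _ _ _ (∑ i ∈ I, p i) x = _
  rw [map_sum, Finset.sum_apply]
  rfl

theorem iteratedFDerivWithin_of_subset {G : Type*} [NormedAddCommGroup G] [NormedSpace ℝ G]
    {f : Euc n → G} {U V : Set (Euc n)} (hUV : U ⊆ V) (hU : IsOpen U) (hV : IsOpen V) (k : ℕ)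
    {y : Euc n} (hy : y ∈ U) :
    iteratedFDerivWithin ℝ k f U y = iteratedFDerivWithin ℝ k f V y := by
  rw [iteratedFDerivWithin_of_isOpen k hU hy, iteratedFDerivWithin_of_isOpen k hV (hUV hy)]

/-- Leibniz' rule for the fibrewise bilinear map. The factors may have larger overlaps than the
pairing, but on open sets derivatives do not depend on the set within which they are taken. -/
theorem sectionSeminorm_pair_le (a : SemIndex n Z₃) (s : SmoothSection n Z₁)
    (t : SmoothSection n Z₂) :
    sectionSeminorm a (β.pair s t) ≤ ‖β.bilinReal‖ * ∑ m ∈ Finset.range (a.order + 1),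
      (a.order.choose m : ℝ) * sectionSeminorm (β.leftIndex a m) s *
        sectionSeminorm (β.rightIndex a (a.order - m)) t := by
  have hnn : 0 ≤ ‖β.bilinReal‖ * ∑ m ∈ Finset.range (a.order + 1),
      (a.order.choose m : ℝ) * sectionSeminorm (β.leftIndex a m) s *
        sectionSeminorm (β.rightIndex a (a.order - m)) t :=
    mul_nonneg (norm_nonneg β.bilinReal) (Finset.sum_nonneg fun m _ =>
      mul_nonneg (mul_nonneg (Nat.cast_nonneg _) (apply_nonneg _ _)) (apply_nonneg _ _))
  refine Real.iSup_le (fun y => ?_) hnn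
  have hU := isOpen_overlap (Z := Z₃) a.chart a.triv
  have hy := a.K_subset y.2
  have h1 := (s.2 a.chart a.chart_mem (β.left a.triv)).mono (β.overlap_left a.chart a.triv)
  have h2 := (t.2 a.chart a.chart_mem (β.right a.triv)).mono (β.overlap_right a.chart a.triv)
  unfold localDeriv
  have e := iteratedFDerivWithin_congr (𝕜 := ℝ) (n := a.order)
    (β.localRep_eqOn a.chart a.triv s t) hy
  refine (congrArg norm e).trans_le ?_
  refine (β.bilinReal.norm_iteratedFDerivWithin_le_of_bilinear h1 h2 hU.uniqueDiffOn hy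
    (n := a.order) (by exact_mod_cast le_top)).trans ?_
  refine mul_le_mul_of_nonneg_left (Finset.sum_le_sum fun m _ => ?_) (norm_nonneg β.bilinReal)
  rw [iteratedFDerivWithin_of_subset (β.overlap_left a.chart a.triv) hU (isOpen_overlap _ _) _ hy,
    iteratedFDerivWithin_of_subset (β.overlap_right a.chart a.triv) hU (isOpen_overlap _ _) _ hy]
  have e1 : ‖localDeriv (β.leftIndex a m) s y‖ ≤ sectionSeminorm (β.leftIndex a m) s :=
    le_ciSup (bddAbove_localDeriv (β.leftIndex a m) s) y
  have e2 : ‖localDeriv (β.rightIndex a (a.order - m)) t y‖ ≤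
      sectionSeminorm (β.rightIndex a (a.order - m)) t :=
    le_ciSup (bddAbove_localDeriv (β.rightIndex a (a.order - m)) t) y
  exact mul_le_mul (mul_le_mul_of_nonneg_left e1 (Nat.cast_nonneg _)) e2 (norm_nonneg _)
    (mul_nonneg (Nat.cast_nonneg _) (apply_nonneg _ _))

/-- On a bounded set of first arguments, the pairing is bounded by a continuous seminorm of the
second argument. -/
theorem exists_bound {S : Set (SmoothSection n Z₁)} (hS : IsVonNBounded 𝕜 S)
    (I : Finset (SemIndex n Z₃)) :
    ∃ q : Seminorm 𝕜 (SmoothSection n Z₂), Continuous q ∧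
      ∀ s ∈ S, ∀ t, I.sup (sectionSeminorms n Z₃) (β.pair s t) ≤ q t := by
  classical
  have hC : ∀ a : SemIndex n Z₁, ∃ C : NNReal, ∀ s ∈ S, sectionSeminorm a s ≤ C := by
    intro a
    obtain ⟨C, hC, h⟩ := (withSeminorms_section.isVonNBounded_iff_seminorm_bounded.1 hS) a
    exact ⟨⟨C, hC.le⟩, fun s hs => (h s hs).le⟩
  choose C hC using hC
  let q : SemIndex n Z₃ → Seminorm 𝕜 (SmoothSection n Z₂) := fun a =>
    ∑ m ∈ Finset.range (a.order + 1), (‖β.bilinReal‖₊ * ((a.order.choose m : NNReal) *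
      C (β.leftIndex a m))) • sectionSeminorm (β.rightIndex a (a.order - m))
  have hq : ∀ a, Continuous (q a) := fun a => Seminorm.continuous_finsetSum fun m _ =>
    (withSeminorms_section.continuous_seminorm (β.rightIndex a (a.order - m))).const_smul _
  refine ⟨∑ a ∈ I, q a, Seminorm.continuous_finsetSum fun a _ => hq a, fun s hs t => ?_⟩
  refine Seminorm.finset_sup_apply_le (apply_nonneg _ _) fun a ha => ?_
  have h1 : sectionSeminorm a (β.pair s t) ≤ q a t := by
    refine (β.sectionSeminorm_pair_le a s t).trans ?_
    simp only [q, seminorm_sum_apply, Finset.mul_sum]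
    refine Finset.sum_le_sum fun m _ => ?_
    rw [smul_apply, NNReal.smul_def, smul_eq_mul]
    push_cast
    rw [mul_assoc ‖β.bilinReal‖]
    refine mul_le_mul_of_nonneg_left ?_ (norm_nonneg β.bilinReal)
    refine mul_le_mul_of_nonneg_right ?_ (apply_nonneg _ _)
    exact mul_le_mul_of_nonneg_left (hC _ s hs) (Nat.cast_nonneg _)
  refine h1.trans ?_
  rw [seminorm_sum_apply q I]
  exact Finset.single_le_sum (f := fun a => q a t) (fun _ _ => apply_nonneg _ _) ha

/-- The pointwise pairing with a compactly supported section. -/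
def pairComp : SmoothSection n Z₁ →ₗ[𝕜] CompSection n Z₂ →ₗ[𝕜] CompSection n Z₃ :=
  LinearMap.mk₂ 𝕜
    (fun s t => ⟨β.pair s t.toSection, HasCompactSupport.mono t.2 fun x hx ht =>
      hx (by rw [β.pair_apply]; exact (congrArg _ ht).trans (map_zero _))⟩)
    (fun _ _ _ => CompSection.ext fun _ => β.bilin.map_add₂ _ _ _)
    (fun _ _ _ => CompSection.ext fun _ => β.bilin.map_smul₂ _ _ _)
    (fun _ _ _ => CompSection.ext fun _ => map_add (β.bilin _) _ _)
    (fun _ _ _ => CompSection.ext fun _ => map_smul (β.bilin _) _ _)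

@[simp] theorem pairComp_apply (s : SmoothSection n Z₁) (t : CompSection n Z₂) (x : M) :
    β.pairComp s t x = β.bilin (s x) (t x) := rfl

theorem pairComp_smul_left (f : SmoothFun 𝕜 n M) (s : SmoothSection n Z₁) (t : CompSection n Z₂) :
    β.pairComp (f • s) t = f • β.pairComp s t :=
  CompSection.ext fun _ => β.bilin.map_smul₂ _ _ _

theorem pairComp_smul_right (f : SmoothFun 𝕜 n M) (s : SmoothSection n Z₁)
    (t : CompSection n Z₂) : β.pairComp s (f • t) = f • β.pairComp s t :=
  CompSection.ext fun _ => map_smul (β.bilin _) _ _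

/-- The pairings with the elements of a bounded set form an equicontinuous family. -/
theorem exists_continuous_seminorm_pairComp {S : Set (SmoothSection n Z₁)}
    (hS : IsVonNBounded 𝕜 S) {p : Seminorm 𝕜 (CompSection n Z₃)} (hp : Continuous p) :
    ∃ q : Seminorm 𝕜 (CompSection n Z₂), Continuous q ∧
      ∀ s ∈ S, ∀ t, p (β.pairComp s t) ≤ q t := by
  -- The seminorm obtained here depends on `K`. Only its uniformity over `S` matters, since the
  -- final seminorm is a supremum over `S` in which `K` no longer occurs.
  have hbound : ∀ K : Set M, IsCompact K → ∃ q : Seminorm 𝕜 (SmoothSection n Z₂), Continuous q ∧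
      ∀ s ∈ S, ∀ t : CompSection n Z₂, (∀ x, x ∉ K → t x = 0) →
        p (β.pairComp s t) ≤ q t.toSection := by
    intro K hK
    obtain ⟨I, C, hC, h⟩ := exists_bound_of_continuous_seminorm hp hK
    obtain ⟨q, hq, hqs⟩ := β.exists_bound hS I
    refine ⟨C.toNNReal • q, hq.const_smul _, fun s hs t ht => ?_⟩
    refine (h (β.pairComp s t) fun x hx => by
      rw [pairComp_apply, ht x hx, map_zero]).trans ?_
    rw [smul_apply, NNReal.smul_def, smul_eq_mul, Real.coe_toNNReal C hC]
    exact mul_le_mul_of_nonneg_left (hqs s hs _) hC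
  rcases S.eq_empty_or_nonempty with rfl | ⟨s₀, hs₀⟩
  · exact ⟨0, continuous_const, by simp⟩
  have hbdd : BddAbove (Set.range fun s : S => p.comp (β.pairComp s.1)) := by
    rw [Seminorm.bddAbove_range_iff]
    intro t
    -- The supremum is finite at each `t`: its support serves as the compact set.
    obtain ⟨q, -, hq⟩ := hbound (tsupport t.toSection.1) t.2
    refine ⟨q t.toSection, ?_⟩
    rintro _ ⟨s, rfl⟩
    exact hq s.1 s.2 t fun x hx => image_eq_zero_of_notMem_tsupport hx
  refine ⟨⨆ s : S, p.comp (β.pairComp s.1), ?_, fun s hs t => ?_⟩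
  -- Continuity is tested on each `Γ_{c,K}`, where the supremum is dominated by the seminorm from
  -- `hbound`.
  · refine continuous_seminorm_of_comp_suppIncl _ fun K hK => ?_
    obtain ⟨q, hq, hqs⟩ := hbound K hK
    have : Nonempty S := ⟨⟨s₀, hs₀⟩⟩
    refine Seminorm.continuous_of_le (q := q.comp (suppToSection n Z₂ K))
      (hq.comp (isInducing_suppToSection K).continuous) fun t => ?_
    rw [Seminorm.comp_apply, Seminorm.iSup_apply hbdd]
    exact ciSup_le fun s => hqs s.1 s.2 t.1 t.2
  · rw [Seminorm.iSup_apply hbdd]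
    have := (Seminorm.bddAbove_range_iff.1 hbdd) t
    exact le_ciSup this (⟨s, hs⟩ : S)

/-- Both projections of a bounded set of pairs are bounded. The first gives an equicontinuous family
of pairings, and the resulting seminorm is bounded on the second. -/
theorem isBoundedBilin_pairComp : IsBoundedBilin (β.pairComp (n := n)) := by
  intro B hB
  rw [isVonNBounded_iff_continuous_seminorm]
  intro p hp
  obtain ⟨q, hq, h⟩ := β.exists_continuous_seminorm_pairComp
    (hB.image (ContinuousLinearMap.fst 𝕜 (SmoothSection n Z₁) (CompSection n Z₂))) hp
  obtain ⟨C, hC⟩ := isVonNBounded_iff_continuous_seminorm.1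
    (hB.image (ContinuousLinearMap.snd 𝕜 (SmoothSection n Z₁) (CompSection n Z₂))) q hq
  refine ⟨C, ?_⟩
  rintro _ ⟨_, ⟨z, hz, rfl⟩, rfl⟩
  exact (h _ ⟨z, hz, rfl⟩ z.2).trans (hC ⟨z.2, ⟨z, hz, rfl⟩, rfl⟩)

/-- The pairing with a fixed section, as a continuous linear map. -/
def pairCompCLM (s : SmoothSection n Z₁) : CompSection n Z₂ →L[𝕜] CompSection n Z₃ where
  toLinearMap := β.pairComp s
  cont := by
    refine WithSeminorms.continuous_of_continuous_comp
      (PolynormableSpace.withSeminorms 𝕜 (CompSection n Z₃)) (β.pairComp s) fun p => ?_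
    obtain ⟨q, hq, h⟩ := β.exists_continuous_seminorm_pairComp
      (isVonNBounded_singleton (𝕜 := 𝕜) s) p.2
    exact Seminorm.continuous_of_le hq fun t => h s rfl t

end BundlePairing

end Pairings

/-! ### First countability of section spaces and continuity of bounded maps -/

section SmoothCores

variable {𝕜 : Type*} [RCLike 𝕜] {n : ℕ} {M : Type*} [TopologicalSpace M] [ChartedSpace (Euc n) M]
  {F : Type*} [NormedAddCommGroup F] [NormedSpace 𝕜 F] [NormedSpace ℝ F]
  [IsScalarTower ℝ 𝕜 F] {ι : Type*} {Z : VectorBundleCore 𝕜 M F ι}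

variable (n Z) in
/-- The transition functions of the bundle are smooth. -/
def HasSmoothTransitions : Prop :=
  ∀ φ ∈ atlas (Euc n) M, ∀ i j,
    ContDiffOn ℝ ∞ (fun y => Z.coordChange i j (φ.symm y)) (overlap Z φ i ∩ overlap Z φ j)

theorem localRep_eq_coordChange (φ ψ : OpenPartialHomeomorph M (Euc n)) (i j : ι) (s : M → F)
    {y : Euc n} (hi : φ.symm y ∈ Z.baseSet i) (hj : φ.symm y ∈ Z.baseSet j)
    (hψ : φ.symm y ∈ ψ.source) :
    localRep Z φ i s y = Z.coordChange j i (φ.symm y) (localRep Z ψ j s (ψ (φ.symm y))) := by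
  simp only [localRep]
  rw [ψ.left_inv hψ, Z.coordChange_comp _ _ _ _ ⟨⟨Z.mem_baseSet_at _, hj⟩, hi⟩]

variable [IsManifold (𝓡 n) ∞ M]

theorem contDiffOn_chart_transition {φ ψ : OpenPartialHomeomorph M (Euc n)}
    (hφ : φ ∈ atlas (Euc n) M) (hψ : ψ ∈ atlas (Euc n) M) :
    ContDiffOn ℝ ∞ (fun y => ψ (φ.symm y)) (φ.target ∩ φ.symm ⁻¹' ψ.source) := by
  have h1 := contMDiffOn_of_mem_maximalAtlas (I := 𝓡 n) (n := ∞)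
    (IsManifold.subset_maximalAtlas hψ)
  have h2 := contMDiffOn_symm_of_mem_maximalAtlas (I := 𝓡 n) (n := ∞)
    (IsManifold.subset_maximalAtlas hφ)
  exact (h1.comp' h2).contDiffOn

/-- Near a point, the derivatives of one local representation are bounded by those of another. -/
theorem exists_local_bound (hZ : HasSmoothTransitions n Z) (a : SemIndex n Z)
    {ψ : OpenPartialHomeomorph M (Euc n)} (hψ : ψ ∈ atlas (Euc n) M) {j : ι} {L : Set (Euc n)}
    (hL : IsCompact L) (hLs : L ⊆ overlap Z ψ j) {y₀ : Euc n} (hy₀ : y₀ ∈ a.K)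
    (hy₀s : a.chart.symm y₀ ∈ ψ.source) (hy₀L : ψ (a.chart.symm y₀) ∈ interior L) :
    ∃ V ∈ nhds y₀, ∃ C : ℝ, 0 ≤ C ∧ ∀ s : SmoothSection n Z, ∀ y ∈ V,
      ‖localDeriv a s y‖ ≤ C * ∑ m ∈ Finset.range (a.order + 1),
        sectionSeminorm (n := n) (Z := Z) ⟨ψ, hψ, j, L, hL, hLs, m⟩ s := by
  obtain ⟨φ, hφ, i, K, hK, hKs, k⟩ := a
  dsimp only at hy₀ hy₀s hy₀L ⊢
  let τ : Euc n → Euc n := fun y => ψ (φ.symm y)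
  let c : Euc n → F →L[𝕜] F := fun y => Z.coordChange j i (φ.symm y)
  have hτ0 : ContDiffOn ℝ ∞ τ (φ.target ∩ φ.symm ⁻¹' ψ.source) :=
    contDiffOn_chart_transition hφ hψ
  have hO : IsOpen (φ.target ∩ φ.symm ⁻¹' ψ.source) :=
    φ.isOpen_inter_preimage_symm ψ.open_source
  -- On `W` both local representations are defined and the change of chart `τ` lands in `L`, where
  -- the seminorms for `ψ` control derivatives.
  let W : Set (Euc n) := overlap Z φ i ∩ ((φ.target ∩ φ.symm ⁻¹' ψ.source) ∩ τ ⁻¹' interior L)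
  have hW : IsOpen W := (isOpen_overlap φ i).inter
    (hτ0.continuousOn.isOpen_inter_preimage hO isOpen_interior)
  have hWt : Set.MapsTo τ W (overlap Z ψ j) := fun y hy => hLs (interior_subset hy.2.2)
  have hWj : ∀ y ∈ W, φ.symm y ∈ Z.baseSet j := fun y hy => by
    have h := (hWt hy).2
    rwa [Set.mem_preimage, ψ.left_inv hy.2.1.2] at h
  have hc : ContDiffOn ℝ ∞ c W := (hZ φ hφ j i).mono fun y hy =>
    ⟨⟨hy.1.1, hWj y hy⟩, hy.1⟩
  have hτ : ContDiffOn ℝ ∞ τ W := hτ0.mono fun y hy => hy.2.1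
  have hWy₀ : y₀ ∈ W := ⟨hKs hy₀, ⟨(hKs hy₀).1, hy₀s⟩, hy₀L⟩
  obtain ⟨K', hK', hK'y, hK'W⟩ := exists_compact_subset hW hWy₀
  have hbd : ∀ m : ℕ, ∃ D : ℝ, ∀ y ∈ K', ‖iteratedFDerivWithin ℝ m τ W y‖ ≤ D ∧
      ‖iteratedFDerivWithin ℝ m c W y‖ ≤ D := by
    intro m
    obtain ⟨D₁, h₁⟩ := hK'.exists_bound_of_continuousOn
      ((hτ.continuousOn_iteratedFDerivWithin (m := m) (by exact_mod_cast le_top)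
        hW.uniqueDiffOn).mono hK'W)
    obtain ⟨D₂, h₂⟩ := hK'.exists_bound_of_continuousOn
      ((hc.continuousOn_iteratedFDerivWithin (m := m) (by exact_mod_cast le_top)
        hW.uniqueDiffOn).mono hK'W)
    exact ⟨max D₁ D₂, fun y hy => ⟨(h₁ y hy).trans (le_max_left _ _),
      (h₂ y hy).trans (le_max_right _ _)⟩⟩
  choose D₀ hD₀ using hbd
  -- The estimate for derivatives of a composition wants the `l`-th derivative of `τ` bounded by `D
  -- ^ l` for `l ≥ 1`. A common bound `D ≥ 1` meets this, as then `D ≤ D ^ l`.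
  obtain ⟨D, hD1, hD⟩ : ∃ D : ℝ, 1 ≤ D ∧ ∀ m ≤ k, D₀ m ≤ D := by
    refine ⟨1 + ∑ m ∈ Finset.range (k + 1), |D₀ m|, le_add_of_nonneg_right
      (Finset.sum_nonneg fun _ _ => abs_nonneg _), fun m hm => ?_⟩
    have := Finset.single_le_sum (f := fun m => |D₀ m|) (fun m _ => abs_nonneg (D₀ m))
      (Finset.mem_range.2 (Nat.lt_succ_of_le hm))
    have h2 := le_abs_self (D₀ m)
    linarith
  have hD0 : 0 ≤ D := zero_le_one.trans hD1
  let A : (F →L[𝕜] F) →L[ℝ] F →L[ℝ] F :=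
    (ContinuousLinearMap.id 𝕜 (F →L[𝕜] F)).bilinearRestrictScalars ℝ
  refine ⟨interior K', isOpen_interior.mem_nhds hK'y, ‖A‖ * ∑ m ∈ Finset.range (k + 1),
    (k.choose m : ℝ) * D * ((k - m).factorial * D ^ (k - m)),
    mul_nonneg (norm_nonneg A) (Finset.sum_nonneg fun m _ => by positivity), fun s y hy => ?_⟩
  have hyK := interior_subset hy
  have hyW : y ∈ W := hK'W hyK
  let Q : ℝ := ∑ m ∈ Finset.range (k + 1),
        sectionSeminorm (n := n) (Z := Z) ⟨ψ, hψ, j, L, hL, hLs, m⟩ s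
  have hs := s.2 ψ hψ j
  have hQ : ∀ m ≤ k, ‖iteratedFDerivWithin ℝ m (localRep Z ψ j s) (overlap Z ψ j) (τ y)‖ ≤ Q := by
    intro m hm
    have h1 : ‖localDeriv (n := n) (Z := Z) ⟨ψ, hψ, j, L, hL, hLs, m⟩ s (τ y)‖ ≤
        sectionSeminorm (n := n) (Z := Z) ⟨ψ, hψ, j, L, hL, hLs, m⟩ s :=
      le_ciSup (bddAbove_localDeriv (n := n) (Z := Z) ⟨ψ, hψ, j, L, hL, hLs, m⟩ s)
        ⟨τ y, interior_subset hyW.2.2⟩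
    refine h1.trans ?_
    exact Finset.single_le_sum
      (f := fun m => sectionSeminorm (n := n) (Z := Z) ⟨ψ, hψ, j, L, hL, hLs, m⟩ s)
      (fun _ _ => apply_nonneg _ _) (Finset.mem_range.2 (Nat.lt_succ_of_le hm))
  have hQ0 : 0 ≤ Q := Finset.sum_nonneg fun _ _ => apply_nonneg _ _
  have hcomp : ∀ m ≤ k, ‖iteratedFDerivWithin ℝ m (localRep Z ψ j s ∘ τ) W y‖ ≤
      m.factorial * Q * D ^ m := by
    intro m hm
    refine norm_iteratedFDerivWithin_comp_le hs hτ (by exact_mod_cast le_top)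
      (isOpen_overlap ψ j).uniqueDiffOn hW.uniqueDiffOn hWt hyW
      (fun l hl => hQ l (hl.trans hm)) fun l hl1 hl => ?_
    exact ((hD₀ l y hyK).1.trans (hD l (hl.trans hm))).trans
      (le_self_pow₀ hD1 (by omega))
  -- Changing chart and trivialization is composition with `τ` followed by the linear transition
  -- `c`. The chain rule and Leibniz' rule then compare the derivatives.
  have heq : Set.EqOn (localRep Z φ i s) (fun y => A (c y) ((localRep Z ψ j s ∘ τ) y)) W :=
    fun y hy => localRep_eq_coordChange φ ψ i j s hy.1.2 (hWj y hy) hy.2.1.2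
  have e1 : ‖iteratedFDerivWithin ℝ k (localRep Z φ i s) (overlap Z φ i) y‖ =
      ‖iteratedFDerivWithin ℝ k (fun y => A (c y) ((localRep Z ψ j s ∘ τ) y)) W y‖ := by
    rw [← BundlePairing.iteratedFDerivWithin_of_subset Set.inter_subset_left hW
      (isOpen_overlap φ i) k hyW, iteratedFDerivWithin_congr heq hyW]
  refine e1.trans_le ((A.norm_iteratedFDerivWithin_le_of_bilinear hc (hs.comp hτ hWt)
    hW.uniqueDiffOn hyW (n := k) (by exact_mod_cast le_top)).trans ?_)
  rw [mul_assoc, Finset.sum_mul]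
  refine mul_le_mul_of_nonneg_left (Finset.sum_le_sum fun m hm => ?_) (norm_nonneg A)
  have hm' : m ≤ k := Nat.lt_succ_iff.1 (Finset.mem_range.1 hm)
  rw [mul_assoc, mul_assoc, mul_assoc]
  refine mul_le_mul_of_nonneg_left ?_ (Nat.cast_nonneg _)
  refine mul_le_mul ((hD₀ m y hyK).2.trans (hD m hm')) ((hcomp _ (Nat.sub_le k m)).trans_eq ?_)
    (norm_nonneg _) hD0
  ring

/-- Countably many charts, shrunk to the interiors of compact sets `L x`, cover `M`. Their seminorms
dominate all others: the local bounds are patched together over the compact set of an arbitrary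
index. -/
theorem firstCountable_smoothSection [SecondCountableTopology M]
    (hZ : HasSmoothTransitions n Z) : FirstCountableTopology (SmoothSection n Z) := by
  classical
  have hex : ∀ x : M, ∃ L : Set (Euc n), IsCompact L ∧ L ⊆ overlap Z (chartAt (Euc n) x) (Z.indexAt x) ∧
      chartAt (Euc n) x x ∈ interior L := by
    intro x
    have hx := mem_chart_source (Euc n) x
    obtain ⟨L, hL, hxL, hLs⟩ := exists_compact_subset
      (isOpen_overlap (Z := Z) (chartAt (Euc n) x) (Z.indexAt x))
      (x := chartAt (Euc n) x x) ⟨(chartAt (Euc n) x).map_source hx, by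
        rw [Set.mem_preimage, (chartAt (Euc n) x).left_inv hx]; exact Z.mem_baseSet_at x⟩
    exact ⟨L, hL, hLs, hxL⟩
  choose L hL hLs hxL using hex
  let U : M → Set M := fun x =>
    (chartAt (Euc n) x).source ∩ chartAt (Euc n) x ⁻¹' interior (L x)
  have hU : ∀ x, U x ∈ nhds x := fun x =>
    ((chartAt (Euc n) x).isOpen_inter_preimage isOpen_interior).mem_nhds
      ⟨mem_chart_source (Euc n) x, hxL x⟩
  obtain ⟨S, hS, hSU⟩ := TopologicalSpace.countable_cover_nhds hU
  let b : M → ℕ → SemIndex n Z := fun x m =>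
    ⟨chartAt (Euc n) x, chart_mem_atlas _ x, Z.indexAt x, L x, hL x, hLs x, m⟩
  let q : SeminormFamily 𝕜 (SmoothSection n Z) (S × ℕ) := fun p => sectionSeminorm (b p.1 p.2)
  have : Countable S := hS.to_subtype
  have hq : WithSeminorms q := by
    -- One comparison is trivial, the new family being part of the old one.
    refine withSeminorms_section.congr (fun p => ⟨{b p.1 p.2}, 1, ?_⟩) fun a => ?_
    · rw [Finset.sup_singleton, one_smul]; exact le_rfl
    · have key : ∃ (I : Finset (S × ℕ)) (C : ℝ), 0 ≤ C ∧ ∀ s : SmoothSection n Z,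
          ∀ y ∈ a.K, ‖localDeriv a s y‖ ≤ C * I.sup q s := by
        refine a.isCompact_K.induction_on (p := fun T => ∃ (I : Finset (S × ℕ)) (C : ℝ), 0 ≤ C ∧
          ∀ s : SmoothSection n Z, ∀ y ∈ T, ‖localDeriv a s y‖ ≤ C * I.sup q s) ?_ ?_ ?_ ?_
        · exact ⟨∅, 0, le_rfl, by simp⟩
        · rintro T T' hT ⟨I, C, hC, h⟩
          exact ⟨I, C, hC, fun s y hy => h s y (hT hy)⟩
        · rintro T T' ⟨I, C, hC, h⟩ ⟨I', C', hC', h'⟩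
          refine ⟨I ∪ I', C + C', add_nonneg hC hC', fun s y hy => ?_⟩
          rw [Finset.sup_union, add_mul]
          have n1 : I.sup q s ≤ (I.sup q ⊔ I'.sup q) s := le_sup_left (a := I.sup q s)
          have n2 : I'.sup q s ≤ (I.sup q ⊔ I'.sup q) s := le_sup_right (a := I.sup q s)
          have n0 : 0 ≤ (I.sup q ⊔ I'.sup q) s := apply_nonneg _ _
          rcases hy with hy | hy
          · exact ((h s y hy).trans (mul_le_mul_of_nonneg_left n1 hC)).trans
              (le_add_of_nonneg_right (mul_nonneg hC' n0))
          · exact ((h' s y hy).trans (mul_le_mul_of_nonneg_left n2 hC')).trans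
              (le_add_of_nonneg_left (mul_nonneg hC n0))
        · intro y hy
          obtain ⟨x, hxS, hx⟩ := Set.mem_iUnion₂.1
            (hSU.symm ▸ Set.mem_univ (a.chart.symm y) : a.chart.symm y ∈ ⋃ x ∈ S, U x)
          obtain ⟨V, hV, C, hC, h⟩ := exists_local_bound hZ a (chart_mem_atlas _ x) (hL x) (hLs x)
            hy hx.1 hx.2
          let I : Finset (S × ℕ) := (Finset.range (a.order + 1)).image fun m => (⟨x, hxS⟩, m)
          refine ⟨V, mem_nhdsWithin_of_mem_nhds hV, I, C * (a.order + 1 : ℕ),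
            mul_nonneg hC (Nat.cast_nonneg _), fun s z hz => (h s z hz).trans ?_⟩
          rw [mul_assoc]
          refine mul_le_mul_of_nonneg_left ?_ hC
          refine (Finset.sum_le_card_nsmul _ _ (I.sup q s) fun m hm => ?_).trans_eq ?_
          · exact Seminorm.le_finset_sup_apply (p := q)
              (Finset.mem_image_of_mem (fun m => ((⟨x, hxS⟩ : S), m)) hm)
          · rw [Finset.card_range, nsmul_eq_mul]
      obtain ⟨I, C, hC, h⟩ := key
      refine ⟨I, ⟨C, hC⟩, fun s => ?_⟩
      exact Real.iSup_le (fun y => h s y y.2) (mul_nonneg hC (apply_nonneg _ _))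
  exact hq.firstCountableTopology

/-- Bounded linear maps on `Γ_c(Z)` are continuous. -/
theorem continuous_of_isBoundedMap [T2Space M] [SecondCountableTopology M]
    (hZ : HasSmoothTransitions n Z) {G : Type*} [AddCommGroup G] [Module 𝕜 G] [TopologicalSpace G]
    [PolynormableSpace 𝕜 G] (l : CompSection n Z →ₗ[𝕜] G) (hl : IsBoundedMap 𝕜 l) :
    Continuous l := by
  refine continuous_of_comp_suppIncl l fun K hK => ?_
  have := firstCountable_smoothSection hZ
  have : FirstCountableTopology (SuppSection n Z K) :=
    (isInducing_suppToSection K).firstCountableTopology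
  have : IsTopologicalAddGroup G := (PolynormableSpace.withSeminorms 𝕜 G).topologicalAddGroup
  have : ContinuousSMul 𝕜 G := (PolynormableSpace.withSeminorms 𝕜 G).continuousSMul
  -- First countability of `Γ_{c,K}` enters here: on such a space, bounded linear maps are
  -- continuous.
  refine LinearMap.continuous_of_locally_bounded (l ∘ₗ suppIncl n Z K) fun B hB => ?_
  have h := hl _ (hB.image ⟨suppIncl n Z K, continuous_suppIncl hK⟩)
  rwa [← Set.image_comp] at h

end SmoothCores

/-! ### Invariance of the contraction under coordinate changes -/

section ContractionAlgebra

variable (𝕜 : Type*) [RCLike 𝕜] (n r s : ℕ)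

/-- The pairing of tensor components of type `(r, s)` and `(s, r)`. -/
def contractBilin : TensorComp 𝕜 n r s →ₗ[𝕜] TensorComp 𝕜 n s r →ₗ[𝕜] 𝕜 :=
  LinearMap.mk₂ 𝕜 (fun v w => ∑ I : Fin r → Fin n, ∑ J : Fin s → Fin n, v (I, J) * w (J, I))
    (fun v v' w => by simp [add_mul, Finset.sum_add_distrib])
    (fun c v w => by simp [mul_assoc, Finset.mul_sum])
    (fun v w w' => by simp [mul_add, Finset.sum_add_distrib])
    (fun c v w => by simp [mul_left_comm, Finset.mul_sum])

variable {𝕜 n r s}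

theorem contractBilin_apply (v : TensorComp 𝕜 n r s) (w : TensorComp 𝕜 n s r) :
    contractBilin 𝕜 n r s v w =
      ∑ I : Fin r → Fin n, ∑ J : Fin s → Fin n, v (I, J) * w (J, I) := rfl

theorem contractBilin_eq_dotProduct (v : TensorComp 𝕜 n r s) (w : TensorComp 𝕜 n s r) :
    contractBilin 𝕜 n r s v w = v.ofLp ⬝ᵥ (w.ofLp ∘ Prod.swap) := by
  rw [contractBilin_apply, dotProduct, Fintype.sum_prod_type]
  rfl

theorem mulVec_comp_swap {κ κ' : Type*} [Fintype κ] [Fintype κ'] (P : Matrix κ κ 𝕜)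
    (Q : Matrix κ' κ' 𝕜) (w : κ × κ' → 𝕜) :
    (P ⊗ₖ Q).mulVec w ∘ Prod.swap = (Q ⊗ₖ P).mulVec (w ∘ Prod.swap) := by
  ext ⟨K, L⟩
  simp only [Function.comp, Matrix.mulVec, dotProduct, Prod.swap_prod_mk]
  rw [Fintype.sum_prod_type, Fintype.sum_prod_type, Finset.sum_comm]
  simp [Matrix.kroneckerMap_apply, mul_comm]

theorem tensorTransition_eq_kronecker (A B : Matrix (Fin n) (Fin n) ℝ) :
    tensorTransition 𝕜 r s A B = (tensorPow r A).map (algebraMap ℝ 𝕜) ⊗ₖ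
      ((tensorPow s B).map (algebraMap ℝ 𝕜)).transpose := by
  ext ⟨K, L⟩ ⟨I, J⟩
  simp [tensorTransition, Matrix.kroneckerMap_apply]

/-- After the two index blocks are swapped, the transition matrix of type `(s, r)` is inverse to the
transpose of that of type `(r, s)`, because `tensorPow` is multiplicative and `B * A = 1`. -/
theorem contractBilin_tensorTransition {A B : Matrix (Fin n) (Fin n) ℝ} (h : B * A = 1)
    (v : TensorComp 𝕜 n r s) (w : TensorComp 𝕜 n s r) :
    contractBilin 𝕜 n r s (Matrix.toEuclideanCLM (𝕜 := 𝕜) (tensorTransition 𝕜 r s A B) v)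
      (Matrix.toEuclideanCLM (𝕜 := 𝕜) (tensorTransition 𝕜 s r A B) w) =
    contractBilin 𝕜 n r s v w := by
  have hpow : ∀ k, (tensorPow k B).map (algebraMap ℝ 𝕜) * (tensorPow k A).map (algebraMap ℝ 𝕜) =
      1 := fun k => by
    rw [← Matrix.map_mul, ← tensorPow_mul, h, tensorPow_one]
    exact Matrix.map_one _ (map_zero _) (map_one _)
  rw [contractBilin_eq_dotProduct, contractBilin_eq_dotProduct]
  simp only [Matrix.ofLp_toEuclideanCLM]
  rw [tensorTransition_eq_kronecker (r := s), mulVec_comp_swap, Matrix.dotProduct_mulVec,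
    ← Matrix.mulVec_transpose, Matrix.mulVec_mulVec, tensorTransition_eq_kronecker (r := r),
    ← Matrix.kroneckerMap_transpose, ← Matrix.mul_kronecker_mul, Matrix.transpose_transpose,
    ← Matrix.transpose_mul, hpow, hpow, Matrix.transpose_one, Matrix.one_kronecker_one,
    Matrix.one_mulVec]

end ContractionAlgebra

/-! ### Smoothness of the concrete bundles and their pairings -/

section ConcreteBundles

variable {𝕜 : Type*} [RCLike 𝕜] {n : ℕ} {M : Type*} [TopologicalSpace M] [ChartedSpace (Euc n) M]
  [IsManifold (𝓡 n) ∞ M]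

theorem jacobian_mul_jacobian (i j : atlas (Euc n) M) {x : M}
    (hx : x ∈ i.1.source ∩ j.1.source) : jacobian j i x * jacobian i j x = 1 := by
  rw [jacobian_comp i j i ⟨hx, hx.1⟩, jacobian_self i hx.1]

theorem contDiffOn_jacobian {φ : OpenPartialHomeomorph M (Euc n)} (hφ : φ ∈ atlas (Euc n) M)
    (i j : atlas (Euc n) M) (a b : Fin n) :
    ContDiffOn ℝ ∞ (fun y => jacobian i j (φ.symm y) a b)
      (φ.target ∩ φ.symm ⁻¹' (i.1.source ∩ j.1.source)) := by
  -- Since `∞ + 1 = ∞`, no smoothness is lost on passing to the tangent bundle.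
  have hM : IsManifold (𝓡 n) (∞ + 1) M := ‹IsManifold (𝓡 n) ∞ M›
  have hc : (tangentBundleCore (𝓡 n) M).IsContMDiff (𝓡 n) ∞ :=
    tangentBundleCore.isContMDiff (h := hM)
  have h1 := (tangentBundleCore (𝓡 n) M).contMDiffOn_coordChange (𝓡 n) (n := ∞) i j
  have h2 := contMDiffOn_symm_of_mem_maximalAtlas (I := 𝓡 n) (n := ∞)
    (IsManifold.subset_maximalAtlas hφ)
  have h3 : ContDiffOn ℝ ∞ (fun y => (tangentBundleCore (𝓡 n) M).coordChange i j (φ.symm y))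
      (φ.target ∩ φ.symm ⁻¹' (i.1.source ∩ j.1.source)) := (h1.comp' h2).contDiffOn
  have h4 := (EuclideanSpace.proj (𝕜 := ℝ) a : Euc n →L[ℝ] ℝ).contDiff.comp_contDiffOn
    (h3.clm_apply (contDiffOn_const (c := EuclideanSpace.basisFun (Fin n) ℝ b)))
  refine h4.congr fun y _ => ?_
  simp [jacobian, LinearMap.toMatrix_apply]

theorem contDiffOn_ofReal {f : Euc n → ℝ} {U : Set (Euc n)} (hf : ContDiffOn ℝ ∞ f U) :
    ContDiffOn ℝ ∞ (fun y => (f y : 𝕜)) U :=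
  (RCLike.ofRealCLM (K := 𝕜)).contDiff.comp_contDiffOn hf

theorem contDiffOn_toEuclideanCLM {κ : Type*} [Fintype κ] [DecidableEq κ]
    {A : Euc n → Matrix κ κ 𝕜} {U : Set (Euc n)}
    (hA : ∀ a b, ContDiffOn ℝ ∞ (fun y => A y a b) U) :
    ContDiffOn ℝ ∞ (fun y => Matrix.toEuclideanCLM (𝕜 := 𝕜) (A y)) U := by
  have h : ∀ y, Matrix.toEuclideanCLM (𝕜 := 𝕜) (A y) =
      ∑ a, ∑ b, A y a b • Matrix.toEuclideanCLM (𝕜 := 𝕜) (Matrix.single a b (1 : 𝕜)) := by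
    intro y
    conv_lhs => rw [Matrix.matrix_eq_sum_single (A y)]
    simp only [map_sum, ← map_smul, Matrix.smul_single, smul_eq_mul, mul_one]
  simp only [h]
  exact ContDiffOn.sum fun a _ => ContDiffOn.sum fun b _ => (hA a b).smul contDiffOn_const

theorem hasSmoothTransitions_tensorBundle (r s : ℕ) :
    HasSmoothTransitions n (tensorBundle 𝕜 n M r s) := by
  intro φ hφ i j
  have hsub : overlap (tensorBundle 𝕜 n M r s) φ i ∩ overlap (tensorBundle 𝕜 n M r s) φ j ⊆
      φ.target ∩ φ.symm ⁻¹' (i.1.source ∩ j.1.source) := fun y hy => ⟨hy.1.1, hy.1.2, hy.2.2⟩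
  have hsub' : overlap (tensorBundle 𝕜 n M r s) φ i ∩ overlap (tensorBundle 𝕜 n M r s) φ j ⊆
      φ.target ∩ φ.symm ⁻¹' (j.1.source ∩ i.1.source) := fun y hy => ⟨hy.1.1, hy.2.2, hy.1.2⟩
  refine contDiffOn_toEuclideanCLM fun K L => ?_
  simp only [tensorTransition, tensorPow, Matrix.map_apply, Matrix.kroneckerMap_apply,
    Matrix.transpose_apply, Matrix.of_apply]
  exact contDiffOn_ofReal (ContDiffOn.mul
    (contDiffOn_prod fun a _ => (contDiffOn_jacobian hφ i j _ _).mono hsub)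
    (contDiffOn_prod fun a _ => (contDiffOn_jacobian hφ j i _ _).mono hsub'))

/-- The absolute value is smooth away from zero, and the Jacobian determinant does not vanish
because the Jacobian is invertible. -/
theorem hasSmoothTransitions_volBundle : HasSmoothTransitions n (volBundle 𝕜 n M) := by
  intro φ hφ i j
  have hsub : overlap (volBundle 𝕜 n M) φ i ∩ overlap (volBundle 𝕜 n M) φ j ⊆
      φ.target ∩ φ.symm ⁻¹' (j.1.source ∩ i.1.source) := fun y hy => ⟨hy.1.1, hy.2.2, hy.1.2⟩
  have hdet : ContDiffOn ℝ ∞ (fun y => (jacobian j i (φ.symm y)).det)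
      (overlap (volBundle 𝕜 n M) φ i ∩ overlap (volBundle 𝕜 n M) φ j) := by
    simp only [Matrix.det_apply]
    exact ContDiffOn.sum fun σ _ => (contDiffOn_prod fun a _ =>
      (contDiffOn_jacobian hφ j i _ _).mono hsub).const_smul _
  refine ContDiffOn.smul (contDiffOn_ofReal (𝕜 := 𝕜) (hdet.abs fun y hy h0 => ?_))
    (contDiffOn_const (c := ContinuousLinearMap.id 𝕜 𝕜))
  have h := congrArg Matrix.det (jacobian_mul_jacobian j i (hsub hy).2)
  rw [Matrix.det_mul, h0, mul_zero, Matrix.det_one] at h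
  exact zero_ne_one h

theorem contractBilin_coordChange {r s : ℕ} (i j : atlas (Euc n) M) {x : M}
    (hx : x ∈ i.1.source ∩ j.1.source) (v : TensorComp 𝕜 n r s) (w : TensorComp 𝕜 n s r) :
    contractBilin 𝕜 n r s ((tensorBundle 𝕜 n M r s).coordChange i j x v)
      ((tensorBundle 𝕜 n M s r).coordChange i j x w) = contractBilin 𝕜 n r s v w :=
  contractBilin_tensorTransition (jacobian_mul_jacobian i j hx) v w

theorem SmoothFun.ext {f g : SmoothFun 𝕜 n M} (h : ∀ x, f x = g x) : f = g :=
  Subtype.ext (funext h)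

theorem contMDiff_of_charts {f : M → 𝕜}
    (h : ∀ φ ∈ atlas (Euc n) M, ContDiffOn ℝ ∞ (fun y => f (φ.symm y)) φ.target) :
    ContMDiff (𝓡 n) 𝓘(ℝ, 𝕜) ∞ f := by
  intro x
  have h1 := (h _ (chart_mem_atlas (Euc n) x)).contMDiffOn
  have h2 := contMDiffOn_of_mem_maximalAtlas (I := 𝓡 n) (n := ∞)
    (IsManifold.subset_maximalAtlas (chart_mem_atlas (Euc n) x))
  have h3 := h1.comp h2 fun y hy => (chartAt (Euc n) x).map_source hy
  refine (h3.congr fun y hy => ?_).contMDiffAt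
    ((chartAt (Euc n) x).open_source.mem_nhds (mem_chart_source _ x))
  simp [(chartAt (Euc n) x).left_inv hy]

theorem contDiff_contractBilin (r s : ℕ) : ContDiff ℝ ∞
    (fun p : TensorComp 𝕜 n r s × TensorComp 𝕜 n s r => contractBilin 𝕜 n r s p.1 p.2) := by
  simp only [contractBilin_apply]
  refine ContDiff.sum fun I _ => ContDiff.sum fun J _ => ContDiff.mul ?_ ?_
  · exact (((EuclideanSpace.proj (𝕜 := 𝕜) (I, J) : TensorComp 𝕜 n r s →L[𝕜] 𝕜).restrictScalars
      ℝ).contDiff).comp contDiff_fst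
  · exact (((EuclideanSpace.proj (𝕜 := 𝕜) (J, I) : TensorComp 𝕜 n s r →L[𝕜] 𝕜).restrictScalars
      ℝ).contDiff).comp contDiff_snd

/-- The contraction of two tensor fields as a smooth function. -/
def contractFun {r s : ℕ} (u : TensorField 𝕜 n M r s) (t : TensorField 𝕜 n M s r) :
    SmoothFun 𝕜 n M :=
  ⟨fun x => contractBilin 𝕜 n r s (u x) (t x), contMDiff_of_charts fun φ hφ => by
    have hov : ∀ r s, overlap (tensorBundle 𝕜 n M r s) φ ⟨φ, hφ⟩ = φ.target := fun r s =>
      Set.inter_eq_left.2 fun y hy => φ.map_target hy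
    have hu := u.2 φ hφ ⟨φ, hφ⟩
    have ht := t.2 φ hφ ⟨φ, hφ⟩
    rw [hov] at hu ht
    refine ((contDiff_contractBilin r s).comp_contDiffOn (hu.prodMk ht)).congr fun y hy => ?_
    exact (contractBilin_coordChange (achart (Euc n) (φ.symm y)) ⟨φ, hφ⟩
      ⟨mem_chart_source _ _, φ.map_target hy⟩ _ _).symm⟩

@[simp] theorem contractFun_apply {r s : ℕ} (u : TensorField 𝕜 n M r s)
    (t : TensorField 𝕜 n M s r) (x : M) :
    contractFun u t x = contractBilin 𝕜 n r s (u x) (t x) := rfl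

variable (𝕜 n M) in
/-- The pointwise tensor product of tensor fields and densities. -/
def tensorDensityPairing (r s : ℕ) : BundlePairing (tensorBundle 𝕜 n M s r) (volBundle 𝕜 n M)
    (tensorProductBundle (tensorBundle 𝕜 n M s r) (volBundle 𝕜 n M)) where
  bilin := LinearMap.mkContinuous₂ (TensorProduct.mk 𝕜 (TensorComp 𝕜 n s r) 𝕜) 1
    (fun a b => by simp)
  left l := l.1
  right l := l.2
  subset_left _ := Set.inter_subset_left
  subset_right _ := Set.inter_subset_right
  equivariant _ _ _ _ _ := TensorProduct.map_tmul _ _ _ _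

variable (𝕜 n) in
/-- The contraction of tensor components with the first factor of a tensor product. -/
def contractTensor (r s : ℕ) :
    TensorComp 𝕜 n r s →ₗ[𝕜] (TensorComp 𝕜 n s r ⊗[𝕜] 𝕜) →ₗ[𝕜] 𝕜 where
  toFun v := TensorProduct.lift (LinearMap.mul 𝕜 𝕜 ∘ₗ contractBilin 𝕜 n r s v)
  map_add' v v' := TensorProduct.ext' fun w c => by simp
  map_smul' a v := TensorProduct.ext' fun w c => by simp [mul_assoc]

@[simp] theorem contractTensor_tmul (r s : ℕ) (v : TensorComp 𝕜 n r s) (w : TensorComp 𝕜 n s r)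
    (c : 𝕜) : contractTensor 𝕜 n r s v (w ⊗ₜ[𝕜] c) = contractBilin 𝕜 n r s v w * c := rfl

variable (𝕜 n M) in
/-- The contraction of tensor fields with tensor densities. -/
def contractDensityPairing (r s : ℕ) : BundlePairing (tensorBundle 𝕜 n M r s)
    (tensorProductBundle (tensorBundle 𝕜 n M s r) (volBundle 𝕜 n M)) (volBundle 𝕜 n M) where
  bilin := LinearMap.toContinuousLinearMap
    (LinearMap.toContinuousLinearMap.toLinearMap ∘ₗ contractTensor 𝕜 n r s)
  left l := l
  right l := (l, l)
  subset_left _ := le_rfl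
  subset_right _ := fun _ hx => ⟨hx, hx⟩
  equivariant l x hx v z := by
    change (volBundle 𝕜 n M).coordChange (achart (Euc n) x) l x (contractTensor 𝕜 n r s v z) =
      contractTensor 𝕜 n r s ((tensorBundle 𝕜 n M r s).coordChange (achart (Euc n) x) l x v)
        (TensorProduct.map
          ((tensorBundle 𝕜 n M s r).coordChange (achart (Euc n) x) l x :
            TensorComp 𝕜 n s r →ₗ[𝕜] TensorComp 𝕜 n s r)
          ((volBundle 𝕜 n M).coordChange (achart (Euc n) x) l x : 𝕜 →ₗ[𝕜] 𝕜) z)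
    induction z using TensorProduct.induction_on with
    | zero => simp only [map_zero]
    | add z z' hz hz' => rw [map_add, map_add, hz, hz', map_add, map_add]
    | tmul w c =>
      rw [TensorProduct.map_tmul, contractTensor_tmul, contractTensor_tmul]
      have h := contractBilin_coordChange (𝕜 := 𝕜) (achart (Euc n) x) l (x := x)
        ⟨mem_chart_source _ x, hx⟩ v w
      rw [ContinuousLinearMap.coe_coe, ContinuousLinearMap.coe_coe, h]
      exact map_smul ((volBundle 𝕜 n M).coordChange (achart (Euc n) x) l x)
        (contractBilin 𝕜 n r s v w) c

end ConcreteBundles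

/-! ### The algebra of eliminating one frame element -/

section FrameAlgebra

/-- The coefficients `b` form a linear relation among the `w j` whose product with `a` is `ρ`.
Replacing `w j` by `w j - a j • w₀` is compensated by subtracting `b j • ∑ k, a k • u k` from `ρ • u
j`: the relation kills the unwanted `w j`-terms, and the two `w₀`-terms cancel. When `a j = 1` and
`w₀ = w j`, the `j`-th term vanishes. -/
theorem sum_reduced_frame {R V₁ V₂ κ : Type*} [CommRing R] [AddCommGroup V₁] [Module R V₁]
    [AddCommGroup V₂] [Module R V₂] [Fintype κ] (β : V₁ →ₗ[R] V₂ →ₗ[R] R) (u : κ → V₁)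
    (w : κ → V₂) (h : R) (hf : ∀ v, ∑ i, β (u i) v • w i = h • v) (a c : κ → R) (w₀ v : V₂)
    {ρ : R} (hρ : ρ = ∑ j, c j * (h * a j - ∑ i, a i * β (u i) (w j)))
    {b : κ → R} (hb : ∀ j, b j = h * c j - ∑ k, β (u j) (w k) * c k) :
    ∑ j, β (ρ • u j - b j • ∑ k, a k • u k) v • (w j - a j • w₀) = (h * ρ) • v := by
  -- By the frame identity, the matrix `β (u j) (w k)` acts on combinations of the `w j` as
  -- multiplication by `h`, so `b` is a relation for any `c`.
  have h1 : ∑ j, b j • w j = 0 := by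
    simp only [hb, sub_smul, Finset.sum_sub_distrib, Finset.sum_smul]
    rw [Finset.sum_comm (s := Finset.univ) (t := Finset.univ), ← Finset.sum_sub_distrib]
    refine Finset.sum_eq_zero fun k _ => ?_
    have h2 : ∑ j, (β (u j) (w k) * c k) • w j = (h * c k) • w k := by
      rw [mul_comm, mul_smul, ← hf, Finset.smul_sum]
      exact Finset.sum_congr rfl fun j _ => by rw [mul_comm, mul_smul]
    rw [h2, sub_self]
  have h2 : ∑ j, b j * a j = ρ := by
    rw [hρ]
    simp only [hb, sub_mul, mul_sub, Finset.sum_sub_distrib, Finset.sum_mul, Finset.mul_sum]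
    congr 1
    · exact Finset.sum_congr rfl fun j _ => by ring
    · rw [Finset.sum_comm]
      exact Finset.sum_congr rfl fun j _ => Finset.sum_congr rfl fun k _ => by ring
  have h3 : ∀ j, β (ρ • u j - b j • ∑ k, a k • u k) v • (w j - a j • w₀) =
      ρ • β (u j) v • w j - (∑ k, a k * β (u k) v) • b j • w j -
        ((ρ * (a j * β (u j) v)) • w₀ - ((∑ k, a k * β (u k) v) * (b j * a j)) • w₀) := by
    intro j
    simp only [map_sub, map_smul, map_sum, LinearMap.sub_apply, LinearMap.smul_apply,
      LinearMap.sum_apply, smul_eq_mul, smul_sub, sub_smul, smul_smul]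
    generalize ∑ k, a k * β (u k) v = S
    module
  simp only [h3, Finset.sum_sub_distrib, ← Finset.smul_sum, ← Finset.sum_smul, h1, hf,
    ← Finset.mul_sum, h2]
  rw [smul_zero, sub_zero, mul_comm ρ, sub_self, sub_zero, smul_smul, mul_comm]

end FrameAlgebra

/-! ### Frames up to a factor, and generic reduction of their size -/

section Frames

variable {𝕜 : Type*} [RCLike 𝕜] {n : ℕ} {M : Type*} [TopologicalSpace M] [ChartedSpace (Euc n) M]

theorem SmoothFun.sum_apply {κ : Type*} (s : Finset κ) (f : κ → SmoothFun 𝕜 n M) (x : M) :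
    (∑ i ∈ s, f i : SmoothFun 𝕜 n M) x = ∑ i ∈ s, f i x := by
  classical
  induction s using Finset.induction_on with
  | empty => simp
  | insert i s hi ih => simp [Finset.sum_insert hi, ih]

@[simp] theorem SmoothFun.sub_apply (f g : SmoothFun 𝕜 n M) (x : M) : (f - g) x = f x - g x := rfl

/-- The complex conjugate of a smooth function. -/
def SmoothFun.conj (f : SmoothFun 𝕜 n M) : SmoothFun 𝕜 n M :=
  ⟨fun x => (starRingEnd 𝕜) (f x),
    (RCLike.conjCLE (K := 𝕜)).contDiff.contMDiff.comp (f.2 : ContMDiff (𝓡 n) 𝓘(ℝ, 𝕜) ∞ f.1)⟩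

@[simp] theorem SmoothFun.conj_apply (f : SmoothFun 𝕜 n M) (x : M) :
    f.conj x = (starRingEnd 𝕜) (f x) := rfl

/-- The function takes nonnegative real values only. -/
def SmoothFun.IsNonneg (f : SmoothFun 𝕜 n M) : Prop := ∀ x, ∃ c : ℝ, 0 ≤ c ∧ f x = (c : 𝕜)

theorem SmoothFun.IsNonneg.mul {f g : SmoothFun 𝕜 n M} (hf : f.IsNonneg) (hg : g.IsNonneg) :
    (f * g).IsNonneg := fun x => by
  obtain ⟨c, hc, h⟩ := hf x
  obtain ⟨d, hd, h'⟩ := hg x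
  exact ⟨c * d, mul_nonneg hc hd, by simp [h, h']⟩

theorem SmoothFun.IsNonneg.add {f g : SmoothFun 𝕜 n M} (hf : f.IsNonneg) (hg : g.IsNonneg) :
    (f + g).IsNonneg := fun x => by
  obtain ⟨c, hc, h⟩ := hf x
  obtain ⟨d, hd, h'⟩ := hg x
  exact ⟨c + d, add_nonneg hc hd, by simp [h, h']⟩

/-- Nonnegative reals do not cancel. Factors of frames are kept nonnegative so that they stay
nonzero when frames are joined. -/
theorem SmoothFun.IsNonneg.add_ne_zero {f g : SmoothFun 𝕜 n M} (hf : f.IsNonneg)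
    (hg : g.IsNonneg) {x : M} (h : f x ≠ 0 ∨ g x ≠ 0) : (f + g) x ≠ 0 := by
  obtain ⟨c, hc, e⟩ := hf x
  obtain ⟨d, hd, e'⟩ := hg x
  rw [SmoothFun.add_apply]
  rw [e, e'] at h ⊢
  rw [← RCLike.ofReal_add]
  simp only [ne_eq, RCLike.ofReal_eq_zero] at h ⊢
  intro h0
  rcases h with h | h
  · exact h (by linarith)
  · exact h (by linarith)

variable [IsManifold (𝓡 n) ∞ M] {r s : ℕ}

/-- Tensor fields `u i` and `w i` such that `∑ i, ⟨u i, t⟩ w i = h t` for all `t`. -/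
def IsFrame {κ : Type*} [Fintype κ] (h : SmoothFun 𝕜 n M) (u : κ → TensorField 𝕜 n M r s)
    (w : κ → TensorField 𝕜 n M s r) : Prop :=
  ∀ (x : M) (v : TensorComp 𝕜 n s r),
    ∑ i, contractBilin 𝕜 n r s (u i x) v • w i x = h x • v

/-- A `C^1` map is locally Lipschitz and does not raise Hausdorff dimension, so the countable union
of images has dimension at most `dim E < dim G`. -/
theorem dense_compl_image {E G : Type*} [NormedAddCommGroup E] [NormedSpace ℝ E]
    [FiniteDimensional ℝ E] [NormedAddCommGroup G] [NormedSpace ℝ G] [FiniteDimensional ℝ G]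
    {κ : Type*} [Countable κ] {f : κ → E → G} {U : κ → Set E} (hU : ∀ k, IsOpen (U k))
    (hf : ∀ k, ContDiffOn ℝ 1 (f k) (U k))
    (hd : Module.finrank ℝ E < Module.finrank ℝ G) : Dense (⋃ k, f k '' U k)ᶜ := by
  refine dense_compl_of_dimH_lt_finrank ?_
  rw [dimH_iUnion]
  refine (iSup_le fun k => ?_).trans_lt (b := (Module.finrank ℝ E : ENNReal)) (Nat.cast_lt.2 hd)
  refine (dimH_image_le_of_locally_lipschitzOn fun x hx => ?_).trans
    ((dimH_mono (Set.subset_univ (U k))).trans_eq (Real.dimH_univ_eq_finrank E))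
  obtain ⟨C, t, ht, h⟩ := ((hf k).contDiffAt ((hU k).mem_nhds hx)).exists_lipschitzOnWith
  exact ⟨C, t, mem_nhdsWithin_of_mem_nhds ht, h⟩

theorem contDiffOn_localRep_self (w : TensorField 𝕜 n M s r)
    {φ : OpenPartialHomeomorph M (Euc n)} (hφ : φ ∈ atlas (Euc n) M) :
    ContDiffOn ℝ ∞ (localRep (tensorBundle 𝕜 n M s r) φ ⟨φ, hφ⟩ w) φ.target :=
  (w.2 φ hφ ⟨φ, hφ⟩).mono fun _ hy => ⟨hy, φ.map_target hy⟩

/-- For more tensor fields than the dimension of the total space of the dual bundle, there are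
coefficients which are not the values of a covector on these fields. -/
theorem exists_generic_coefficients [SecondCountableTopology M] {N : ℕ}
    (w : Fin (N + 1) → TensorField 𝕜 n M s r)
    (hN : n + Module.finrank ℝ (TensorComp 𝕜 n r s) ≤ N) :
    ∃ a : Fin (N + 1) → 𝕜, a (Fin.last N) = 1 ∧
      ∀ (x : M) (ξ : TensorComp 𝕜 n r s), ∃ j, a j ≠ contractBilin 𝕜 n r s ξ (w j x) := by
  obtain ⟨S, hS, hSM⟩ := TopologicalSpace.countable_cover_nhds
    (fun x : M => (chartAt (Euc n) x).open_source.mem_nhds (mem_chart_source (Euc n) x))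
  have : Countable S := hS.to_subtype
  let U : S → Set (Euc n × TensorComp 𝕜 n r s) := fun k => (chartAt (Euc n) k.1).target ×ˢ Set.univ
  -- The values to be avoided, parametrized over countably many charts by a base point and a
  -- covector.
  let f : S → Euc n × TensorComp 𝕜 n r s → (Fin (N + 1) → 𝕜) := fun k p j =>
    contractBilin 𝕜 n r s p.2
      (localRep (tensorBundle 𝕜 n M s r) (chartAt (Euc n) k.1) (achart (Euc n) k.1) (w j) p.1)
  have hU : ∀ k, IsOpen (U k) := fun k => (chartAt (Euc n) k.1).open_target.prod isOpen_univ
  have hf : ∀ k, ContDiffOn ℝ 1 (f k) (U k) := fun k => by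
    have h0 : Set.MapsTo (Prod.fst : Euc n × TensorComp 𝕜 n r s → Euc n) (U k)
        (chartAt (Euc n) k.1).target := fun p hp => hp.1
    have h1 : ∀ j, ContDiffOn ℝ ∞ (fun p : Euc n × TensorComp 𝕜 n r s => localRep
        (tensorBundle 𝕜 n M s r) (chartAt (Euc n) k.1) (achart (Euc n) k.1) (w j) p.1) (U k) := by
      intro j
      have h := contDiffOn_localRep_self (w j) (chart_mem_atlas (Euc n) k.1)
      have h' : ContDiffOn ℝ ∞ (Prod.fst : Euc n × TensorComp 𝕜 n r s → Euc n) (U k) :=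
        contDiff_fst.contDiffOn
      have h'' := h.comp h' h0
      exact h''
    have h2 : ContDiffOn ℝ ∞ (fun p : Euc n × TensorComp 𝕜 n r s => p.2) (U k) := by
      exact contDiff_snd.contDiffOn
    have h3 : ∀ j, ContDiffOn ℝ ∞ (fun p : Euc n × TensorComp 𝕜 n r s =>
        contractBilin 𝕜 n r s p.2 (localRep (tensorBundle 𝕜 n M s r) (chartAt (Euc n) k.1)
          (achart (Euc n) k.1) (w j) p.1)) (U k) := by
      intro j
      have h4 := h2.prodMk (h1 j)
      have h5 := (contDiff_contractBilin (𝕜 := 𝕜) (n := n) r s).comp_contDiffOn h4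
      exact h5
    have h6 : ContDiffOn ℝ ∞ (f k) (U k) := contDiffOn_pi.2 h3
    exact h6.of_le (by exact_mod_cast le_top)
  have hd : Module.finrank ℝ (Euc n × TensorComp 𝕜 n r s) <
      Module.finrank ℝ (Fin (N + 1) → 𝕜) := by
    rw [Module.finrank_prod, finrank_euclideanSpace_fin, Module.finrank_pi_fintype]
    simp only [Finset.sum_const, Finset.card_univ, Fintype.card_fin, smul_eq_mul]
    have h1 : 1 ≤ Module.finrank ℝ 𝕜 := Module.finrank_pos
    nlinarith
  have hdense := dense_compl_image hU hf hd
  -- A dense set meets this nonempty open set, so the last coefficient may be taken nonzero and then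
  -- normalized to `1`.
  have hO : IsOpen {a : Fin (N + 1) → 𝕜 | a (Fin.last N) ≠ 0} :=
    isOpen_ne.preimage (continuous_apply (Fin.last N))
  obtain ⟨a, hmem, ha0⟩ := hdense.inter_open_nonempty _ hO ⟨fun _ => 1, one_ne_zero⟩
  have ha : a (Fin.last N) ≠ 0 := hmem
  clear hdense hO hmem
  have hone : (a (Fin.last N))⁻¹ * a (Fin.last N) = 1 := inv_mul_cancel₀ ha
  suffices hgen : ∀ (x : M) (ξ : TensorComp 𝕜 n r s), ∃ j,
      (a (Fin.last N))⁻¹ * a j ≠ contractBilin 𝕜 n r s ξ (w j x) from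
    ⟨fun j => (a (Fin.last N))⁻¹ * a j, hone, hgen⟩
  intro x ξ
  by_contra! hx
  refine ha0 ?_
  obtain ⟨k, hkS, hk⟩ := Set.mem_iUnion₂.1
    (hSM.symm ▸ Set.mem_univ x : x ∈ ⋃ y ∈ S, (chartAt (Euc n) y).source)
  let ξ' : TensorComp 𝕜 n r s :=
    (tensorBundle 𝕜 n M r s).coordChange (achart (Euc n) x) (achart (Euc n) k) x ξ
  have h1 : ∀ j, contractBilin 𝕜 n r s ξ' (localRep (tensorBundle 𝕜 n M s r) (chartAt (Euc n) k)
      (achart (Euc n) k) (w j) (chartAt (Euc n) k x)) = contractBilin 𝕜 n r s ξ (w j x) := by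
    intro j
    rw [localRep, (chartAt (Euc n) k).left_inv hk]
    exact contractBilin_coordChange (𝕜 := 𝕜) (achart (Euc n) x) (achart (Euc n) k) (x := x)
      ⟨mem_chart_source _ x, hk⟩ ξ (w j x)
  -- The set of avoided values is stable under scalars, which are absorbed into the covector, so the
  -- normalization does no harm.
  have h2 : f ⟨k, hkS⟩ (chartAt (Euc n) k x, a (Fin.last N) • ξ') = a := funext fun j => by
    simp only [f]
    rw [map_smul, LinearMap.smul_apply, h1, ← hx j, smul_eq_mul, mul_inv_cancel_left₀ ha]
  have h3 : (chartAt (Euc n) k x, a (Fin.last N) • ξ') ∈ U ⟨k, hkS⟩ :=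
    ⟨(chartAt (Euc n) k).map_source hk, Set.mem_univ _⟩
  exact Set.mem_iUnion_of_mem ⟨k, hkS⟩ (h2 ▸ Set.mem_image_of_mem (f ⟨k, hkS⟩) h3)

/-- The fields are projected along a generic vector `a`: each `w j` is replaced by `w j - a j • w
(Fin.last N)`, which removes the last one. Genericity of `a` keeps the new factor nonzero on `K`. -/
theorem IsFrame.reduce [SecondCountableTopology M] {N : ℕ} {h : SmoothFun 𝕜 n M}
    {u : Fin (N + 1) → TensorField 𝕜 n M r s} {w : Fin (N + 1) → TensorField 𝕜 n M s r}
    (hF : IsFrame h u w) (h0 : h.IsNonneg) {K : Set M} (hK : ∀ x ∈ K, h x ≠ 0)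
    (hN : n + Module.finrank ℝ (TensorComp 𝕜 n r s) ≤ N) :
    ∃ (h' : SmoothFun 𝕜 n M) (u' : Fin N → TensorField 𝕜 n M r s)
      (w' : Fin N → TensorField 𝕜 n M s r), IsFrame h' u' w' ∧ h'.IsNonneg ∧
        ∀ x ∈ K, h' x ≠ 0 := by
  obtain ⟨a, ha1, ha⟩ := exists_generic_coefficients w hN
  -- `R` measures how far `h • a` is from the values of the covector `∑ i, a i • u i` on the `w j`.
  -- Choosing `c` as its conjugate makes `ρ` the smooth nonnegative function `∑ j, ‖R j‖ ^ 2`.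
  let R : Fin (N + 1) → SmoothFun 𝕜 n M := fun j => a j • h - ∑ i, a i • contractFun (u i) (w j)
  let ρ : SmoothFun 𝕜 n M := ∑ j, (R j).conj * R j
  let b : Fin (N + 1) → SmoothFun 𝕜 n M := fun j =>
    h * (R j).conj - ∑ k, contractFun (u j) (w k) * (R k).conj
  let u₀ : TensorField 𝕜 n M r s := ∑ k, a k • u k
  have hR : ∀ x j, R j x =
      h x * a j - ∑ i, a i * contractBilin 𝕜 n r s (u i x) (w j x) := fun x j => by
    simp only [R, SmoothFun.sub_apply, SmoothFun.smul_apply, SmoothFun.sum_apply,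
      contractFun_apply, mul_comm (a j)]
  have hρ : ∀ x, ρ x = ((∑ j, ‖R j x‖ ^ 2 : ℝ) : 𝕜) := fun x => by
    simp only [ρ, SmoothFun.sum_apply, SmoothFun.mul_apply, SmoothFun.conj_apply, RCLike.conj_mul]
    push_cast
    rfl
  have hρ0 : ρ.IsNonneg := fun x => ⟨_, Finset.sum_nonneg fun _ _ => by positivity, hρ x⟩
  refine ⟨h * ρ, fun i => ρ • u i.castSucc - b i.castSucc • u₀,
    fun i => w i.castSucc - a i.castSucc • w (Fin.last N), fun x v => ?_, h0.mul hρ0,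
    fun x hx => ?_⟩
  · have key := sum_reduced_frame (contractBilin 𝕜 n r s) (fun i => u i x) (fun i => w i x) (h x)
      (hF x) a (fun j => (R j).conj x) (w (Fin.last N) x) v (ρ := ρ x) (b := fun j => b j x)
      (by simp only [ρ, SmoothFun.sum_apply, SmoothFun.mul_apply, hR])
      (fun j => by
        simp only [b, SmoothFun.sub_apply, SmoothFun.mul_apply, SmoothFun.sum_apply,
          contractFun_apply])
    rw [Fin.sum_univ_castSucc, ha1, one_smul, sub_self, smul_zero, add_zero] at key
    rw [SmoothFun.mul_apply, ← key]
    refine Finset.sum_congr rfl fun i _ => ?_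
    have e1 : u₀ x = ∑ k, a k • u k x := SmoothSection.sum_apply _ _ _
    rw [← e1]
    rfl
  · rw [SmoothFun.mul_apply]
    refine mul_ne_zero (hK x hx) ?_
    -- If all `R j` vanished at `x`, then `a` would consist of the values of this covector.
    obtain ⟨j, hj⟩ := ha x ((h x)⁻¹ • u₀ x)
    rw [hρ, RCLike.ofReal_ne_zero]
    refine ((Finset.sum_pos' (fun _ _ => by positivity) ⟨j, Finset.mem_univ j, ?_⟩)).ne'
    refine pow_pos (norm_pos_iff.2 fun h2 => hj ?_) 2
    have e1 : u₀ x = ∑ k, a k • u k x := SmoothSection.sum_apply _ _ _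
    rw [hR, sub_eq_zero] at h2
    rw [map_smul, LinearMap.smul_apply, e1, map_sum, LinearMap.sum_apply]
    simp only [map_smul, LinearMap.smul_apply, smul_eq_mul]
    rw [← h2, inv_mul_cancel_left₀ (hK x hx)]

end Frames

/-! ### Local frames, gluing, and the global frame -/

section LocalFrames

variable {𝕜 : Type*} [RCLike 𝕜] {n : ℕ} {M : Type*} [TopologicalSpace M] [ChartedSpace (Euc n) M]

section General

variable {F : Type*} [NormedAddCommGroup F] [NormedSpace 𝕜 F] [NormedSpace ℝ F]
  [IsScalarTower ℝ 𝕜 F] {ι : Type*} {Z : VectorBundleCore 𝕜 M F ι}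

theorem mem_smoothSectionSubmodule_of_locally {s : M → F}
    (h : ∀ x, ∃ t : SmoothSection n Z, ∀ᶠ y in nhds x, s y = t y) :
    s ∈ smoothSectionSubmodule n Z := by
  intro φ hφ i y hy
  obtain ⟨t, ht⟩ := h (φ.symm y)
  have hc : Filter.Tendsto φ.symm (nhds y) (nhds (φ.symm y)) := φ.symm.continuousAt hy.1
  have he : localRep Z φ i s =ᶠ[nhds y] localRep Z φ i t :=
    (hc.eventually ht).mono fun z hz =>
      congrArg (Z.coordChange (Z.indexAt (φ.symm z)) i (φ.symm z)) hz
  exact (t.2 φ hφ i y hy).congr_of_eventuallyEq (he.filter_mono nhdsWithin_le_nhds) he.eq_of_nhds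

/-- The section with constant components in a trivialization, multiplied by a cutoff function. -/
def localSection [IsManifold (𝓡 n) ∞ M] (hZ : HasSmoothTransitions n Z) (χ : SmoothFun 𝕜 n M)
    (i : ι) (hχ : tsupport χ ⊆ Z.baseSet i) (v : F) : SmoothSection n Z :=
  ⟨fun x => χ x • Z.coordChange i (Z.indexAt x) x v, fun φ hφ j => by
    intro y hy
    -- Inside the trivialization the section is `χ` times a smooth transition. Outside, it vanishes
    -- near the point since the closed support of `χ` lies in the base set.
    by_cases hi : φ.symm y ∈ Z.baseSet i
    · have hyi : y ∈ overlap Z φ i ∩ overlap Z φ j := ⟨⟨hy.1, hi⟩, hy⟩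
      have h1 : ContDiffOn ℝ ∞ (fun z => χ (φ.symm z) • Z.coordChange i j (φ.symm z) v)
          (overlap Z φ i ∩ overlap Z φ j) :=
        ((smoothFun_chart χ hφ).mono fun z hz => hz.1.1).smul
          ((((ContinuousLinearMap.apply 𝕜 F v).restrictScalars ℝ).contDiff).comp_contDiffOn
            (hZ φ hφ i j))
      have ho : overlap Z φ i ∩ overlap Z φ j ∈ nhds y :=
        ((isOpen_overlap φ i).inter (isOpen_overlap φ j)).mem_nhds hyi
      refine ((h1.contDiffAt ho).congr_of_eventuallyEq ?_).contDiffWithinAt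
      filter_upwards [ho] with z hz
      rw [localRep, map_smul, Z.coordChange_comp i _ j _ ⟨⟨hz.1.2, Z.mem_baseSet_at _⟩, hz.2.2⟩]
    · have hn : ∀ᶠ z in nhds y, φ.symm z ∉ tsupport χ :=
        (φ.symm.continuousAt hy.1).eventually
          ((isClosed_tsupport χ.1).isOpen_compl.mem_nhds fun hz => hi (hχ hz))
      refine (contDiffAt_const (c := (0 : F))).congr_of_eventuallyEq ?_ |>.contDiffWithinAt
      filter_upwards [hn] with z hz
      have h0 : χ (φ.symm z) = 0 := image_eq_zero_of_notMem_tsupport hz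
      rw [localRep, h0, zero_smul, map_zero]⟩

/-- The sum of a locally finite family of sections. -/
theorem exists_locallyFinite_sum [IsManifold (𝓡 n) ∞ M] {J : Type*} (g : J → SmoothFun 𝕜 n M)
    (hg : LocallyFinite fun j => Function.support (g j)) (t : J → SmoothSection n Z) :
    ∃ s : SmoothSection n Z, ∀ x, s x = ∑ᶠ j, g j x • t j x := by
  refine ⟨⟨fun x => ∑ᶠ j, g j x • t j x, mem_smoothSectionSubmodule_of_locally fun x => ?_⟩,
    fun x => rfl⟩
  obtain ⟨V, hV, hfin⟩ := hg x
  refine ⟨∑ j ∈ hfin.toFinset, g j • t j, ?_⟩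
  filter_upwards [hV] with y hy
  have e : (∑ j ∈ hfin.toFinset, g j • t j : SmoothSection n Z) y =
      ∑ j ∈ hfin.toFinset, g j y • t j y := SmoothSection.sum_apply _ _ _
  refine Eq.trans (finsum_eq_sum_of_support_subset _ fun j hj => ?_) e.symm
  rw [Set.Finite.coe_toFinset]
  refine ⟨y, fun h0 => hj ?_, hy⟩
  change g j y • t j y = 0
  rw [h0, zero_smul]

end General

/-- A real-valued smooth function as a `𝕜`-valued one. -/
def SmoothFun.ofReal (f : M → ℝ) (hf : ContMDiff (𝓡 n) 𝓘(ℝ, ℝ) ∞ f) : SmoothFun 𝕜 n M :=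
  ⟨fun x => (f x : 𝕜), (RCLike.ofRealCLM (K := 𝕜)).contDiff.contMDiff.comp hf⟩

@[simp] theorem SmoothFun.ofReal_apply (f : M → ℝ) (hf : ContMDiff (𝓡 n) 𝓘(ℝ, ℝ) ∞ f) (x : M) :
    (SmoothFun.ofReal f hf : SmoothFun 𝕜 n M) x = (f x : 𝕜) := rfl

variable [IsManifold (𝓡 n) ∞ M] {r s : ℕ}

theorem IsFrame.sum_elim {κ κ' : Type*} [Fintype κ] [Fintype κ'] {h h' : SmoothFun 𝕜 n M}
    {u : κ → TensorField 𝕜 n M r s} {w : κ → TensorField 𝕜 n M s r}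
    {u' : κ' → TensorField 𝕜 n M r s} {w' : κ' → TensorField 𝕜 n M s r}
    (hF : IsFrame h u w) (hF' : IsFrame h' u' w') :
    IsFrame (h + h') (Sum.elim u u') (Sum.elim w w') := fun x v => by
  rw [Fintype.sum_sum_type, SmoothFun.add_apply, add_smul, ← hF x v, ← hF' x v]
  rfl

/-- Serves as the frame over the empty set and as padding to enlarge a frame. -/
theorem isFrame_zero (κ : Type*) [Fintype κ] : IsFrame (0 : SmoothFun 𝕜 n M)
    (0 : κ → TensorField 𝕜 n M r s) (0 : κ → TensorField 𝕜 n M s r) := fun x v => by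
  rw [SmoothFun.zero_apply, zero_smul]
  exact Finset.sum_eq_zero fun i _ => smul_zero _

theorem IsFrame.reindex {κ κ' : Type*} [Fintype κ] [Fintype κ'] {h : SmoothFun 𝕜 n M}
    {u : κ → TensorField 𝕜 n M r s} {w : κ → TensorField 𝕜 n M s r} (hF : IsFrame h u w)
    (e : κ' ≃ κ) : IsFrame h (u ∘ e) (w ∘ e) := fun x v => by
  rw [← hF x v]
  exact e.sum_comp fun i => contractBilin 𝕜 n r s (u i x) v • w i x

theorem sum_contractBilin_single (v : TensorComp 𝕜 n s r) :
    ∑ I : (Fin s → Fin n) × (Fin r → Fin n), contractBilin 𝕜 n r s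
      (EuclideanSpace.single I.swap (1 : 𝕜)) v • EuclideanSpace.single I (1 : 𝕜) = v := by
  have h : ∀ I : (Fin s → Fin n) × (Fin r → Fin n), contractBilin 𝕜 n r s
      (EuclideanSpace.single I.swap (1 : 𝕜)) v = v I := fun I => by
    rw [contractBilin_eq_dotProduct]
    simp [EuclideanSpace.single]
  simp only [h]
  have := (EuclideanSpace.basisFun ((Fin s → Fin n) × (Fin r → Fin n)) 𝕜).sum_repr v
  simpa using this

/-- The coordinate frame at `x₀` and its dual are both cut off by a bump function `χ`, which yields
the factor `χ * χ`. The identity is checked in the coordinates at `x₀` by invariance of the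
contraction. -/
theorem exists_isFrame_nhds [T2Space M] (x₀ : M) :
    ∃ (h : SmoothFun 𝕜 n M)
      (u : (Fin s → Fin n) × (Fin r → Fin n) → TensorField 𝕜 n M r s)
      (w : (Fin s → Fin n) × (Fin r → Fin n) → TensorField 𝕜 n M s r),
      IsFrame h u w ∧ h.IsNonneg ∧ ∀ᶠ x in nhds x₀, h x ≠ 0 := by
  obtain ⟨f⟩ : Nonempty (SmoothBumpFunction (𝓡 n) x₀) := inferInstance
  let χ : SmoothFun 𝕜 n M := SmoothFun.ofReal f f.contMDiff
  have hχ : tsupport χ ⊆ (chartAt (Euc n) x₀).source := by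
    refine (closure_mono fun x hx => ?_).trans f.tsupport_subset_chartAt_source
    intro h0
    refine hx ?_
    change ((f x : ℝ) : 𝕜) = 0
    rw [h0, RCLike.ofReal_zero]
  refine ⟨χ * χ,
    fun I => localSection (hasSmoothTransitions_tensorBundle r s) χ (achart (Euc n) x₀) hχ
      (EuclideanSpace.single I.swap 1),
    fun I => localSection (hasSmoothTransitions_tensorBundle s r) χ (achart (Euc n) x₀) hχ
      (EuclideanSpace.single I 1), fun x v => ?_, ?_, ?_⟩
  · by_cases hx : x ∈ (chartAt (Euc n) x₀).source
    · let i := achart (Euc n) x₀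
      let k := achart (Euc n) x
      have hik : x ∈ i.1.source ∩ k.1.source := ⟨hx, mem_chart_source _ x⟩
      obtain ⟨v', rfl⟩ : ∃ v', v = (tensorBundle 𝕜 n M s r).coordChange i k x v' :=
        ⟨(tensorBundle 𝕜 n M s r).coordChange k i x v, by
          rw [(tensorBundle 𝕜 n M s r).coordChange_comp k i k x ⟨hik.symm, hik.2⟩,
            (tensorBundle 𝕜 n M s r).coordChange_self k x hik.2]⟩
      have e : ∀ I : (Fin s → Fin n) × (Fin r → Fin n),
          contractBilin 𝕜 n r s (χ x • (tensorBundle 𝕜 n M r s).coordChange i k x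
              (EuclideanSpace.single I.swap (1 : 𝕜)))
              ((tensorBundle 𝕜 n M s r).coordChange i k x v') •
            χ x • (tensorBundle 𝕜 n M s r).coordChange i k x (EuclideanSpace.single I (1 : 𝕜)) =
          (χ x * χ x) • (tensorBundle 𝕜 n M s r).coordChange i k x (contractBilin 𝕜 n r s
            (EuclideanSpace.single I.swap (1 : 𝕜)) v' • EuclideanSpace.single I (1 : 𝕜)) := by
        intro I
        rw [map_smul, LinearMap.smul_apply, contractBilin_coordChange i k hik, map_smul, smul_smul,
          smul_smul, smul_eq_mul]
        congr 1
        ring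
      refine (Finset.sum_congr rfl fun I _ => e I).trans ?_
      rw [← Finset.smul_sum, ← map_sum, sum_contractBilin_single]
      rfl
    · have h0 : χ x = 0 := image_eq_zero_of_notMem_tsupport fun h => hx (hχ h)
      rw [SmoothFun.mul_apply, h0, mul_zero, zero_smul]
      refine Finset.sum_eq_zero fun I _ => ?_
      have e : localSection (hasSmoothTransitions_tensorBundle s r) χ (achart (Euc n) x₀) hχ
          (EuclideanSpace.single I 1) x = 0 :=
        (congrArg (· • _) h0).trans (zero_smul 𝕜 _)
      exact (congrArg (_ • ·) e).trans (smul_zero _)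
  · have hnn : χ.IsNonneg := fun x => ⟨f x, f.nonneg, rfl⟩
    exact hnn.mul hnn
  · filter_upwards [f.support_mem_nhds] with x hx
    have : χ x ≠ 0 := RCLike.ofReal_ne_zero.2 hx
    exact mul_ne_zero this this

/-- Joining two frames adds their factors. Being nonnegative, these do not cancel, so compactness
reduces the claim to neighbourhoods of points. -/
theorem exists_isFrame_compact [T2Space M] {K : Set M} (hK : IsCompact K) :
    ∃ (N : ℕ) (h : SmoothFun 𝕜 n M) (u : Fin N → TensorField 𝕜 n M r s)
      (w : Fin N → TensorField 𝕜 n M s r), IsFrame h u w ∧ h.IsNonneg ∧ ∀ x ∈ K, h x ≠ 0 := by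
  have of_fintype : ∀ {κ : Type} [Fintype κ] {K : Set M} {h : SmoothFun 𝕜 n M}
      {u : κ → TensorField 𝕜 n M r s} {w : κ → TensorField 𝕜 n M s r}, IsFrame h u w →
      h.IsNonneg → (∀ x ∈ K, h x ≠ 0) → ∃ (N : ℕ) (h : SmoothFun 𝕜 n M)
        (u : Fin N → TensorField 𝕜 n M r s) (w : Fin N → TensorField 𝕜 n M s r),
        IsFrame h u w ∧ h.IsNonneg ∧ ∀ x ∈ K, h x ≠ 0 := fun {κ} _ _ h u w hF h0 hK =>
    ⟨Fintype.card κ, h, _, _, hF.reindex (Fintype.equivFin κ).symm, h0, hK⟩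
  refine hK.induction_on (p := fun K => ∃ (N : ℕ) (h : SmoothFun 𝕜 n M)
      (u : Fin N → TensorField 𝕜 n M r s) (w : Fin N → TensorField 𝕜 n M s r),
      IsFrame h u w ∧ h.IsNonneg ∧ ∀ x ∈ K, h x ≠ 0) ?_ ?_ ?_ ?_
  · exact of_fintype (isFrame_zero PEmpty) (fun x => ⟨0, le_rfl, by simp⟩) (by simp)
  · rintro S T hST ⟨N, h, u, w, hF, h0, hT⟩
    exact ⟨N, h, u, w, hF, h0, fun x hx => hT x (hST hx)⟩
  · rintro S T ⟨N, h, u, w, hF, h0, hS⟩ ⟨N', h', u', w', hF', h0', hT⟩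
    exact of_fintype (hF.sum_elim hF') (h0.add h0') fun x hx =>
      h0.add_ne_zero h0' (hx.imp (hS x) (hT x))
  · intro x _
    obtain ⟨h, u, w, hF, h0, hx⟩ := exists_isFrame_nhds (𝕜 := 𝕜) (n := n) (r := r) (s := s) x
    exact ⟨_, mem_nhdsWithin_of_mem_nhds hx, of_fintype hF h0 fun y hy => hy⟩

/-- Near a compact set there are frames whose number of elements does not depend on the set. -/
theorem exists_isFrame_compact_fin [T2Space M] [SecondCountableTopology M] {N₀ : ℕ}
    (hN₀ : n + Module.finrank ℝ (TensorComp 𝕜 n r s) ≤ N₀) {K : Set M} (hK : IsCompact K) :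
    ∃ (h : SmoothFun 𝕜 n M) (u : Fin N₀ → TensorField 𝕜 n M r s)
      (w : Fin N₀ → TensorField 𝕜 n M s r), IsFrame h u w ∧ h.IsNonneg ∧ ∀ x ∈ K, h x ≠ 0 := by
  have descend : ∀ k, (∃ (h : SmoothFun 𝕜 n M) (u : Fin (N₀ + k) → TensorField 𝕜 n M r s)
      (w : Fin (N₀ + k) → TensorField 𝕜 n M s r),
        IsFrame h u w ∧ h.IsNonneg ∧ ∀ x ∈ K, h x ≠ 0) →
      ∃ (h : SmoothFun 𝕜 n M) (u : Fin N₀ → TensorField 𝕜 n M r s)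
        (w : Fin N₀ → TensorField 𝕜 n M s r), IsFrame h u w ∧ h.IsNonneg ∧ ∀ x ∈ K, h x ≠ 0 := by
    intro k
    induction k with
    | zero => exact id
    | succ k ih =>
      rintro ⟨h, u, w, hF, h0, hK⟩
      exact ih (IsFrame.reduce (N := N₀ + k) hF h0 hK (by omega))
  obtain ⟨N, h, u, w, hF, h0, hh⟩ := exists_isFrame_compact (𝕜 := 𝕜) (n := n) (r := r) (s := s) hK
  -- Padding by `N₀` zero fields gives size `N₀ + N` whether or not `N` exceeds `N₀`, and `N`
  -- reductions lead to `N₀`.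
  refine descend N ⟨h + 0, _, _, (hF.sum_elim (isFrame_zero (Fin N₀))).reindex
    ((finCongr (add_comm N₀ N)).trans finSumFinEquiv.symm), ?_, ?_⟩
  · rwa [add_zero]
  · rwa [add_zero]

/-- Frames are glued along a family of functions with disjoint supports. -/
theorem exists_isFrame_of_disjoint {κ J : Type*} [Fintype κ] (g h : J → SmoothFun 𝕜 n M)
    (hg : LocallyFinite fun j => Function.support (g j))
    (hd : ∀ j j' x, g j x ≠ 0 → g j' x ≠ 0 → j = j') (hg0 : ∀ j, (g j).IsNonneg)
    (h0 : ∀ j, (h j).IsNonneg) (hgh : ∀ j x, g j x ≠ 0 → h j x ≠ 0)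
    (u : J → κ → TensorField 𝕜 n M r s) (w : J → κ → TensorField 𝕜 n M s r)
    (hF : ∀ j, IsFrame (h j) (u j) (w j)) :
    ∃ (H : SmoothFun 𝕜 n M) (U : κ → TensorField 𝕜 n M r s) (W : κ → TensorField 𝕜 n M s r),
      IsFrame H U W ∧ H.IsNonneg ∧ ∀ x, (∃ j, g j x ≠ 0) → H x ≠ 0 := by
  -- At each point at most one `g j` is nonzero, so the locally finite sums have at most one term.
  -- Hence no cross terms arise in the product of `U` and `W`.
  have eval : ∀ {G : Type _} [AddCommGroup G] [Module 𝕜 G] (t : J → G) (j : J) (x : M),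
      g j x ≠ 0 → ∑ᶠ i, g i x • t i = g j x • t j := fun t j x hj =>
    finsum_eq_single _ j fun i hi => by
      by_contra hne
      exact hi (hd i j x (fun h => hne (by rw [h, zero_smul])) hj)
  have eval0 : ∀ {G : Type _} [AddCommGroup G] [Module 𝕜 G] (t : J → G) (x : M),
      (¬ ∃ j, g j x ≠ 0) → ∑ᶠ i, g i x • t i = 0 := fun t x hx => by
    push Not at hx
    simp [hx]
  choose U hU using fun i => exists_locallyFinite_sum g hg fun j => u j i
  choose W hW using fun i => exists_locallyFinite_sum g hg fun j => w j i
  -- The cutoff enters twice, once through `U` and once through `W`.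
  let H : SmoothFun 𝕜 n M := ⟨fun x => ∑ᶠ j, (g j * (g j * h j)) x, by
    refine contMDiff_finsum (fun j => (g j * (g j * h j)).2) (hg.subset fun j x hx h0 => hx ?_)
    change g j x * (g j x * h j x) = 0
    rw [h0, zero_mul]⟩
  have hH : ∀ x, H x = ∑ᶠ j, g j x • (g j x * h j x) := fun x => rfl
  refine ⟨H, U, W, fun x v => ?_, fun x => ?_, ?_⟩
  · by_cases hx : ∃ j, g j x ≠ 0
    · obtain ⟨j, hj⟩ := hx
      simp only [hH, hU, hW]
      rw [eval (fun j => g j x * h j x) j x hj, smul_eq_mul, mul_smul, mul_smul, ← hF j x v,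
        Finset.smul_sum, Finset.smul_sum]
      refine Finset.sum_congr rfl fun i _ => ?_
      rw [eval (fun j => u j i x) j x hj, eval (fun j => w j i x) j x hj, map_smul,
        LinearMap.smul_apply, smul_assoc, smul_comm (contractBilin 𝕜 n r s (u j i x) v) (g j x)]
    · rw [hH, eval0 _ x hx, zero_smul]
      refine Finset.sum_eq_zero fun i _ => ?_
      rw [hW, eval0 _ x hx, smul_zero]
  · by_cases hx : ∃ j, g j x ≠ 0
    · obtain ⟨j, hj⟩ := hx
      rw [hH, eval (fun j => g j x * h j x) j x hj]
      exact (hg0 j).mul ((hg0 j).mul (h0 j)) x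
    · exact ⟨0, le_rfl, by rw [hH, eval0 _ x hx, RCLike.ofReal_zero]⟩
  · rintro x ⟨j, hj⟩
    rw [hH, eval (fun j => g j x * h j x) j x hj]
    exact mul_ne_zero hj (mul_ne_zero hj (hgh j x hj))

/-- The inverse of a nowhere vanishing smooth function. -/
def SmoothFun.inv (f : SmoothFun 𝕜 n M) (hf : ∀ x, f x ≠ 0) : SmoothFun 𝕜 n M :=
  ⟨fun x => (f x)⁻¹, fun x =>
    (contDiffAt_inv ℝ (hf x)).contMDiffAt.comp x
      ((f.2 : ContMDiff (𝓡 n) 𝓘(ℝ, 𝕜) ∞ f.1) x)⟩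

/-- The space of tensor fields is a finitely generated projective module. -/
theorem exists_isFrame_one (𝕜 : Type*) [RCLike 𝕜] (n : ℕ) (M : Type*) [TopologicalSpace M]
    [ChartedSpace (Euc n) M] [IsManifold (𝓡 n) ∞ M] [T2Space M] [SecondCountableTopology M]
    (r s : ℕ) : ∃ (N : ℕ) (u : Fin N → TensorField 𝕜 n M r s) (w : Fin N → TensorField 𝕜 n M s r),
      IsFrame (1 : SmoothFun 𝕜 n M) u w := by
  have : LocallyCompactSpace M := ChartedSpace.locallyCompactSpace (Euc n) M
  -- The shift makes `K 0` empty, so that the shells `V j` also cover the innermost compact set.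
  let K : CompactExhaustion M := (CompactExhaustion.choice M).shiftr
  have hK0 : K 0 = ∅ := rfl
  let V : ℕ → Set M := fun j => interior (K (j + 2)) \ K j
  have hV : ∀ j, IsOpen (V j) := fun j => isOpen_interior.sdiff (K.isCompact j).isClosed
  have hcover : (Set.univ : Set M) ⊆ ⋃ j, V j := fun x _ => by
    have hx : ∃ m, x ∈ K m := K.exists_mem x
    classical
    have hm := Nat.find_spec hx
    have hpos : Nat.find hx ≠ 0 := fun h => by
      rw [h, hK0] at hm
      exact hm
    obtain ⟨j, hj⟩ := Nat.exists_eq_succ_of_ne_zero hpos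
    rw [hj] at hm
    exact Set.mem_iUnion.2 ⟨j, K.subset_interior_succ (j + 1) hm,
      Nat.find_min hx (by rw [hj]; exact Nat.lt_succ_self j)⟩
  -- Two shells meet only if their indices differ by at most one, so shells of equal parity are
  -- disjoint.
  have hdisj : ∀ j l x, x ∈ V j → x ∈ V l → j % 2 = l % 2 → j = l := by
    have key : ∀ j l x, x ∈ V j → x ∈ V l → j < l → ¬ j % 2 = l % 2 := fun j l x hj hl hjl hm =>
      hl.2 (K.subset (by omega : j + 2 ≤ l) (interior_subset hj.1))
    intro j l x hj hl hm
    rcases lt_trichotomy j l with h | h | h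
    · exact absurd hm (key j l x hj hl h)
    · exact h
    · exact absurd hm.symm (key l j x hl hj h)
  obtain ⟨f, hf⟩ := SmoothPartitionOfUnity.exists_isSubordinate (I := 𝓡 n) isClosed_univ V hV hcover
  let g : ℕ → SmoothFun 𝕜 n M := fun j => SmoothFun.ofReal (f j) (f j).contMDiff
  have hgV : ∀ j x, g j x ≠ 0 → x ∈ V j := fun j x hx =>
    hf j (subset_tsupport _ fun h => hx (by simp [g, h]))
  have hg : LocallyFinite fun j => Function.support (g j) :=
    f.locallyFinite.subset fun j x hx h => hx (by
      change ((f j x : ℝ) : 𝕜) = 0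
      rw [h, RCLike.ofReal_zero])
  have hg0 : ∀ j, (g j).IsNonneg := fun j x => ⟨f j x, f.nonneg j x, rfl⟩
  -- The size of these frames does not depend on `j`, which is what allows infinitely many of them
  -- to be glued into a finite family.
  choose h u w hF h0 hh using fun j => exists_isFrame_compact_fin (𝕜 := 𝕜) (n := n) (r := r) (s := s) le_rfl
    (K.isCompact (j + 2))
  have hgh : ∀ j x, g j x ≠ 0 → h j x ≠ 0 := fun j x hx =>
    hh j x (interior_subset (hgV j x hx).1)
  have glue : ∀ c, ∃ (H : SmoothFun 𝕜 n M)
      (U : Fin (n + Module.finrank ℝ (TensorComp 𝕜 n r s)) → TensorField 𝕜 n M r s)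
      (W : Fin (n + Module.finrank ℝ (TensorComp 𝕜 n r s)) → TensorField 𝕜 n M s r),
      IsFrame H U W ∧ H.IsNonneg ∧ ∀ x, (∃ j : {j : ℕ // j % 2 = c}, g j x ≠ 0) → H x ≠ 0 :=
    fun c => exists_isFrame_of_disjoint (fun j : {j : ℕ // j % 2 = c} => g j) (fun j => h j)
      (hg.comp_injective Subtype.val_injective)
      (fun j l x hj hl => Subtype.ext (hdisj j l x (hgV j x hj) (hgV l x hl) (j.2.trans l.2.symm)))
      (fun j => hg0 j) (fun j => h0 j) (fun j => hgh j) (fun j => u j) (fun j => w j)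
      (fun j => hF j)
  obtain ⟨H₀, U₀, W₀, hF₀, hn₀, hH₀⟩ := glue 0
  obtain ⟨H₁, U₁, W₁, hF₁, hn₁, hH₁⟩ := glue 1
  have hH : ∀ x, (H₀ + H₁) x ≠ 0 := fun x => by
    obtain ⟨j, hj⟩ := f.exists_pos_of_mem (Set.mem_univ x)
    have hj' : g j x ≠ 0 := RCLike.ofReal_ne_zero.2 hj.ne'
    refine hn₀.add_ne_zero hn₁ ?_
    rcases Nat.mod_two_eq_zero_or_one j with hm | hm
    · exact Or.inl (hH₀ x ⟨⟨j, hm⟩, hj'⟩)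
    · exact Or.inr (hH₁ x ⟨⟨j, hm⟩, hj'⟩)
  -- The nowhere vanishing factor `H₀ + H₁` is divided out of the `u`-side only.
  have hF' : IsFrame (1 : SmoothFun 𝕜 n M)
      (fun i => (H₀ + H₁).inv hH • Sum.elim U₀ U₁ i) (Sum.elim W₀ W₁) := fun x v => by
    have e := hF₀.sum_elim hF₁ x v
    rw [SmoothFun.one_apply, ← inv_mul_cancel₀ (hH x), mul_smul, ← e, Finset.smul_sum]
    refine Finset.sum_congr rfl fun i _ => ?_
    rw [SmoothSection.smul_apply, map_smul, LinearMap.smul_apply, smul_assoc]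
    rfl
  exact ⟨_, _, _, hF'.reindex (Fintype.equivFin _).symm⟩

end LocalFrames

/-! ### Expansions of fields and tensor densities in a frame -/

section FrameIdentities

variable {𝕜 : Type*} [RCLike 𝕜] {n : ℕ} {M : Type*} [TopologicalSpace M] [ChartedSpace (Euc n) M]
  [IsManifold (𝓡 n) ∞ M] {r s : ℕ}

theorem contractBilin_single_right (v : TensorComp 𝕜 n r s)
    (I : (Fin r → Fin n) × (Fin s → Fin n)) :
    contractBilin 𝕜 n r s v (EuclideanSpace.single I.swap (1 : 𝕜)) = v I := by
  have h : (EuclideanSpace.single I.swap (1 : 𝕜)).ofLp ∘ Prod.swap = Pi.single I 1 := by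
    ext J
    simp [EuclideanSpace.single, Pi.single_apply, Prod.swap_inj]
  rw [contractBilin_eq_dotProduct, h, dotProduct_single, mul_one]

theorem contractBilin_ext {v v' : TensorComp 𝕜 n r s}
    (h : ∀ w, contractBilin 𝕜 n r s v w = contractBilin 𝕜 n r s v' w) : v = v' := by
  ext I
  rw [← contractBilin_single_right v, h, contractBilin_single_right]

variable {κ : Type*} [Fintype κ] {u : κ → TensorField 𝕜 n M r s} {w : κ → TensorField 𝕜 n M s r}

theorem IsFrame.sum_smul (hF : IsFrame (1 : SmoothFun 𝕜 n M) u w) (t : TensorField 𝕜 n M s r) :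
    ∑ i, contractFun (u i) t • w i = t := by
  refine SmoothSection.ext fun x => (SmoothSection.sum_apply _ _ _).trans ?_
  exact (hF x (t x)).trans (one_smul 𝕜 _)

/-- Contracting `t` with the frame identity gives the expansion weakly, and the contraction is
nondegenerate. -/
theorem IsFrame.sum_smul_dual (hF : IsFrame (1 : SmoothFun 𝕜 n M) u w)
    (t : TensorField 𝕜 n M r s) : ∑ i, contractFun t (w i) • u i = t := by
  refine SmoothSection.ext fun x => (SmoothSection.sum_apply _ _ _).trans ?_
  refine contractBilin_ext fun v => ?_
  have h := congrArg (contractBilin 𝕜 n r s (t x)) (hF x v)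
  rw [SmoothFun.one_apply, one_smul] at h
  rw [← h, map_sum, map_sum, LinearMap.sum_apply]
  refine Finset.sum_congr rfl fun i _ => ?_
  rw [SmoothSection.smul_apply, map_smul, map_smul, LinearMap.smul_apply, smul_eq_mul, smul_eq_mul,
    mul_comm]
  rfl

/-- A fibrewise linear identity, hence checked on pure tensors, where it is the frame identity with
the scalar moved across `⊗`. -/
theorem IsFrame.sum_tensor_contract (hF : IsFrame (1 : SmoothFun 𝕜 n M) u w)
    (σ : CompTensorDensity 𝕜 n M r s) :
    ∑ i, (tensorDensityPairing 𝕜 n M r s).pairComp (w i)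
      ((contractDensityPairing 𝕜 n M r s).pairComp (u i) σ) = σ := by
  refine CompSection.ext fun x => (CompSection.sum_apply _ _ _).trans ?_
  have key : ∀ z : TensorComp 𝕜 n s r ⊗[𝕜] 𝕜,
      ∑ i, w i x ⊗ₜ[𝕜] contractTensor 𝕜 n r s (u i x) z = z := by
    intro z
    induction z using TensorProduct.induction_on with
    | zero => simp
    | add z z' hz hz' =>
      simp only [map_add, TensorProduct.tmul_add, Finset.sum_add_distrib, hz, hz']
    | tmul v c =>
      simp only [contractTensor_tmul]
      have h := hF x v
      rw [SmoothFun.one_apply, one_smul] at h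
      conv_rhs => rw [← h, TensorProduct.sum_tmul]
      refine Finset.sum_congr rfl fun i _ => ?_
      rw [TensorProduct.smul_tmul, smul_eq_mul]
  exact key (σ x)

theorem contract_tensor (u : TensorField 𝕜 n M r s) (t : TensorField 𝕜 n M s r)
    (μ : CompDensity 𝕜 n M) :
    (contractDensityPairing 𝕜 n M r s).pairComp u
      ((tensorDensityPairing 𝕜 n M r s).pairComp t μ) = contractFun u t • μ :=
  CompSection.ext fun _ => rfl

end FrameIdentities

/-! ### The canonical maps, their inverses and their boundedness -/

section Isomorphisms

variable {𝕜 : Type*} [RCLike 𝕜] {n : ℕ} {M : Type*} [TopologicalSpace M] [ChartedSpace (Euc n) M]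
  [IsManifold (𝓡 n) ∞ M] {r s : ℕ}

theorem smul_dual_apply {E : Type*} [AddCommGroup E] [Module 𝕜 E] [TopologicalSpace E]
    [Module (SmoothFun 𝕜 n M) E] [IsScalarTower 𝕜 (SmoothFun 𝕜 n M) E]
    [ContinuousConstSMul (SmoothFun 𝕜 n M) E] (f : SmoothFun 𝕜 n M) (T : StrongDual 𝕜 E) (x : E) :
    (f • T) x = T (f • x) := rfl

variable (𝕜 n M r s) in
/-- The map `T^s_r(M) ⊗ Γ_c(Vol(M)) → Γ_c(T^s_r(M) ⊗ Vol(M))`. -/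
def tensorLift : BornTensor 𝕜 (SmoothFun 𝕜 n M) (TensorField 𝕜 n M s r) (CompDensity 𝕜 n M) →L[𝕜]
    CompTensorDensity 𝕜 n M r s :=
  bornLift (tensorDensityPairing 𝕜 n M r s).pairComp
    (tensorDensityPairing 𝕜 n M r s).isBoundedBilin_pairComp fun f t μ => by
      rw [BundlePairing.pairComp_smul_left, BundlePairing.pairComp_smul_right]

@[simp] theorem tensorLift_bornTmul (t : TensorField 𝕜 n M s r) (μ : CompDensity 𝕜 n M) :
    tensorLift 𝕜 n M r s (bornTmul 𝕜 (SmoothFun 𝕜 n M) t μ) =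
      (tensorDensityPairing 𝕜 n M r s).pairComp t μ :=
  bornLift_bornTmul _ _ _ _ _

theorem tensorLift_smul (f : SmoothFun 𝕜 n M)
    (z : BornTensor 𝕜 (SmoothFun 𝕜 n M) (TensorField 𝕜 n M s r) (CompDensity 𝕜 n M)) :
    tensorLift 𝕜 n M r s (f • z) = f • tensorLift 𝕜 n M r s z := by
  induction z using bornTensor_induction with
  | h0 => simp
  | ht t μ =>
    rw [smul_bornTmul, tensorLift_bornTmul, tensorLift_bornTmul, BundlePairing.pairComp_smul_left]
  | ha z z' hz hz' => rw [smul_add, map_add, hz, hz', map_add, smul_add]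

variable (𝕜 n M r s) in
/-- The map from tensor distributions to functionals on the bornological tensor product. -/
def toTensorDual : TensorDistribution 𝕜 n M r s →ₗ[SmoothFun 𝕜 n M]
    StrongDual 𝕜 (BornTensor 𝕜 (SmoothFun 𝕜 n M) (TensorField 𝕜 n M s r) (CompDensity 𝕜 n M)) where
  toFun T := T.comp (tensorLift 𝕜 n M r s)
  map_add' _ _ := rfl
  map_smul' f T := ContinuousLinearMap.ext fun z => congrArg T (tensorLift_smul f z).symm

theorem toTensorDual_apply (T : TensorDistribution 𝕜 n M r s)
    (z : BornTensor 𝕜 (SmoothFun 𝕜 n M) (TensorField 𝕜 n M s r) (CompDensity 𝕜 n M)) :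
    toTensorDual 𝕜 n M r s T z = T (tensorLift 𝕜 n M r s z) := rfl

theorem isBoundedMap_toTensorDual : IsBoundedMap 𝕜 (toTensorDual 𝕜 n M r s) :=
  isBoundedMap_of_continuous (ContinuousLinearMap.precomp 𝕜 (tensorLift 𝕜 n M r s))

theorem tensorDual_ext
    {S S' : StrongDual 𝕜 (BornTensor 𝕜 (SmoothFun 𝕜 n M) (TensorField 𝕜 n M s r)
      (CompDensity 𝕜 n M))}
    (h : ∀ t μ, S (bornTmul 𝕜 (SmoothFun 𝕜 n M) t μ) = S' (bornTmul 𝕜 (SmoothFun 𝕜 n M) t μ)) :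
    S = S' := by
  refine ContinuousLinearMap.ext fun z => ?_
  induction z using bornTensor_induction with
  | h0 => rw [map_zero, map_zero]
  | ht t μ => exact h t μ
  | ha z z' hz hz' => rw [map_add, map_add, hz, hz']

section Currying

variable [T2Space M] [SecondCountableTopology M]

/-- The distribution `μ ↦ S (t ⊗ μ)`. -/
def partialDual (S : StrongDual 𝕜 (BornTensor 𝕜 (SmoothFun 𝕜 n M) (TensorField 𝕜 n M s r)
    (CompDensity 𝕜 n M))) (t : TensorField 𝕜 n M s r) : Distribution 𝕜 n M where
  toFun μ := S (bornTmul 𝕜 (SmoothFun 𝕜 n M) t μ)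
  map_add' μ μ' := by rw [bornTmul_add_right, map_add]
  map_smul' c μ := by rw [bornTmul_smul_right, map_smul, RingHom.id_apply]
  -- The tensor product topology only makes `μ ↦ S (t ⊗ μ)` bounded. Continuity comes from the
  -- structure of `Γ_c(Vol(M))`.
  cont := continuous_of_isBoundedMap hasSmoothTransitions_volBundle
    (G := 𝕜)
    { toFun := fun μ => S (bornTmul 𝕜 (SmoothFun 𝕜 n M) t μ)
      map_add' := fun μ μ' => by rw [bornTmul_add_right, map_add]
      map_smul' := fun c μ => by rw [bornTmul_smul_right, map_smul, RingHom.id_apply] }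
    ((isBoundedMap_of_continuous S).comp (isBoundedMap_bornTmul_right t))

/-- Tensors of elements of two bounded sets form a bounded set, on which `𝒮` is uniformly bounded.
With a single functional this shows that its curried form is bounded, and in general that currying
is. -/
theorem isVonNBounded_partialDual {𝒮 : Set (StrongDual 𝕜 (BornTensor 𝕜 (SmoothFun 𝕜 n M)
    (TensorField 𝕜 n M s r) (CompDensity 𝕜 n M)))} (hS : IsVonNBounded 𝕜 𝒮)
    {B : Set (TensorField 𝕜 n M s r)} (hB : IsVonNBounded 𝕜 B) :
    IsVonNBounded 𝕜 {T | ∃ S ∈ 𝒮, ∃ t ∈ B, partialDual S t = T} := by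
  rw [isVonNBounded_strongDual_iff]
  intro C hC
  obtain ⟨c, hc⟩ := isVonNBounded_strongDual_iff.1 hS _
    (isBoundedMap_bornTmul (𝕜 := 𝕜) (A := SmoothFun 𝕜 n M) _ (isVonNBounded_prod hB hC))
  refine ⟨c, ?_⟩
  rintro _ ⟨S, hS, t, ht, rfl⟩ μ hμ
  exact hc S hS _ ⟨(t, μ), ⟨ht, hμ⟩, rfl⟩

variable (𝕜 n M r s) in
/-- The currying of functionals on the bornological tensor product. -/
def curryDual : StrongDual 𝕜 (BornTensor 𝕜 (SmoothFun 𝕜 n M) (TensorField 𝕜 n M s r)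
      (CompDensity 𝕜 n M)) →ₗ[SmoothFun 𝕜 n M]
    BoundedHom 𝕜 (SmoothFun 𝕜 n M) (TensorField 𝕜 n M s r) (Distribution 𝕜 n M) where
  toFun S := ⟨
    { toFun := partialDual S
      map_add' := fun t t' => ContinuousLinearMap.ext fun μ =>
        (congrArg S (bornTmul_add_left t t' μ)).trans (map_add S _ _)
      map_smul' := fun f t => ContinuousLinearMap.ext fun μ =>
        congrArg S (bornTmul_smul_left_eq f t μ) },
    fun B hB => (isVonNBounded_partialDual (isVonNBounded_singleton (𝕜 := 𝕜) S) hB).subset (by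
      rintro _ ⟨t, ht, rfl⟩
      exact ⟨S, rfl, t, ht, rfl⟩)⟩
  map_add' _ _ := rfl
  map_smul' f S := BoundedHom.ext fun t => ContinuousLinearMap.ext fun μ =>
    congrArg S (bornTmul_smul_left_eq f t μ)

theorem curryDual_apply (S : StrongDual 𝕜 (BornTensor 𝕜 (SmoothFun 𝕜 n M)
    (TensorField 𝕜 n M s r) (CompDensity 𝕜 n M))) (t : TensorField 𝕜 n M s r)
    (μ : CompDensity 𝕜 n M) :
    (curryDual 𝕜 n M r s S).toLin t μ = S (bornTmul 𝕜 (SmoothFun 𝕜 n M) t μ) := rfl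

theorem isBoundedMap_curryDual : IsBoundedMap 𝕜 (curryDual 𝕜 n M r s) := fun 𝒮 hS => by
  rw [BoundedHom.isVonNBounded_iff]
  refine fun B hB => (isVonNBounded_partialDual hS hB).subset ?_
  rintro _ ⟨_, ⟨S, hS, rfl⟩, t, ht, rfl⟩
  exact ⟨S, hS, t, ht, rfl⟩

end Currying

theorem isBoundedMap_toLin_apply {A E F : Type*} [CommRing A] [Algebra 𝕜 A]
    [AddCommGroup E] [Module 𝕜 E] [Module A E] [IsScalarTower 𝕜 A E] [TopologicalSpace E]
    [ContinuousSMul 𝕜 E]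
    [AddCommGroup F] [Module 𝕜 F] [Module A F] [IsScalarTower 𝕜 A F] [TopologicalSpace F]
    [IsTopologicalAddGroup F] [ContinuousSMul 𝕜 F] [ContinuousConstSMul A F] (x : E) :
    IsBoundedMap 𝕜 (fun l : BoundedHom 𝕜 A E F => l.toLin x) := fun S hS => by
  refine (BoundedHom.isVonNBounded_iff.1 hS {x} (isVonNBounded_singleton x)).subset ?_
  rintro _ ⟨l, hl, rfl⟩
  exact ⟨l, hl, x, rfl, rfl⟩

/-- The tensor distribution `σ ↦ ∑ i, ⟨L (w i), ⟨u i, σ⟩⟩`. -/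
def ofBoundedHom {κ : Type*} [Fintype κ] (u : κ → TensorField 𝕜 n M r s)
    (w : κ → TensorField 𝕜 n M s r)
    (L : BoundedHom 𝕜 (SmoothFun 𝕜 n M) (TensorField 𝕜 n M s r) (Distribution 𝕜 n M)) :
    TensorDistribution 𝕜 n M r s :=
  ∑ i, (L.toLin (w i)).comp ((contractDensityPairing 𝕜 n M r s).pairCompCLM (u i))

theorem ofBoundedHom_apply {κ : Type*} [Fintype κ] (u : κ → TensorField 𝕜 n M r s)
    (w : κ → TensorField 𝕜 n M s r)
    (L : BoundedHom 𝕜 (SmoothFun 𝕜 n M) (TensorField 𝕜 n M s r) (Distribution 𝕜 n M))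
    (σ : CompTensorDensity 𝕜 n M r s) : ofBoundedHom u w L σ =
      ∑ i, L.toLin (w i) ((contractDensityPairing 𝕜 n M r s).pairComp (u i) σ) := by
  rw [ofBoundedHom, sum_apply]
  rfl

/-- Each summand is evaluation at `w i` followed by the transpose of a continuous map, and the frame
is finite. -/
theorem isBoundedMap_ofBoundedHom {κ : Type*} [Fintype κ] (u : κ → TensorField 𝕜 n M r s)
    (w : κ → TensorField 𝕜 n M s r) : IsBoundedMap 𝕜 (ofBoundedHom u w) :=
  isBoundedMap_finsetSum (𝕜 := 𝕜) (F := TensorDistribution 𝕜 n M r s) Finset.univ fun i =>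
    (isBoundedMap_of_continuous (ContinuousLinearMap.precomp 𝕜
      ((contractDensityPairing 𝕜 n M r s).pairCompCLM (u i)))).comp
      (isBoundedMap_toLin_apply (w i))

section FrameInverses

variable {κ : Type*} [Fintype κ] {u : κ → TensorField 𝕜 n M r s} {w : κ → TensorField 𝕜 n M s r}

/-- Expand `t` in the frame. Linearity of `L` over `C^∞(M)` moves the coefficient `⟨u i, t⟩` onto
`μ`, and `⟨u i, t⟩ μ` is the contraction of `u i` with `t ⊗ μ`. -/
theorem IsFrame.ofBoundedHom_tensor (hF : IsFrame (1 : SmoothFun 𝕜 n M) u w)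
    (L : BoundedHom 𝕜 (SmoothFun 𝕜 n M) (TensorField 𝕜 n M s r) (Distribution 𝕜 n M))
    (t : TensorField 𝕜 n M s r) (μ : CompDensity 𝕜 n M) :
    ofBoundedHom u w L ((tensorDensityPairing 𝕜 n M r s).pairComp t μ) = L.toLin t μ := by
  conv_rhs => rw [← hF.sum_smul t, map_sum, sum_apply]
  rw [ofBoundedHom_apply]
  refine Finset.sum_congr rfl fun i _ => ?_
  rw [contract_tensor, (L.toLin).map_smul, smul_dual_apply]

theorem IsFrame.toTensorDual_ofBoundedHom (hF : IsFrame (1 : SmoothFun 𝕜 n M) u w)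
    (L : BoundedHom 𝕜 (SmoothFun 𝕜 n M) (TensorField 𝕜 n M s r) (Distribution 𝕜 n M))
    (t : TensorField 𝕜 n M s r) (μ : CompDensity 𝕜 n M) :
    toTensorDual 𝕜 n M r s (ofBoundedHom u w L) (bornTmul 𝕜 (SmoothFun 𝕜 n M) t μ) =
      L.toLin t μ := by
  rw [toTensorDual_apply, tensorLift_bornTmul, hF.ofBoundedHom_tensor]

variable [T2Space M] [SecondCountableTopology M]

/-- Precomposition with the pointwise tensor product, as an isomorphism. -/
def IsFrame.tensorDualEquiv (hF : IsFrame (1 : SmoothFun 𝕜 n M) u w) :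
    TensorDistribution 𝕜 n M r s ≃ₗ[SmoothFun 𝕜 n M] StrongDual 𝕜 (BornTensor 𝕜 (SmoothFun 𝕜 n M)
      (TensorField 𝕜 n M s r) (CompDensity 𝕜 n M)) where
  toLinearMap := toTensorDual 𝕜 n M r s
  invFun S := ofBoundedHom u w (curryDual 𝕜 n M r s S)
  left_inv T := ContinuousLinearMap.ext fun σ => by
    change ofBoundedHom u w (curryDual 𝕜 n M r s (toTensorDual 𝕜 n M r s T)) σ = T σ
    rw [ofBoundedHom_apply]
    conv_rhs => rw [← hF.sum_tensor_contract σ, map_sum]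
    refine Finset.sum_congr rfl fun i _ => ?_
    rw [curryDual_apply, toTensorDual_apply, tensorLift_bornTmul]
  right_inv S := tensorDual_ext fun t μ =>
    (hF.toTensorDual_ofBoundedHom _ t μ).trans (curryDual_apply S t μ)

/-- Currying of functionals, as an isomorphism. -/
def IsFrame.curryEquiv (hF : IsFrame (1 : SmoothFun 𝕜 n M) u w) :
    StrongDual 𝕜 (BornTensor 𝕜 (SmoothFun 𝕜 n M) (TensorField 𝕜 n M s r) (CompDensity 𝕜 n M))
      ≃ₗ[SmoothFun 𝕜 n M]
    BoundedHom 𝕜 (SmoothFun 𝕜 n M) (TensorField 𝕜 n M s r) (Distribution 𝕜 n M) where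
  toLinearMap := curryDual 𝕜 n M r s
  invFun L := toTensorDual 𝕜 n M r s (ofBoundedHom u w L)
  -- Both isomorphisms share the map `ofBoundedHom`, which inverts their composite, so each inverse
  -- is obtained by composing it with the other canonical map.
  left_inv S := hF.tensorDualEquiv.right_inv S
  right_inv L := BoundedHom.ext fun t => ContinuousLinearMap.ext fun μ =>
    hF.toTensorDual_ofBoundedHom L t μ

theorem IsFrame.isBornologicalIso_tensorDualEquiv (hF : IsFrame (1 : SmoothFun 𝕜 n M) u w) :
    IsBornologicalIso 𝕜 hF.tensorDualEquiv :=
  ⟨isBoundedMap_toTensorDual, (isBoundedMap_ofBoundedHom u w).comp isBoundedMap_curryDual⟩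

theorem IsFrame.isBornologicalIso_curryEquiv (hF : IsFrame (1 : SmoothFun 𝕜 n M) u w) :
    IsBornologicalIso 𝕜 hF.curryEquiv :=
  ⟨isBoundedMap_curryDual, isBoundedMap_toTensorDual.comp (isBoundedMap_ofBoundedHom u w)⟩

end FrameInverses

/-- The tensor distribution `σ ↦ ⟨v, ⟨u, σ⟩⟩`. -/
def fieldMul : TensorField 𝕜 n M r s →ₗ[𝕜] Distribution 𝕜 n M →ₗ[𝕜]
    TensorDistribution 𝕜 n M r s :=
  LinearMap.mk₂ 𝕜 (fun u v => v.comp ((contractDensityPairing 𝕜 n M r s).pairCompCLM u))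
    (fun u u' v => ContinuousLinearMap.ext fun σ =>
      (congrArg (fun l => v (l σ))
        (map_add (contractDensityPairing 𝕜 n M r s).pairComp u u')).trans (map_add v _ _))
    (fun c u v => ContinuousLinearMap.ext fun σ =>
      (congrArg (fun l => v (l σ))
        (map_smul (contractDensityPairing 𝕜 n M r s).pairComp c u)).trans (map_smul v _ _))
    (fun _ _ _ => rfl) (fun _ _ _ => rfl)

theorem fieldMul_apply (u : TensorField 𝕜 n M r s) (v : Distribution 𝕜 n M)
    (σ : CompTensorDensity 𝕜 n M r s) :
    fieldMul u v σ = v ((contractDensityPairing 𝕜 n M r s).pairComp u σ) := rfl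

/-- Contraction sends bounded sets of fields and tensor densities to a bounded set of densities, on
which a bounded set of distributions is uniformly bounded. -/
theorem isBoundedBilin_fieldMul :
    IsBoundedBilin (fieldMul (𝕜 := 𝕜) (n := n) (M := M) (r := r) (s := s)) := fun B hB => by
  rw [isVonNBounded_strongDual_iff]
  intro C hC
  have h1 := hB.image (ContinuousLinearMap.fst 𝕜 (TensorField 𝕜 n M r s) (Distribution 𝕜 n M))
  have h2 := hB.image (ContinuousLinearMap.snd 𝕜 (TensorField 𝕜 n M r s) (Distribution 𝕜 n M))
  obtain ⟨c, hc⟩ := isVonNBounded_strongDual_iff.1 h2 _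
    ((contractDensityPairing 𝕜 n M r s).isBoundedBilin_pairComp _ (isVonNBounded_prod h1 hC))
  refine ⟨c, ?_⟩
  rintro _ ⟨p, hp, rfl⟩ σ hσ
  exact hc p.2 ⟨p, hp, rfl⟩ _ ⟨(p.1, σ), ⟨⟨p, hp, rfl⟩, hσ⟩, rfl⟩

variable (𝕜 n M r s) in
/-- The map `T^r_s(M) ⊗ D'(M) → D'^r_s(M)`. -/
def fieldMulLift :
    BornTensor 𝕜 (SmoothFun 𝕜 n M) (TensorField 𝕜 n M r s) (Distribution 𝕜 n M) →L[𝕜]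
      TensorDistribution 𝕜 n M r s :=
  bornLift fieldMul isBoundedBilin_fieldMul fun f u v => ContinuousLinearMap.ext fun σ => by
    rw [fieldMul_apply, BundlePairing.pairComp_smul_left]
    rfl

@[simp] theorem fieldMulLift_bornTmul (u : TensorField 𝕜 n M r s) (v : Distribution 𝕜 n M) :
    fieldMulLift 𝕜 n M r s (bornTmul 𝕜 (SmoothFun 𝕜 n M) u v) = fieldMul u v :=
  bornLift_bornTmul _ _ _ _ _

section FrameTensor

variable {κ : Type*} [Fintype κ] {u : κ → TensorField 𝕜 n M r s} {w : κ → TensorField 𝕜 n M s r}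

/-- The map `L ↦ ∑ i, u i ⊗ L (w i)`. -/
def toFieldTensor (u : κ → TensorField 𝕜 n M r s) (w : κ → TensorField 𝕜 n M s r) :
    BoundedHom 𝕜 (SmoothFun 𝕜 n M) (TensorField 𝕜 n M s r) (Distribution 𝕜 n M)
      →ₗ[SmoothFun 𝕜 n M]
    BornTensor 𝕜 (SmoothFun 𝕜 n M) (TensorField 𝕜 n M r s) (Distribution 𝕜 n M) where
  toFun L := ∑ i, bornTmul 𝕜 (SmoothFun 𝕜 n M) (u i) (L.toLin (w i))
  map_add' L L' := by
    rw [← Finset.sum_add_distrib]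
    refine Finset.sum_congr rfl fun i _ => ?_
    rw [BoundedHom.toLin_add, bornTmul_add_right]
  map_smul' f L := by
    rw [RingHom.id_apply, Finset.smul_sum]
    refine Finset.sum_congr rfl fun i _ => ?_
    rw [BoundedHom.toLin_smul', smul_bornTmul, bornTmul_smul_left_eq]

instance {E F : Type*} [AddCommGroup E] [Module 𝕜 E] [TopologicalSpace E] [AddCommGroup F]
    [Module 𝕜 F] [TopologicalSpace F] : ContinuousSMul 𝕜 (BornTensorBase 𝕜 E F) :=
  continuousSMul_sInf fun t ht =>
    letI := t; haveI := ht.1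
    (PolynormableSpace.withSeminorms 𝕜 (BornTensorBase 𝕜 E F)).continuousSMul

/-- The sum is formed before passing to the quotient, in the tensor product over `𝕜`, and then
projected by the continuous quotient map. -/
theorem isBoundedMap_toFieldTensor (u : κ → TensorField 𝕜 n M r s)
    (w : κ → TensorField 𝕜 n M s r) : IsBoundedMap 𝕜 (toFieldTensor u w) := by
  have h : ∀ i, IsBoundedMap 𝕜 (fun L : BoundedHom 𝕜 (SmoothFun 𝕜 n M) (TensorField 𝕜 n M s r)
      (Distribution 𝕜 n M) => baseTmul 𝕜 (u i) (L.toLin (w i))) := fun i B hB => by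
    refine (isBoundedMap_baseTmul (𝕜 := 𝕜) _ (isVonNBounded_prod
      (isVonNBounded_singleton (𝕜 := 𝕜) (u i)) (isBoundedMap_toLin_apply (w i) B hB))).subset ?_
    rintro _ ⟨L, hL, rfl⟩
    exact ⟨(u i, L.toLin (w i)), ⟨rfl, ⟨L, hL, rfl⟩⟩, rfl⟩
  have h' := (isBoundedMap_of_continuous (bornMk 𝕜 (SmoothFun 𝕜 n M) (TensorField 𝕜 n M r s)
    (Distribution 𝕜 n M))).comp (isBoundedMap_finsetSum (𝕜 := 𝕜) Finset.univ h)
  intro B hB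
  refine (h' B hB).subset ?_
  rintro _ ⟨L, hL, rfl⟩
  exact ⟨L, hL, map_sum (bornMk 𝕜 (SmoothFun 𝕜 n M) _ _) _ _⟩

variable [T2Space M] [SecondCountableTopology M]

variable (𝕜 n M r s) in
/-- The map sending `u ⊗ v` to `t ↦ ⟨u, t⟩ v`. -/
def ofFieldTensor (z : BornTensor 𝕜 (SmoothFun 𝕜 n M) (TensorField 𝕜 n M r s)
      (Distribution 𝕜 n M)) :
    BoundedHom 𝕜 (SmoothFun 𝕜 n M) (TensorField 𝕜 n M s r) (Distribution 𝕜 n M) :=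
  -- The lift goes through the tensor distributions because a lift needs a Hausdorff locally convex
  -- target, which this strong dual is.
  curryDual 𝕜 n M r s (toTensorDual 𝕜 n M r s (fieldMulLift 𝕜 n M r s z))

theorem ofFieldTensor_add (z z' : BornTensor 𝕜 (SmoothFun 𝕜 n M) (TensorField 𝕜 n M r s)
    (Distribution 𝕜 n M)) : ofFieldTensor 𝕜 n M r s (z + z') =
      ofFieldTensor 𝕜 n M r s z + ofFieldTensor 𝕜 n M r s z' := by
  simp only [ofFieldTensor, map_add]

theorem ofFieldTensor_bornTmul (u : TensorField 𝕜 n M r s) (v : Distribution 𝕜 n M)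
    (t : TensorField 𝕜 n M s r) :
    (ofFieldTensor 𝕜 n M r s (bornTmul 𝕜 (SmoothFun 𝕜 n M) u v)).toLin t = contractFun u t • v :=
  ContinuousLinearMap.ext fun μ => by
    rw [ofFieldTensor, curryDual_apply, toTensorDual_apply, tensorLift_bornTmul,
      fieldMulLift_bornTmul, fieldMul_apply, contract_tensor, smul_dual_apply]

theorem isBoundedMap_ofFieldTensor : IsBoundedMap 𝕜 (ofFieldTensor 𝕜 n M r s) :=
  isBoundedMap_curryDual.comp
    (isBoundedMap_toTensorDual.comp (isBoundedMap_of_continuous (fieldMulLift 𝕜 n M r s)))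

/-- The map `L ↦ ∑ i, u i ⊗ L (w i)`, with inverse `a ⊗ v ↦ (t ↦ ⟨a, t⟩ v)`, as an isomorphism. -/
def IsFrame.fieldTensorEquiv (hF : IsFrame (1 : SmoothFun 𝕜 n M) u w) :
    BoundedHom 𝕜 (SmoothFun 𝕜 n M) (TensorField 𝕜 n M s r) (Distribution 𝕜 n M)
      ≃ₗ[SmoothFun 𝕜 n M]
    BornTensor 𝕜 (SmoothFun 𝕜 n M) (TensorField 𝕜 n M r s) (Distribution 𝕜 n M) where
  toLinearMap := toFieldTensor u w
  invFun := ofFieldTensor 𝕜 n M r s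
  left_inv L := BoundedHom.ext fun t => ContinuousLinearMap.ext fun μ => by
    change (curryDual 𝕜 n M r s (toTensorDual 𝕜 n M r s (fieldMulLift 𝕜 n M r s
      (∑ i, bornTmul 𝕜 (SmoothFun 𝕜 n M) (u i) (L.toLin (w i)))))).toLin t μ = L.toLin t μ
    -- As a tensor distribution, `∑ i, u i ⊗ L (w i)` is the one already known to curry back to `L`.
    have e : fieldMulLift 𝕜 n M r s (∑ i, bornTmul 𝕜 (SmoothFun 𝕜 n M) (u i) (L.toLin (w i))) =
        ofBoundedHom u w L := by
      rw [map_sum]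
      exact Finset.sum_congr rfl fun i _ => fieldMulLift_bornTmul _ _
    rw [e, curryDual_apply, hF.toTensorDual_ofBoundedHom]
  right_inv z := by
    change toFieldTensor u w (ofFieldTensor 𝕜 n M r s z) = z
    induction z using bornTensor_induction with
    | h0 =>
      have e : ofFieldTensor 𝕜 n M r s 0 = 0 := by simp only [ofFieldTensor, map_zero]
      rw [e, map_zero]
    | ht a v =>
      change ∑ i, bornTmul 𝕜 (SmoothFun 𝕜 n M) (u i)
        ((ofFieldTensor 𝕜 n M r s (bornTmul 𝕜 (SmoothFun 𝕜 n M) a v)).toLin (w i)) = _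
      -- The dual expansion `a = ∑ i, ⟨a, w i⟩ u i` is inserted, and the coefficients are moved to
      -- the second factor by the balancing relation.
      conv_rhs => rw [← hF.sum_smul_dual a, bornTmul_sum_left]
      refine Finset.sum_congr rfl fun i _ => ?_
      rw [ofFieldTensor_bornTmul, bornTmul_smul_left_eq]
    | ha z z' hz hz' => rw [ofFieldTensor_add, map_add, hz, hz']

theorem IsFrame.isBornologicalIso_fieldTensorEquiv (hF : IsFrame (1 : SmoothFun 𝕜 n M) u w) :
    IsBornologicalIso 𝕜 hF.fieldTensorEquiv :=
  ⟨isBoundedMap_toFieldTensor u w, isBoundedMap_ofFieldTensor⟩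

end FrameTensor

end Isomorphisms

end TensorDist
end

open TensorDist in
theorem theorem7p3 (𝕜 : Type*) [RCLike 𝕜] (n : ℕ) (M : Type*) [TopologicalSpace M]
    [ChartedSpace (Euc n) M] [IsManifold (𝓡 n) ∞ M] [T2Space M] [SecondCountableTopology M]
    (r s : ℕ) :
    ∃ (e₁ : TensorDistribution 𝕜 n M r s ≃ₗ[SmoothFun 𝕜 n M]
          StrongDual 𝕜 (BornTensor 𝕜 (SmoothFun 𝕜 n M)
            (TensorField 𝕜 n M s r) (CompDensity 𝕜 n M)))
      (e₂ : StrongDual 𝕜 (BornTensor 𝕜 (SmoothFun 𝕜 n M)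
            (TensorField 𝕜 n M s r) (CompDensity 𝕜 n M)) ≃ₗ[SmoothFun 𝕜 n M]
          BoundedHom 𝕜 (SmoothFun 𝕜 n M) (TensorField 𝕜 n M s r) (Distribution 𝕜 n M))
      (e₃ : BoundedHom 𝕜 (SmoothFun 𝕜 n M) (TensorField 𝕜 n M s r) (Distribution 𝕜 n M)
          ≃ₗ[SmoothFun 𝕜 n M]
          BornTensor 𝕜 (SmoothFun 𝕜 n M) (TensorField 𝕜 n M r s) (Distribution 𝕜 n M)),
      IsBornologicalIso 𝕜 e₁ ∧ IsBornologicalIso 𝕜 e₂ ∧ IsBornologicalIso 𝕜 e₃ ∧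
      (∀ (T : TensorDistribution 𝕜 n M r s) (t : TensorField 𝕜 n M s r) (μ : CompDensity 𝕜 n M)
        (τ : CompTensorDensity 𝕜 n M r s), (∀ x, τ x = t x ⊗ₜ[𝕜] μ x) →
        e₁ T (bornTmul 𝕜 (SmoothFun 𝕜 n M) t μ) = T τ) ∧
      (∀ (S : StrongDual 𝕜 (BornTensor 𝕜 (SmoothFun 𝕜 n M)
            (TensorField 𝕜 n M s r) (CompDensity 𝕜 n M)))
        (t : TensorField 𝕜 n M s r) (μ : CompDensity 𝕜 n M),
        (e₂ S).toLin t μ = S (bornTmul 𝕜 (SmoothFun 𝕜 n M) t μ)) ∧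
      (∀ (u : TensorField 𝕜 n M r s) (v : Distribution 𝕜 n M) (t : TensorField 𝕜 n M s r)
        (f : SmoothFun 𝕜 n M), (∀ x, f x = contraction u t x) →
        (e₃.symm (bornTmul 𝕜 (SmoothFun 𝕜 n M) u v)).toLin t = f • v) := by
  obtain ⟨N, u, w, hF⟩ := exists_isFrame_one 𝕜 n M r s
  refine ⟨hF.tensorDualEquiv, hF.curryEquiv, hF.fieldTensorEquiv,
    hF.isBornologicalIso_tensorDualEquiv, hF.isBornologicalIso_curryEquiv,
    hF.isBornologicalIso_fieldTensorEquiv, fun T t μ τ hτ => ?_, fun S t μ => rfl,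
    fun u v t f hf => ?_⟩
  · have e : τ = (tensorDensityPairing 𝕜 n M r s).pairComp t μ := CompSection.ext hτ
    rw [e, ← tensorLift_bornTmul]
    rfl
  · rw [show f = contractFun u t from SmoothFun.ext hf]
    exact ofFieldTensor_bornTmul u v t
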